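/- **Setting.** Let $n\ge 1$, let $\Omega\subset\mathbb R^n$ be bounded and open, $T>0$ and $0<\epsilon\le\infty$. Put $\Omega_{\mathcal I}=\{y\notin\Omega: |y-x|\le\epsilon\text{ for some }x\in\Omega\}$ and $\tilde\Omega=\Omega\cup\Omega_{\mathcal I}$. Let $\beta:\tilde\Omega\to\mathbb R$ be continuous with $0<\beta_*\le\beta\le\beta^*<1$, and let $$\alpha(x,y)=\frac{y-x}{|y-x|^{n/2+\beta(x)+1}}\,1_{\{|y-x|\le\epsilon\}},\qquad \mathcal D^*u(x,y)=-(u(y)-u(x))\,\alpha(x,y).$$ Let $a=(a_{ij}(t,x,y))$ be a symmetric $n\times n$ matrix with $a_{ij}\in C^1([0,T]\times\mathbb R^n\times\mathbb R^n)$ such that, for some constants $0<a_*$ and $a^*$, for all $t\in[0,T]$, $\xi\in\mathbb R^n$ and all $x,y\in\tilde\Omega$ with $|y-x|\le\epsilon$, $$a_*|\xi|^2\le\sum_{i,j}a_{ij}(t,x,y)\xi_i\xi_j\le a^*|\xi|^2,\qquad \sum_{i,j}\partial_ta_{ij}(t,x,y)\xi_i\xi_j\le a^*|\xi|^2 .$$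 Put $\gamma(t,x,y)=\alpha(x,y)\cdot a(t,x,y)\,\alpha(x,y)$ and $\bar\gamma(t,x,y)=\frac12(\gamma(t,x,y)+\gamma(t,y,x))$. **Spaces.** Let $\|u\|_{H^{\beta(\cdot)}(\tilde\Omega)}=\|u\|_{L^2(\tilde\Omega)}+\Big(\int_{\tilde\Omega}\int_{\tilde\Omega}\frac{(u(y)-u(x))^2}{|y-x|^{n+2\beta(x)}}\,dy\,dx\Big)^{1/2}$. Let $H_c^{\beta(\cdot)}(\tilde\Omega)$ be the space of all $u\in L^2(\tilde\Omega)$ for which this norm is finite and $E_c(u)=0$, where $E_c(u)=\int_{\Omega_{\mathcal I}}u^2\,dx$ in the Dirichlet case and $E_c(u)=\big(\int_{\tilde\Omega}u\,dx\big)^2$ in the Neumann case. In the Neumann case assume $\epsilon<\infty$. The space $L^2(0,T;\tilde H^{2\beta(\cdot)}(\tilde\Omega))$ consists of the $u$ with $u(t)\in L^2(\tilde\Omega)$ and $E_c(u(t))=0$ for a.e. $t$ for which $$\|u\|_{L^2(0,T;\tilde H^{2\beta(\cdot)}(\tilde\Omega))}^2:=\int_0^T\int_\Omega\Big|\,\mathrm{p.v.}\!\int_{\tilde\Omega}(u(y,t)-u(x,t))\,\bar\gamma(t,x,y)\,dy\Big|^2dx\,dt<\infty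 .$$ Here the principal value at time $t$ is the function $g(t)$ on $\Omega$ such that, for every $\varphi$ of finite $H^{\beta(\cdot)}(\tilde\Omega)$ norm that vanishes a.e. on $\Omega_{\mathcal I}$, $$\lim_{\delta\to0^+}\int_\Omega\varphi(x)\int_{\tilde\Omega\cap\{|y-x|>\delta\}}(u(y,t)-u(x,t))\,\bar\gamma(t,x,y)\,dy\,dx=\int_\Omega g(t)\,\varphi\,dx ,$$ and membership in the space includes that such a $g(t)$ exists for a.e. $t$, with $g\in L^2(\Omega\times(0,T))$. **Weak solutions.** Let $P=\Omega$ or $P=\tilde\Omega$ (in the Dirichlet case both choices give the same notion). A weak solution with data $f,u_0$ is a function $u\in L^2(0,T;H_c^{\beta(\cdot)}(\tilde\Omega))$ with $u'\in L^2(0,T;(H_c^{\beta(\cdot)}(\tilde\Omega))^*)$ (duality with respect to the $L^2(\tilde\Omega)$ pairing) such that $u(0)=u_0$ and, for all $\varphi\in H_c^{\beta(\cdot)}(\tilde\Omega)$ and a.e. $t\in(0,T)$, $$\int_P\partial_tu\,\varphi\,dx+\int_{\tilde\Omega}\int_{\tilde\Omega}\mathcal D^*u\cdot\big(a(t,x,y)\,\mathcal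 D^*\varphi\big)\,dy\,dx=\int_Pf\varphi\,dx ,$$ where $\int_P\partial_tu\,\varphi\,dx$ is the weak derivative of $t\mapsto\int_Pu\varphi\,dx$, and $u(0)$ is the value at $0$ of the version of $u$ in $C([0,T];L^2(\tilde\Omega))$. **Theorem 2.3.** There is a constant $C>0$, depending only on $T$, $\Omega$, $\epsilon$ and $a$, such that the following holds in both the Dirichlet and the Neumann case. If $u_0\in H_c^{\beta(\cdot)}(\tilde\Omega)$, $f\in L^2(0,T;L^2(\tilde\Omega))$ and $u$ is a weak solution with data $f,u_0$, then (after modification on a null set of times) $$u\in C([0,T];H_c^{\beta(\cdot)}(\tilde\Omega))\cap L^2(0,T;\tilde H^{2\beta(\cdot)}(\tilde\Omega)),\qquad \partial_tu\in L^2(0,T;L^2(\Omega)),$$ and $$\sup_{0\le t\le T}\|u(\cdot,t)\|_{H^{\beta(\cdot)}(\tilde\Omega)}+\|\partial_tu\|_{L^2(0,T;L^2(\Omega))}+\|u\|_{L^2(0,T;\tilde H^{2\beta(\cdot)}(\tilde\Omega))}\le C\left(\|f\|_{L^2(0,T;L^2(\tilde\Omega))}+\|u_0\|_{H^{\beta(\cdot)}(\tilde\Omega)}\right).$$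 -/

import Mathlib

open Set Filter Topology MeasureTheory
open scoped ENNReal Matrix ContDiff

noncomputable section

namespace NonlocalDiffusion

/-- The Euclidean space of dimension `n`. -/
abbrev Space (n : ℕ) := EuclideanSpace ℝ (Fin n)

/-! ### Geometry, kernel and nonlocal gradient -/

section Kernel

variable {n : ℕ}

/-- The vector kernel `α(x,y) = (y - x) / |y - x| ^ (n/2 + β(x) + 1)` for `|y - x| ≤ ε`, and `0`
otherwise. The horizon `ε` may be infinite. -/
def alpha (β : Space n → ℝ) (ε : ℝ≥0∞) (x y : Space n) : Space n :=
  open Classical in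
  if edist y x ≤ ε then (dist y x ^ ((n : ℝ) / 2 + β x + 1))⁻¹ • (y - x) else 0

/-- The interaction domain `Ω_I`: the points outside `Ω` that interact with a point of `Ω`. For
`x ∈ Ω` and `y ∉ Ω` one has `α(x,y) ≠ 0` exactly when `|y - x| ≤ ε`. -/
def interactionDomain (ε : ℝ≥0∞) (Ω : Set (Space n)) : Set (Space n) :=
  {y | y ∉ Ω ∧ ∃ x ∈ Ω, edist y x ≤ ε}

/-- `Ω̃ = Ω ∪ Ω_I`. -/
def totalDomain (ε : ℝ≥0∞) (Ω : Set (Space n)) : Set (Space n) :=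
  Ω ∪ interactionDomain ε Ω

/-- The adjoint nonlocal divergence `D*(u)(x,y) = -(u(y) - u(x)) α(x,y)`. -/
def Dstar (β : Space n → ℝ) (ε : ℝ≥0∞) (u : Space n → ℝ) (x y : Space n) : Space n :=
  (-(u y - u x)) • alpha β ε x y

/-- The scalar kernel `γ(t,x,y) = α(x,y) · (a(t,x,y) α(x,y))`. -/
def gamma (β : Space n → ℝ) (ε : ℝ≥0∞)
    (a : ℝ → Space n → Space n → Matrix (Fin n) (Fin n) ℝ) (t : ℝ) (x y : Space n) : ℝ :=
  (alpha β ε x y).ofLp ⬝ᵥ (a t x y *ᵥ (alpha β ε x y).ofLp)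

/-- The symmetrized kernel `(γ(t,x,y) + γ(t,y,x)) / 2`. It equals `γ` as soon as `α` is
antisymmetric and `a(t,x,y) = a(t,y,x)`, and it generates the same bilinear form as `γ`. -/
def gammaSymm (β : Space n → ℝ) (ε : ℝ≥0∞)
    (a : ℝ → Space n → Space n → Matrix (Fin n) (Fin n) ℝ) (t : ℝ) (x y : Space n) : ℝ :=
  (gamma β ε a t x y + gamma β ε a t y x) / 2

/-- The bilinear form `∫_Ω̃ ∫_Ω̃ D*(u) · (a(t,x,y) D*(φ)) dy dx`. -/
def nonlocalForm (β : Space n → ℝ) (ε : ℝ≥0∞) (Ω : Set (Space n))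
    (a : ℝ → Space n → Space n → Matrix (Fin n) (Fin n) ℝ) (t : ℝ) (u φ : Space n → ℝ) : ℝ :=
  ∫ x in totalDomain ε Ω, ∫ y in totalDomain ε Ω,
    (Dstar β ε u x y).ofLp ⬝ᵥ (a t x y *ᵥ (Dstar β ε φ x y).ofLp)

/-- The standing assumptions on the diffusion tensor `a` on `[0,T]`: entries of class `C¹` on
`[0,T] × ℝⁿ × ℝⁿ`, symmetry, uniform ellipticity with constants `aLow`, `aUp`, and an upper bound
for the time derivative, for all `x, y ∈ Ω̃` with `|y - x| ≤ ε`. -/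
structure AdmissibleTensor (ε : ℝ≥0∞) (Ω : Set (Space n)) (T : ℝ)
    (a : ℝ → Space n → Space n → Matrix (Fin n) (Fin n) ℝ) (aLow aUp : ℝ) : Prop where
  contDiffOn : ∀ i j, ContDiffOn ℝ 1
    (fun p : ℝ × Space n × Space n => a p.1 p.2.1 p.2.2 i j) (Icc 0 T ×ˢ univ)
  symm : ∀ t ∈ Icc 0 T, ∀ x y i j, a t x y i j = a t x y j i
  low_pos : 0 < aLow
  lower : ∀ t ∈ Icc 0 T, ∀ x ∈ totalDomain ε Ω, ∀ y ∈ totalDomain ε Ω, edist y x ≤ ε →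
    ∀ ξ : Space n, aLow * ‖ξ‖ ^ 2 ≤ ∑ i, ∑ j, a t x y i j * ξ i * ξ j
  upper : ∀ t ∈ Icc 0 T, ∀ x ∈ totalDomain ε Ω, ∀ y ∈ totalDomain ε Ω, edist y x ≤ ε →
    ∀ ξ : Space n, ∑ i, ∑ j, a t x y i j * ξ i * ξ j ≤ aUp * ‖ξ‖ ^ 2
  deriv_upper : ∀ t ∈ Icc 0 T, ∀ x ∈ totalDomain ε Ω, ∀ y ∈ totalDomain ε Ω, edist y x ≤ ε →
    ∀ ξ : Space n,
      ∑ i, ∑ j, derivWithin (fun s => a s x y i j) (Icc 0 T) t * ξ i * ξ j ≤ aUp * ‖ξ‖ ^ 2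

end Kernel

/-! ### Variable-order Sobolev spaces -/

section Sobolev

variable {n : ℕ}

/-- The squared seminorm `∫_S ∫_S (u(y) - u(x))² / |y - x| ^ (n + 2β(x)) dy dx`. -/
def seminormSq (β : Space n → ℝ) (S : Set (Space n)) (u : Space n → ℝ) : ℝ≥0∞ :=
  ∫⁻ x in S, ∫⁻ y in S, ENNReal.ofReal ((u y - u x) ^ 2 / dist y x ^ ((n : ℝ) + 2 * β x))

/-- The norm `‖u‖_{L²(S)} + |u|_{H^{β(·)}(S)}`, with values in `[0,∞]`. -/
def sobolevNorm (β : Space n → ℝ) (S : Set (Space n)) (u : Space n → ℝ) : ℝ≥0∞ :=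
  eLpNorm u 2 (volume.restrict S) + seminormSq β S u ^ (1 / 2 : ℝ)

/-- `u ∈ H^{β(·)}(S)`. -/
def MemSobolev (β : Space n → ℝ) (S : Set (Space n)) (u : Space n → ℝ) : Prop :=
  MemLp u 2 (volume.restrict S) ∧ seminormSq β S u < ⊤

/-- The two kinds of volume constraint. -/
inductive Constraint
  | dirichlet
  | neumann

/-- The constraint functional `E_c`. -/
def constraintFunctional (c : Constraint) (ε : ℝ≥0∞) (Ω : Set (Space n)) (u : Space n → ℝ) : ℝ :=
  match c with
  | .dirichlet => ∫ x in interactionDomain ε Ω, u x ^ 2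
  | .neumann => (∫ x in totalDomain ε Ω, u x) ^ 2

/-- `u ∈ H_c^{β(·)}(Ω̃)`. -/
def MemSobolevC (c : Constraint) (β : Space n → ℝ) (ε : ℝ≥0∞) (Ω : Set (Space n))
    (u : Space n → ℝ) : Prop :=
  MemSobolev β (totalDomain ε Ω) u ∧ constraintFunctional c ε Ω u = 0

end Sobolev

/-! ### Functions of time and space -/

section Evolution

variable {n : ℕ}

/-- Lebesgue measure on `(0,T) × S`; `L²(0,T;L²(S))` is the `L²` space of this measure. -/
def cylinder (T : ℝ) (S : Set (Space n)) : Measure (ℝ × Space n) :=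
  (volume.restrict (Ioo 0 T)).prod (volume.restrict S)

/-- The scalar function `d` is the weak derivative of `g` on the interval `(0,T)`. -/
def HasWeakDeriv (T : ℝ) (g d : ℝ → ℝ) : Prop :=
  IntegrableOn g (Ioo 0 T) ∧ IntegrableOn d (Ioo 0 T) ∧
    ∀ ψ : ℝ → ℝ, ContDiff ℝ ∞ ψ → HasCompactSupport ψ → tsupport ψ ⊆ Ioo 0 T →
      ∫ t in Ioo 0 T, g t * deriv ψ t = -∫ t in Ioo 0 T, d t * ψ t

/-- `v` is a version of `u`, that is, `v(t) = u(t)` almost everywhere on `S` for almost every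
`t ∈ (0,T)`. -/
def IsVersion (T : ℝ) (S : Set (Space n)) (v u : ℝ → Space n → ℝ) : Prop :=
  ∀ᵐ t ∂(volume.restrict (Ioo 0 T)), v t =ᵐ[volume.restrict S] u t

/-- `u ∈ L²(0,T;H_c^{β(·)}(Ω̃))`. -/
def MemL2Sobolev (c : Constraint) (β : Space n → ℝ) (ε : ℝ≥0∞) (Ω : Set (Space n)) (T : ℝ)
    (u : ℝ → Space n → ℝ) : Prop :=
  AEStronglyMeasurable (Function.uncurry u) (cylinder T (totalDomain ε Ω)) ∧
  (∀ᵐ t ∂(volume.restrict (Ioo 0 T)), MemSobolevC c β ε Ω (u t)) ∧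
  ∫⁻ t in Ioo 0 T, sobolevNorm β (totalDomain ε Ω) (u t) ^ 2 < ⊤

/-- `u' ∈ L²(0,T;(H_c^{β(·)}(Ω̃))*)`, where the dual is taken with respect to the `L²(Ω̃)` pairing:
`F t` is the functional `u'(t)` and `m t` bounds its norm. -/
def HasDualTimeDeriv (c : Constraint) (β : Space n → ℝ) (ε : ℝ≥0∞) (Ω : Set (Space n)) (T : ℝ)
    (u : ℝ → Space n → ℝ) : Prop :=
  ∃ (F : ℝ → (Space n → ℝ) → ℝ) (m : ℝ → ℝ),
    MemLp m 2 (volume.restrict (Ioo 0 T)) ∧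
    (∀ᵐ t ∂(volume.restrict (Ioo 0 T)),
      (∀ φ ψ, MemSobolevC c β ε Ω φ → MemSobolevC c β ε Ω ψ → ∀ r s : ℝ,
        F t (fun x => r * φ x + s * ψ x) = r * F t φ + s * F t ψ) ∧
      (∀ φ, MemSobolevC c β ε Ω φ →
        |F t φ| ≤ m t * (sobolevNorm β (totalDomain ε Ω) φ).toReal)) ∧
    ∀ φ, MemSobolevC c β ε Ω φ →
      HasWeakDeriv T (fun t => ∫ x in totalDomain ε Ω, u t x * φ x) (fun t => F t φ)

/-- `u(0) = u₀`: the version of `u` in `C([0,T];L²(S))` takes the value `u₀` at time `0`. -/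
def HasInitialValue (T : ℝ) (S : Set (Space n)) (u : ℝ → Space n → ℝ) (u₀ : Space n → ℝ) : Prop :=
  ∃ v : ℝ → Space n → ℝ, IsVersion T S v u ∧
    (∀ t ∈ Icc 0 T, MemLp (v t) 2 (volume.restrict S)) ∧
    (∀ s ∈ Icc 0 T, Tendsto (fun t => eLpNorm (v t - v s) 2 (volume.restrict S))
      (𝓝[Icc 0 T] s) (𝓝 0)) ∧
    v 0 =ᵐ[volume.restrict S] u₀

/-- Weak solutions: `u ∈ L²(0,T;H_c)` with `u' ∈ L²(0,T;H_c*)`, `u(0) = u₀`, and for all `φ ∈ H_c`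
and almost every `t`,
`∫_P ∂ₜu φ dx + ∫_Ω̃ ∫_Ω̃ D*(u) · (a D*(φ)) dy dx = ∫_P f φ dx`.
The set `P` is the region over which the two single integrals are taken. -/
structure IsWeakSolution (c : Constraint) (β : Space n → ℝ) (ε : ℝ≥0∞) (Ω P : Set (Space n))
    (T : ℝ) (a : ℝ → Space n → Space n → Matrix (Fin n) (Fin n) ℝ)
    (f : ℝ → Space n → ℝ) (u₀ : Space n → ℝ) (u : ℝ → Space n → ℝ) : Prop where
  memL2 : MemL2Sobolev c β ε Ω T u
  dualDeriv : HasDualTimeDeriv c β ε Ω T u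
  initial : HasInitialValue T (totalDomain ε Ω) u u₀
  equation : ∀ φ, MemSobolevC c β ε Ω φ → ∃ d : ℝ → ℝ,
    HasWeakDeriv T (fun t => ∫ x in P, u t x * φ x) d ∧
    ∀ᵐ t ∂(volume.restrict (Ioo 0 T)),
      d t + nonlocalForm β ε Ω a t (u t) φ = ∫ x in P, f t x * φ x

/-- `u ∈ C([0,T];H_c^{β(·)}(Ω̃))`. -/
def IsContinuousSobolev (c : Constraint) (β : Space n → ℝ) (ε : ℝ≥0∞) (Ω : Set (Space n)) (T : ℝ)
    (u : ℝ → Space n → ℝ) : Prop :=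
  (∀ t ∈ Icc 0 T, MemSobolevC c β ε Ω (u t)) ∧
  ∀ s ∈ Icc 0 T, Tendsto (fun t => sobolevNorm β (totalDomain ε Ω) (u t - u s))
    (𝓝[Icc 0 T] s) (𝓝 0)

/-- `w = ∂ₜu` on `Ω × (0,T)` in the weak sense, with `w ∈ L²(0,T;L²(Ω))`. -/
def HasL2TimeDeriv (Ω : Set (Space n)) (T : ℝ) (u w : ℝ → Space n → ℝ) : Prop :=
  MemLp (Function.uncurry w) 2 (cylinder T Ω) ∧
  ∀ h : Space n → ℝ, MemLp h 2 (volume.restrict Ω) →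
    HasWeakDeriv T (fun t => ∫ x in Ω, u t x * h x) (fun t => ∫ x in Ω, w t x * h x)

/-- The truncated singular integral `∫_{y ∈ Ω̃, |y - x| > δ} (u(y) - u(x)) γ(t,x,y) dy`, with the
symmetrized kernel. -/
def truncatedOperator (β : Space n → ℝ) (ε : ℝ≥0∞) (Ω : Set (Space n))
    (a : ℝ → Space n → Space n → Matrix (Fin n) (Fin n) ℝ) (t δ : ℝ) (u : Space n → ℝ)
    (x : Space n) : ℝ :=
  ∫ y in totalDomain ε Ω ∩ {y | δ < dist y x}, (u y - u x) * gammaSymm β ε a t x y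

/-- On `Ω`, the function `g` is the principal value of the singular integral
`∫_Ω̃ (u(y) - u(x)) γ(t,x,y) dy` in the weak sense: the truncated integrals converge to `g` when
tested against functions of finite energy that vanish outside `Ω`. These include the smooth
functions with compact support in `Ω`, so `g` is unique almost everywhere on `Ω`. -/
def IsPrincipalValue (β : Space n → ℝ) (ε : ℝ≥0∞) (Ω : Set (Space n))
    (a : ℝ → Space n → Space n → Matrix (Fin n) (Fin n) ℝ) (t : ℝ) (u g : Space n → ℝ) : Prop :=
  ∀ φ, MemSobolevC .dirichlet β ε Ω φ →
    Tendsto (fun δ => ∫ x in Ω, truncatedOperator β ε Ω a t δ u x * φ x) (𝓝[>] 0)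
      (𝓝 (∫ x in Ω, g x * φ x))

/-- `u ∈ L²(0,T;H̃^{2β(·)}(Ω̃))`, where `g(t)` is the singular integral
`∫_Ω̃ (u(y,t) - u(x,t)) γ(t,x,y) dy` on `Ω`; the norm of `u` is the `L²(Ω × (0,T))` norm of `g`. -/
def MemTildeSpace (c : Constraint) (β : Space n → ℝ) (ε : ℝ≥0∞) (Ω : Set (Space n)) (T : ℝ)
    (a : ℝ → Space n → Space n → Matrix (Fin n) (Fin n) ℝ) (u g : ℝ → Space n → ℝ) : Prop :=
  (∀ᵐ t ∂(volume.restrict (Ioo 0 T)), MemLp (u t) 2 (volume.restrict (totalDomain ε Ω)) ∧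
    constraintFunctional c ε Ω (u t) = 0) ∧
  MemLp (Function.uncurry g) 2 (cylinder T Ω) ∧
  ∀ᵐ t ∂(volume.restrict (Ioo 0 T)), IsPrincipalValue β ε Ω a t (u t) (g t)

end Evolution

end NonlocalDiffusion

end

open NonlocalDiffusion

open Set Filter Topology MeasureTheory
open scoped ENNReal Matrix ContDiff
noncomputable section
namespace NonlocalDiffusion

set_option linter.unusedSectionVars false

/-! ### Steklov averages -/

section Steklov

variable {E : Type*} [NormedAddCommGroup E]

/-! Formally the theorem is the energy identity obtained by testing the equation with ∂ₜu. If B_t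
denotes the nonlocal form, then d/dt B_t(u,u) = 2(f − ∂ₜu, ∂ₜu) + (∂ₜB_t)(u,u). Here 2(f − ∂ₜu, ∂ₜu)
≤ ‖f‖² − ‖∂ₜu‖², and (∂ₜB_t)(u,u) is bounded above by a multiple of the energy, so Grönwall's
inequality bounds the energy and ∫‖∂ₜu‖² together. The work lies in justifying this: a priori ∂ₜu is
only a functional on the energy space, and on an unbounded domain the coefficients are controlled in
time from one side only.

Setting. The increment u(y) − u(x) is regarded as an element of L² of the singular measure
`jumpMeasure`. This makes H_c a closed subspace of a product of two L² spaces (`EnergySpace`) and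
turns B_t into ∫ κ_t f g with a bounded weight κ_t (`tensorWeight`). By `exists_energy_le` the full
norm is controlled by the interactions up to the horizon and the L²(Ω) norm, with a constant that
depends on the geometry but not on the order β.

Splitting. On a large ball the coefficients are Lipschitz in time. For pairs that leave the ball, a
Dirichlet function has a nonzero increment only at distance more than 1/2, where the kernel is
integrable, so this part of the form is bounded on L². In the Neumann case the domain is bounded and
the second part vanishes. Thus B = N + M with N Lipschitz in operator norm and M of lower order
(`exists_splitForm`).

Regularity. The equation integrated over (t − h, t) is tested with a difference quotient of u
(`IsAbstractSolution.quotient_inequality`). This bounds the Steklov averages in the energy space and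
the quotients in L², uniformly in h (`IsAbstractSolution.exists_quotient_bound`). Weak limits give
∂ₜu ∈ L² (`exists_weak_time_deriv`) and a bounded, weakly continuous trajectory in the energy space.

Energy inequality. `energy_inequality` avoids any chain rule. Convexity bounds b_t(v_t,v_t) −
b_t(v_{t−h},v_{t−h}) by 2b_t(v_t, v_t − v_{t−h}), which the equation expresses through averages of
∂ₜu, and then h → 0. Applied to N forwards and backwards in time it shows that the energy is
continuous, so weak continuity becomes strong (`IsAbstractSolution.continuousOn_trajectory`).
Applied to N + M, for which only the upper bound of the time derivative is needed, it yields the a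
priori estimate `IsAbstractSolution.energy_bound`. Its constant involves neither the Lipschitz
constant of N nor the bounds on M, and this keeps β out of the final constant.

Principal value. Tested with functions vanishing outside Ω, the truncated integrals are −1/2 times
truncated forms and converge (`tendsto_truncatedOperator`). The equation then identifies the limit
as −1/2 (f − ∂ₜu), corrected in the Neumann case by a constant in space, because the test functions
there must have mean zero. -/

/-- The backward Steklov average `h⁻¹ ∫_{t-h}^t w`. -/
def steklov [NormedSpace ℝ E] (h : ℝ) (w : ℝ → E) (t : ℝ) : E := h⁻¹ • ∫ τ in (t - h)..t, w τ

lemma locallyIntegrable_of_memLp_two {w : ℝ → E} (hw : MemLp w 2 volume) :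
    LocallyIntegrable w volume := hw.locallyIntegrable (by norm_num)

lemma intervalIntegrable_of_memLp_two {w : ℝ → E} (hw : MemLp w 2 volume) (s t : ℝ) :
    IntervalIntegrable w volume s t :=
  ((locallyIntegrable_of_memLp_two hw).integrableOn_isCompact isCompact_uIcc).intervalIntegrable

lemma integrable_norm_sq {α : Type*} [MeasurableSpace α] {μ : Measure α} {w : α → E}
    (hw : MemLp w 2 μ) : Integrable (fun t => ‖w t‖ ^ 2) μ := by
  simpa using hw.integrable_norm_pow (by norm_num : (2 : ℕ) ≠ 0)

lemma continuous_steklov [NormedSpace ℝ E] {w : ℝ → E} (hw : LocallyIntegrable w volume) (h : ℝ) :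
    Continuous (steklov h w) := by
  have h0 : ∀ s t, IntervalIntegrable w volume s t := fun s t =>
    (hw.integrableOn_isCompact isCompact_uIcc).intervalIntegrable
  have h1 : Continuous fun t => ∫ τ in (0 : ℝ)..t, w τ :=
    intervalIntegral.continuous_primitive h0 0
  have h2 : steklov h w = fun t => h⁻¹ • ((∫ τ in (0 : ℝ)..t, w τ) - ∫ τ in (0 : ℝ)..(t - h), w τ) := by
    ext t
    rw [intervalIntegral.integral_interval_sub_left (h0 _ _) (h0 _ _)]; rfl
  rw [h2]
  fun_prop

/-- Jensen's inequality for the average, read off from the nonnegativity of the variance ∫ (g − m)².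
-/
lemma sq_intervalIntegral_le {g : ℝ → ℝ} (hg : MemLp g 2 volume) {h : ℝ} (hh : 0 < h) (t : ℝ) :
    (h⁻¹ * ∫ τ in (t - h)..t, g τ) ^ 2 ≤ h⁻¹ * ∫ τ in (t - h)..t, g τ ^ 2 := by
  have hi := intervalIntegrable_of_memLp_two hg (t - h) t
  have hi2 : IntervalIntegrable (fun τ => g τ ^ 2) volume (t - h) t :=
    hg.integrable_sq.intervalIntegrable
  set m := h⁻¹ * ∫ τ in (t - h)..t, g τ with hm
  have h0 : 0 ≤ ∫ τ in (t - h)..t, (g τ - m) ^ 2 :=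
    intervalIntegral.integral_nonneg (by linarith) fun τ _ => sq_nonneg _
  have h1 : ∫ τ in (t - h)..t, (g τ - m) ^ 2
      = (∫ τ in (t - h)..t, g τ ^ 2) - 2 * m * (∫ τ in (t - h)..t, g τ) + h * m ^ 2 := by
    have : ∀ τ, (g τ - m) ^ 2 = g τ ^ 2 - 2 * m * g τ + m ^ 2 := fun τ => by ring
    simp_rw [this]
    rw [intervalIntegral.integral_add (hi2.sub (hi.const_mul _)) (by simp),
      intervalIntegral.integral_sub hi2 (hi.const_mul _), intervalIntegral.integral_const_mul]
    simp
  have h2 : (∫ τ in (t - h)..t, g τ) = h * m := by rw [hm]; field_simp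
  rw [h1, h2] at h0
  have h3 : h * m ^ 2 ≤ ∫ τ in (t - h)..t, g τ ^ 2 := by nlinarith
  calc m ^ 2 = h⁻¹ * (h * m ^ 2) := by field_simp
    _ ≤ _ := by gcongr

/-- Tonelli: a time τ lies in the window (t − h, t] exactly for t in [τ, τ + h), a set of measure h.
-/
lemma lintegral_average {g : ℝ → ℝ≥0∞} (hg : AEMeasurable g volume) (h : ℝ) :
    ∫⁻ t, ∫⁻ τ in Ioc (t - h) t, g τ = ENNReal.ofReal h * ∫⁻ τ, g τ := by
  have h1 : ∀ t, ∫⁻ τ in Ioc (t - h) t, g τ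
      = ∫⁻ τ, {p : ℝ × ℝ | p.1 - h < p.2 ∧ p.2 ≤ p.1}.indicator (fun p => g p.2) (t, τ) := by
    intro t
    rw [← lintegral_indicator measurableSet_Ioc]
    rfl
  have hS : MeasurableSet {p : ℝ × ℝ | p.1 - h < p.2 ∧ p.2 ≤ p.1} :=
    (measurableSet_lt (measurable_fst.sub_const h) measurable_snd).inter
      (measurableSet_le measurable_snd measurable_fst)
  simp_rw [h1]
  rw [lintegral_lintegral_swap]
  · have h2 : ∀ τ, ∫⁻ t, {p : ℝ × ℝ | p.1 - h < p.2 ∧ p.2 ≤ p.1}.indicator (fun p => g p.2) (t, τ)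
        = ENNReal.ofReal h * g τ := by
      intro τ
      have : (fun t => {p : ℝ × ℝ | p.1 - h < p.2 ∧ p.2 ≤ p.1}.indicator (fun p => g p.2) (t, τ))
          = (Ico τ (τ + h)).indicator fun _ => g τ := by
        ext t
        simp only [indicator, mem_ofPred_eq, mem_Ico]
        congr 1
        apply propext
        constructor <;> rintro ⟨a, b⟩ <;> constructor <;> linarith
      rw [this, lintegral_indicator measurableSet_Ico, setLIntegral_const, Real.volume_Ico,
        mul_comm]
      simp
    simp_rw [h2]
    rw [lintegral_const_mul'' _ hg]
  · exact (AEMeasurable.comp_snd hg).indicator hS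

lemma integral_average {g : ℝ → ℝ} (hg : Integrable g) (h0 : ∀ t, 0 ≤ g t) {h : ℝ} (hh : 0 < h) :
    Integrable (steklov h g) ∧ ∫ t, steklov h g t = ∫ t, g t := by
  have hc := continuous_steklov hg.locallyIntegrable h
  have hn : ∀ t, 0 ≤ steklov h g t := fun t =>
    smul_nonneg (by positivity) (intervalIntegral.integral_nonneg (by linarith) fun τ _ => h0 τ)
  have key : ∫⁻ t, ENNReal.ofReal (steklov h g t) = ∫⁻ t, ENNReal.ofReal (g t) := by
    have : ∀ t, ENNReal.ofReal (steklov h g t)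
        = ENNReal.ofReal h⁻¹ * ∫⁻ τ in Ioc (t - h) t, ENNReal.ofReal (g τ) := by
      intro t
      rw [steklov, smul_eq_mul, ENNReal.ofReal_mul (by positivity),
        intervalIntegral.integral_of_le (by linarith),
        ofReal_integral_eq_lintegral_ofReal hg.integrableOn (ae_of_all _ h0)]
    simp_rw [this]
    rw [lintegral_const_mul' _ _ ENNReal.ofReal_ne_top,
      lintegral_average hg.aemeasurable.ennreal_ofReal h, ← mul_assoc,
      ← ENNReal.ofReal_mul (by positivity), inv_mul_cancel₀ hh.ne']
    simp
  constructor
  · refine ⟨hc.aestronglyMeasurable, ?_⟩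
    rw [hasFiniteIntegral_iff_ofReal (ae_of_all _ hn), key]
    exact hg.lintegral_lt_top
  · rw [integral_eq_lintegral_of_nonneg_ae (ae_of_all _ hn) hc.aestronglyMeasurable, key,
      ← integral_eq_lintegral_of_nonneg_ae (ae_of_all _ h0) hg.aestronglyMeasurable]

lemma norm_steklov_le [NormedSpace ℝ E] (w : ℝ → E) {h : ℝ} (hh : 0 < h) (t : ℝ) :
    ‖steklov h w t‖ ≤ steklov h (fun τ => ‖w τ‖) t := by
  rw [steklov, steklov, norm_smul, smul_eq_mul, Real.norm_of_nonneg (by positivity)]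
  gcongr
  exact intervalIntegral.norm_integral_le_integral_norm (by linarith)

lemma norm_steklov_sq_le [NormedSpace ℝ E] {w : ℝ → E} (hw : MemLp w 2 volume) {h : ℝ} (hh : 0 < h)
    (t : ℝ) : ‖steklov h w t‖ ^ 2 ≤ steklov h (fun τ => ‖w τ‖ ^ 2) t :=
  (pow_le_pow_left₀ (norm_nonneg _) (norm_steklov_le w hh t) 2).trans
    (sq_intervalIntegral_le hw.norm hh t)

lemma memLp_steklov [NormedSpace ℝ E] {w : ℝ → E} (hw : MemLp w 2 volume) {h : ℝ} (hh : 0 < h) :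
    MemLp (steklov h w) 2 volume ∧ ∫ t, ‖steklov h w t‖ ^ 2 ≤ ∫ t, ‖w t‖ ^ 2 := by
  have h1 := integral_average (integrable_norm_sq hw) (fun t => by positivity) hh
  have hm := (continuous_steklov (locallyIntegrable_of_memLp_two hw) h).aestronglyMeasurable
    (μ := volume)
  have h2 : Integrable (fun t => ‖steklov h w t‖ ^ 2) volume :=
    h1.1.mono' (hm.norm.pow 2) (ae_of_all _ fun t => by
      simpa using norm_steklov_sq_le hw hh t)
  exact ⟨(memLp_two_iff_integrable_sq_norm hm).2 h2,
    (integral_mono h2 h1.1 fun t => norm_steklov_sq_le hw hh t).trans h1.2.le⟩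

lemma ae_tendsto_steklov [NormedSpace ℝ E] [CompleteSpace E] {w : ℝ → E}
    (hw : LocallyIntegrable w volume) :
    ∀ᵐ t, Tendsto (fun h => steklov h w t) (𝓝[>] 0) (𝓝 (w t)) := by
  filter_upwards [_root_.LocallyIntegrable.ae_hasDerivAt_integral hw] with t ht
  have h1 := (ht 0).tendsto_slope
  have h2 : Tendsto (fun h : ℝ => t - h) (𝓝[>] 0) (𝓝[≠] t) := by
    rw [tendsto_nhdsWithin_iff]
    constructor
    · have : Tendsto (fun h : ℝ => t - h) (𝓝 0) (𝓝 (t - 0)) :=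
        tendsto_const_nhds.sub tendsto_id
      rw [sub_zero] at this
      exact this.mono_left nhdsWithin_le_nhds
    · filter_upwards [self_mem_nhdsWithin] with h hh
      simp only [mem_Ioi] at hh
      simp [hh.ne']
  refine (h1.comp h2).congr' ?_
  filter_upwards [self_mem_nhdsWithin] with h hh
  simp only [mem_Ioi] at hh
  have h0 : ∀ s t, IntervalIntegrable w volume s t := fun s t =>
    (hw.integrableOn_isCompact isCompact_uIcc).intervalIntegrable
  simp only [Function.comp, slope, vsub_eq_sub, steklov]
  rw [intervalIntegral.integral_interval_sub_left (h0 _ _) (h0 _ _),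
    intervalIntegral.integral_symm]
  simp

end Steklov

/-! ### Weak convergence of Steklov averages -/

section SteklovInner

variable {L : Type*} [NormedAddCommGroup L] [InnerProductSpace ℝ L]

lemma integrable_inner {α : Type*} [MeasurableSpace α] {μ : Measure α} {a w : α → L}
    (ha : MemLp a 2 μ) (hw : MemLp w 2 μ) : Integrable (fun t => inner ℝ (a t) (w t)) μ := by
  refine (((integrable_norm_sq ha)).add ((integrable_norm_sq hw))).mono'
    (ha.1.inner hw.1) (ae_of_all _ fun t => ?_)
  have := norm_inner_le_norm (𝕜 := ℝ) (a t) (w t)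
  simp only [Pi.add_apply]
  nlinarith [sq_nonneg (‖a t‖ - ‖w t‖), norm_nonneg (a t), norm_nonneg (w t)]

/-- Steklov averages converge weakly in `L²`, upper bound. -/
lemma eventually_integral_inner_steklov_le [CompleteSpace L] {a w : ℝ → L} (ha : MemLp a 2 volume)
    (hw : MemLp w 2 volume) {h : ℕ → ℝ} (hpos : ∀ k, 0 < h k) (hlim : Tendsto h atTop (𝓝 0))
    {η : ℝ} (hη : 0 < η) :
    ∀ᶠ k in atTop, ∫ t, inner ℝ (a t) (steklov (h k) w t) ≤ (∫ t, inner ℝ (a t) (w t)) + η := by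
  have hlim' : Tendsto h atTop (𝓝[>] 0) :=
    tendsto_nhdsWithin_iff.2 ⟨hlim, Eventually.of_forall hpos⟩
  have hS := fun k => memLp_steklov hw (hpos k)
  -- Averaging is a contraction of L² that converges almost everywhere. In 2⟨a, S_h w⟩ = ‖a‖² + ‖S_h
  -- w‖² − ‖a − S_h w‖² the middle term is at most ‖w‖², and Fatou controls the last one.
  have fatou : ∫⁻ t, ENNReal.ofReal (‖a t - w t‖ ^ 2)
      ≤ liminf (fun k => ∫⁻ t, ENNReal.ofReal (‖a t - steklov (h k) w t‖ ^ 2)) atTop := by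
    refine le_trans (le_of_eq ?_) (lintegral_liminf_le' fun k =>
      ((ha.1.sub (hS k).1.1).norm.aemeasurable.pow_const 2).ennreal_ofReal)
    refine lintegral_congr_ae ?_
    filter_upwards [ae_tendsto_steklov (locallyIntegrable_of_memLp_two hw)] with t ht
    have h1 : Tendsto (fun k => ENNReal.ofReal (‖a t - steklov (h k) w t‖ ^ 2)) atTop
        (𝓝 (ENNReal.ofReal (‖a t - w t‖ ^ 2))) :=
      (ENNReal.continuous_ofReal.tendsto _).comp
        (((tendsto_const_nhds.sub (ht.comp hlim')).norm).pow 2)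
    exact h1.liminf_eq.symm
  have hexp : ∀ b : ℝ → L, MemLp b 2 volume → ∫ t, ‖a t - b t‖ ^ 2
      = (∫ t, ‖a t‖ ^ 2) - 2 * (∫ t, inner ℝ (a t) (b t)) + ∫ t, ‖b t‖ ^ 2 := by
    intro b hb
    have h1 := (integrable_inner ha hb).const_mul 2
    have h2 := integral_add ((integrable_norm_sq ha).sub h1) (integrable_norm_sq hb)
    have h3 := integral_sub (integrable_norm_sq ha) h1
    simp only [Pi.sub_apply] at h2
    simp_rw [norm_sub_sq_real]
    rw [h2, h3, integral_const_mul]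
  have hof : ∀ b : ℝ → L, MemLp b 2 volume → ∫⁻ t, ENNReal.ofReal (‖a t - b t‖ ^ 2)
      = ENNReal.ofReal (∫ t, ‖a t - b t‖ ^ 2) := fun b hb =>
    (ofReal_integral_eq_lintegral_ofReal (integrable_norm_sq (ha.sub hb))
      (ae_of_all _ fun t => by positivity)).symm
  rw [hof w hw] at fatou
  simp_rw [fun k => hof _ (hS k).1] at fatou
  -- The strict comparison with the liminf takes place in [0, ∞], so ‖a − w‖² must exceed 2η.
  -- Otherwise dropping ‖a − S_h w‖² already gives the claim.
  rcases le_or_gt (∫ t, ‖a t - w t‖ ^ 2) (2 * η) with hle | hgt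
  · refine Eventually.of_forall fun k => ?_
    have h1 := hexp w hw
    have h2 := hexp _ (hS k).1
    have h3 : 0 ≤ ∫ t, ‖a t - steklov (h k) w t‖ ^ 2 := integral_nonneg fun t => by positivity
    have h4 := (hS k).2
    nlinarith
  · have hlt : ENNReal.ofReal ((∫ t, ‖a t - w t‖ ^ 2) - 2 * η)
        < ENNReal.ofReal (∫ t, ‖a t - w t‖ ^ 2) := by
      rw [ENNReal.ofReal_lt_ofReal_iff (by linarith)]; linarith
    filter_upwards [eventually_lt_of_lt_liminf (hlt.trans_le fatou)] with k hk
    have h5 := lt_of_not_ge fun hge => absurd hk (not_lt.2 (ENNReal.ofReal_le_ofReal hge))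
    have h1 := hexp w hw
    have h2 := hexp _ (hS k).1
    have h4 := (hS k).2
    nlinarith

end SteklovInner

/-! ### Weak limits in Hilbert spaces -/

section WeakLimit

variable {X Y : Type*} [NormedAddCommGroup X] [InnerProductSpace ℝ X] [CompleteSpace X]
  [NormedAddCommGroup Y] [InnerProductSpace ℝ Y] [CompleteSpace Y]

/-- Along an ultrafilter every bounded scalar product converges, and the limits form a bounded
linear functional. Riesz represents it, so neither separability nor a subsequence is needed. -/
lemma exists_weak_limit {ι : Type*} (U : Ultrafilter ι) {x : ι → X} {C : ℝ}
    (hx : ∀ᶠ i in U, ‖x i‖ ≤ C) :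
    ∃ y : X, ‖y‖ ≤ C ∧ ∀ z, Tendsto (fun i => inner ℝ (x i) z) U (𝓝 (inner ℝ y z)) := by
  have hC : 0 ≤ C := by
    obtain ⟨i, hi⟩ := hx.exists
    exact (norm_nonneg _).trans hi
  have hb : ∀ z, ∀ᶠ i in U, |inner ℝ (x i) z| ≤ C * ‖z‖ := fun z => by
    filter_upwards [hx] with i hi
    exact (abs_real_inner_le_norm _ _).trans (by gcongr)
  have h1 : ∀ z, ∃ l, Tendsto (fun i => inner ℝ (x i) z) U (𝓝 l) := by
    intro z
    have hK : IsCompact (Icc (-(C * ‖z‖)) (C * ‖z‖)) := isCompact_Icc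
    have := hK.ultrafilter_le_nhds (U.map fun i => inner ℝ (x i) z) (by
      rw [le_principal_iff]
      exact (hb z).mono fun i hi => abs_le.1 hi)
    obtain ⟨l, -, hl⟩ := this
    exact ⟨l, hl⟩
  choose l hl using h1
  let f : X →ₗ[ℝ] ℝ :=
    { toFun := l
      map_add' := fun z z' => tendsto_nhds_unique (hl (z + z'))
        (by simpa only [inner_add_right] using (hl z).add (hl z'))
      map_smul' := fun c z => tendsto_nhds_unique (hl (c • z))
        (by simpa only [real_inner_smul_right, smul_eq_mul, RingHom.id_apply] using (hl z).const_mul c) }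
  have hf : ∀ z, ‖f z‖ ≤ C * ‖z‖ := fun z =>
    le_of_tendsto (hl z).norm (hb z)
  let F := f.mkContinuous C hf
  refine ⟨(InnerProductSpace.toDual ℝ X).symm F, ?_, fun z => ?_⟩
  · rw [LinearIsometryEquiv.norm_map]
    exact f.mkContinuous_norm_le hC hf
  · rw [InnerProductSpace.toDual_symm_apply]
    exact hl z

/-- If a bounded net in `X` converges after an injective bounded operator `I : X → Y`, then the
limit is in the range of `I` and the net converges weakly. -/
lemma exists_weak_limit_of_tendsto {ι : Type*} {l : Filter ι} [l.NeBot] (I : X →L[ℝ] Y)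
    (hI : Function.Injective I) {x : ι → X} {y : Y} {C : ℝ} (hx : ∀ᶠ i in l, ‖x i‖ ≤ C)
    (hy : Tendsto (fun i => I (x i)) l (𝓝 y)) :
    ∃ x₀ : X, ‖x₀‖ ≤ C ∧ I x₀ = y ∧
      ∀ z, Tendsto (fun i => inner ℝ (x i) z) l (𝓝 (inner ℝ x₀ z)) := by
  have key : ∀ U : Ultrafilter ι, ↑U ≤ l → ∃ x₀ : X, ‖x₀‖ ≤ C ∧ I x₀ = y ∧
      ∀ z, Tendsto (fun i => inner ℝ (x i) z) U (𝓝 (inner ℝ x₀ z)) := by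
    intro U hU
    obtain ⟨x₀, h1, h2⟩ := exists_weak_limit U (hU hx)
    refine ⟨x₀, h1, ?_, h2⟩
    refine ext_inner_right ℝ fun z => ?_
    -- Testing with the adjoint identifies I x₀ with the given limit. Injectivity of I then makes
    -- all ultrafilter limits agree, which gives convergence along the original filter.
    have h3 := h2 (ContinuousLinearMap.adjoint I z)
    simp only [ContinuousLinearMap.adjoint_inner_right] at h3
    exact tendsto_nhds_unique h3 ((hy.mono_left hU).inner tendsto_const_nhds)
  obtain ⟨x₀, h1, h2, -⟩ := key (Ultrafilter.of l) (Ultrafilter.of_le l)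
  refine ⟨x₀, h1, h2, fun z => ?_⟩
  rw [tendsto_iff_ultrafilter]
  intro U hU
  obtain ⟨x₁, -, h4, h5⟩ := key U hU
  rw [hI (h2.trans h4.symm)]
  exact h5 z

end WeakLimit

/-! ### The energy inequality -/

section Energy

variable {X L : Type*} [NormedAddCommGroup X] [InnerProductSpace ℝ X]
  [NormedAddCommGroup L] [InnerProductSpace ℝ L] [CompleteSpace L]

lemma form_sub_le (b : X →L[ℝ] X →L[ℝ] ℝ) (hsymm : ∀ x y, b x y = b y x)
    (hnonneg : ∀ x, 0 ≤ b x x) (x y : X) : b x x - b y y ≤ 2 * b x (x - y) := by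
  have h := hnonneg (x - y)
  simp only [map_sub, sub_apply] at h ⊢
  rw [hsymm y x] at h
  linarith

/-- This is half of the identity d/dt b(v,v) = 2b(v,v') + b'(v,v), for a v whose derivative exists
only after J. The increment v(t) − v(t−h) is an admissible test function, `form_sub_le` turns it
into a bound for the energy difference, and `hres` involves only its image h · (average of w) under
J. The term k allows for residuals known in norm only. -/
theorem energy_inequality (J : X →L[ℝ] L) (b : ℝ → X →L[ℝ] X →L[ℝ] ℝ)
    (hsymm : ∀ t x y, b t x y = b t y x) (hnonneg : ∀ t x, 0 ≤ b t x x) {s r : ℝ} (hsr : s ≤ r)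
    {v : ℝ → X} {a w : ℝ → L} {k : ℝ → ℝ} {q : X → ℝ} (ha : MemLp a 2 volume)
    (hw : MemLp w 2 volume) (hk : MemLp k 2 volume) (hk0 : ∀ t, 0 ≤ k t) (hq0 : ∀ x, 0 ≤ q x)
    (hJ : ∀ t' t, s ≤ t' → t' ≤ t → t ≤ r → J (v t) - J (v t') = ∫ τ in t'..t, w τ)
    (hres : ∀ᵐ t, t ∈ Ioo s r → ∀ φ, b t (v t) φ ≤ inner ℝ (a t) (J φ) + k t * ‖J φ‖)
    (hinc : ∀ t' t, s ≤ t' → t' ≤ t → t ≤ r → ∀ x, b t x x - b t' x x ≤ (t - t') * q x)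
    (hbi : IntervalIntegrable (fun t => b t (v t) (v t)) volume s r)
    (hqi : IntervalIntegrable (fun t => q (v t)) volume s r)
    (hlsc : ∀ η > 0, ∀ᶠ t in 𝓝[<] r, b r (v r) (v r) - η ≤ b t (v t) (v t)) :
    b r (v r) (v r) ≤ b s (v s) (v s)
      + ∫ t in s..r, (2 * inner ℝ (a t) (w t) + 2 * (k t * ‖w t‖) + q (v t)) := by
  rcases hsr.eq_or_lt with rfl | hlt
  · simp
  set S : Set ℝ := Ioc s r with hS
  have hSm : MeasurableSet S := measurableSet_Ioc
  -- The cutoff places the averages on the whole line, where the weak convergence lemma applies. It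
  -- also matches the freezing below: the cut-off w integrates over (t − h, t] to the increment of J
  -- v from max(t − h, s).
  set a' := S.indicator a with ha'
  set w' := S.indicator w with hw'
  set k' := S.indicator k with hk'
  have hma : MemLp a' 2 volume := ha.indicator hSm
  have hmw : MemLp w' 2 volume := hw.indicator hSm
  have hmk : MemLp k' 2 volume := hk.indicator hSm
  set β : ℝ → ℝ := fun t => b t (v t) (v t) with hβ
  -- Times before s are frozen at s. Telescoping then leaves exactly h b_s(v_s, v_s) at the lower
  -- end, so no continuity at s is required; at r left lower semicontinuity suffices.
  set c : ℝ → ℝ := fun t => max t s with hc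
  have hcs : ∀ t, s ≤ t → c t = t := fun t ht => max_eq_left ht
  have hcs' : ∀ t, t ≤ s → c t = s := fun t ht => max_eq_right ht
  -- functions frozen to the left of `s`
  have ext_int : ∀ g : ℝ → ℝ, IntervalIntegrable g volume s r → ∀ h, 0 < h → h < r - s →
      IntervalIntegrable (fun t => g (c (t - h))) volume s r ∧
      ∫ t in s..r, g (c (t - h)) = h * g s + ∫ t in s..(r - h), g t := by
    intro g hg h hh hhr
    have i1 : IntervalIntegrable (fun t => g (c t)) volume (s - h) s :=
      (intervalIntegrable_const (c := g s)).congr (by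
        intro t ht
        rw [uIoc_of_le (by linarith)] at ht
        simp only [hcs' t ht.2])
    have i2 : IntervalIntegrable (fun t => g (c t)) volume s (r - h) :=
      (hg.mono_set (by rw [uIcc_of_le (by linarith), uIcc_of_le hsr]
                       exact Icc_subset_Icc le_rfl (by linarith))).congr (by
        intro t ht
        rw [uIoc_of_le (by linarith)] at ht
        simp only [hcs t ht.1.le])
    constructor
    · have := (i1.trans i2).comp_sub_right h
      simpa using this
    · rw [intervalIntegral.integral_comp_sub_right (fun t => g (c t)) h,
        ← intervalIntegral.integral_add_adjacent_intervals i1 i2]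
      congr 1
      · rw [intervalIntegral.integral_congr (g := fun _ => g s)]
        · simp
        · intro t ht
          rw [uIcc_of_le (by linarith)] at ht
          simp only [hcs' t ht.2]
      · refine intervalIntegral.integral_congr fun t ht => ?_
        rw [uIcc_of_le (by linarith)] at ht
        simp only [hcs t ht.1]
  -- the pointwise inequality
  have hpt : ∀ h, 0 < h → ∀ᵐ t, t ∈ Ioo s r →
      β t - β (c (t - h)) ≤ h * (2 * inner ℝ (a' t) (steklov h w' t)
        + 2 * (k' t * steklov h (fun τ => ‖w' τ‖) t) + q (v (c (t - h)))) := by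
    intro h hh
    filter_upwards [hres] with t ht hts
    have hct : c (t - h) ≤ t := max_le (by linarith) hts.1.le
    have hcs0 : s ≤ c (t - h) := le_max_right _ _
    have hmem : t ∈ S := ⟨hts.1, hts.2.le⟩
    have e1 : J (v t) - J (v (c (t - h))) = h • steklov h w' t := by
      rw [hJ _ _ hcs0 hct hts.2.le, steklov, smul_smul, mul_inv_cancel₀ hh.ne', one_smul,
        intervalIntegral.integral_of_le hct, intervalIntegral.integral_of_le (by linarith), hw',
        setIntegral_indicator hSm]
      congr 2
      ext τ
      simp only [hS, hc, mem_Ioc, mem_inter_iff, max_lt_iff]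
      constructor
      · rintro ⟨⟨x1, x2⟩, x3⟩; exact ⟨⟨x1, x3⟩, x2, x3.trans hts.2.le⟩
      · rintro ⟨⟨x1, x3⟩, x2, x4⟩; exact ⟨⟨x1, x2⟩, x3⟩
    have e2 := form_sub_le (b t) (hsymm t) (hnonneg t) (v t) (v (c (t - h)))
    have e3 := hinc _ _ hcs0 hct hts.2.le (v (c (t - h)))
    have e4 := ht hts (v t - v (c (t - h)))
    rw [map_sub J, e1, real_inner_smul_right, norm_smul, Real.norm_of_nonneg hh.le] at e4
    have e5 : t - c (t - h) ≤ h := by have := le_max_left (t - h) s; simp only [hc]; linarith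
    have e6 := mul_le_mul_of_nonneg_right e5 (hq0 (v (c (t - h))))
    have e7 := mul_le_mul_of_nonneg_left (norm_steklov_le w' hh t) (hk0 t)
    have e8 : a' t = a t := indicator_of_mem hmem a
    have e9 : k' t = k t := indicator_of_mem hmem k
    rw [e8, e9]
    simp only [hβ]
    nlinarith [mul_le_mul_of_nonneg_left e7 hh.le]
  have hn : MemLp (fun τ => ‖w' τ‖) 2 volume := hmw.norm
  -- the integrated inequality
  have hint : ∀ h, 0 < h → h < r - s →
      h⁻¹ * (∫ t in (r - h)..r, β t) - β s
        ≤ 2 * (∫ t, inner ℝ (a' t) (steklov h w' t))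
          + 2 * (∫ t, inner ℝ (k' t) (steklov h (fun τ => ‖w' τ‖) t))
          + (h * q (v s) + ∫ t in s..r, q (v t)) := by
    intro h hh hhr
    obtain ⟨b1, b2⟩ := ext_int β hbi h hh hhr
    obtain ⟨q1, q2⟩ := ext_int (fun t => q (v t)) hqi h hh hhr
    have m1 := integrable_inner hma (memLp_steklov hmw hh).1
    have m2 := integrable_inner hmk (memLp_steklov hn hh).1
    have m1' := (m1.intervalIntegrable (a := s) (b := r)).const_mul 2
    have m2' := (m2.intervalIntegrable (a := s) (b := r)).const_mul 2
    have hmono : ∫ t in s..r, (β t - β (c (t - h))) ≤ ∫ t in s..r,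
        h * (2 * inner ℝ (a' t) (steklov h w' t)
        + 2 * inner ℝ (k' t) (steklov h (fun τ => ‖w' τ‖) t) + q (v (c (t - h)))) := by
      refine intervalIntegral.integral_mono_ae_restrict hsr (hbi.sub b1)
        (((m1'.add m2').add q1).const_mul h) ?_
      rw [← restrict_Ioo_eq_restrict_Icc]
      refine (ae_restrict_iff' measurableSet_Ioo).2 ?_
      filter_upwards [hpt h hh] with t ht hts
      refine (ht hts).trans (le_of_eq ?_)
      simp only [RCLike.inner_apply, conj_trivial]
      ring
    rw [intervalIntegral.integral_sub hbi b1, b2, intervalIntegral.integral_const_mul,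
      intervalIntegral.integral_add (m1'.add m2') q1, intervalIntegral.integral_add m1' m2', q2,
      intervalIntegral.integral_const_mul, intervalIntegral.integral_const_mul] at hmono
    have hsplit : ∀ g : ℝ → ℝ, IntervalIntegrable g volume s r →
        ∫ t in s..r, g t = (∫ t in s..(r - h), g t) + ∫ t in (r - h)..r, g t := by
      intro g hg
      refine (intervalIntegral.integral_add_adjacent_intervals ?_ ?_).symm <;>
      · refine hg.mono_set ?_
        rw [uIcc_of_le (by linarith), uIcc_of_le hsr]
        exact Icc_subset_Icc (by linarith) (by linarith)
    have r1 := hsplit β hbi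
    have r2 := hsplit _ hqi
    have r3 : 0 ≤ ∫ t in (r - h)..r, q (v t) :=
      intervalIntegral.integral_nonneg (by linarith) fun t _ => hq0 _
    have i1 : ∫ t in s..r, inner ℝ (a' t) (steklov h w' t)
        = ∫ t, inner ℝ (a' t) (steklov h w' t) := by
      rw [intervalIntegral.integral_of_le hsr]
      refine setIntegral_eq_integral_of_forall_compl_eq_zero fun t ht => ?_
      rw [ha', indicator_of_notMem ht, inner_zero_left]
    have i2 : ∫ t in s..r, inner ℝ (k' t) (steklov h (fun τ => ‖w' τ‖) t)
        = ∫ t, inner ℝ (k' t) (steklov h (fun τ => ‖w' τ‖) t) := by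
      rw [intervalIntegral.integral_of_le hsr]
      refine setIntegral_eq_integral_of_forall_compl_eq_zero fun t ht => ?_
      rw [hk', indicator_of_notMem ht, inner_zero_left]
    rw [i1, i2] at hmono
    have key : (∫ t in (r - h)..r, β t) - h * β s ≤ h * (2 * (∫ t, inner ℝ (a' t) (steklov h w' t))
          + 2 * (∫ t, inner ℝ (k' t) (steklov h (fun τ => ‖w' τ‖) t))
          + (h * q (v s) + ∫ t in s..r, q (v t))) := by
      nlinarith [mul_nonneg hh.le r3]
    calc h⁻¹ * (∫ t in (r - h)..r, β t) - β s
        = h⁻¹ * ((∫ t in (r - h)..r, β t) - h * β s) := by field_simp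
      _ ≤ h⁻¹ * (h * _) := by gcongr
      _ = _ := by rw [← mul_assoc, inv_mul_cancel₀ hh.ne', one_mul]
  -- passage to the limit
  have hfin : ∫ t in s..r, (2 * inner ℝ (a t) (w t) + 2 * (k t * ‖w t‖) + q (v t))
      = 2 * (∫ t, inner ℝ (a' t) (w' t)) + 2 * (∫ t, inner ℝ (k' t) ‖w' t‖)
        + ∫ t in s..r, q (v t) := by
    have m1 := ((integrable_inner hma hmw).intervalIntegrable (a := s) (b := r)).const_mul 2
    have m2 := ((integrable_inner hmk hn).intervalIntegrable (a := s) (b := r)).const_mul 2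
    have i1 : ∫ t in s..r, inner ℝ (a' t) (w' t) = ∫ t, inner ℝ (a' t) (w' t) := by
      rw [intervalIntegral.integral_of_le hsr]
      refine setIntegral_eq_integral_of_forall_compl_eq_zero fun t ht => ?_
      rw [ha', indicator_of_notMem ht, inner_zero_left]
    have i2 : ∫ t in s..r, inner ℝ (k' t) ‖w' t‖ = ∫ t, inner ℝ (k' t) ‖w' t‖ := by
      rw [intervalIntegral.integral_of_le hsr]
      refine setIntegral_eq_integral_of_forall_compl_eq_zero fun t ht => ?_
      rw [hk', indicator_of_notMem ht, inner_zero_left]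
    rw [← i1, ← i2, ← intervalIntegral.integral_const_mul, ← intervalIntegral.integral_const_mul,
      ← intervalIntegral.integral_add m1 m2, ← intervalIntegral.integral_add (m1.add m2) hqi]
    rw [intervalIntegral.integral_of_le hsr, intervalIntegral.integral_of_le hsr]
    refine setIntegral_congr_fun hSm fun t ht => ?_
    have x1 : a' t = a t := indicator_of_mem ht a
    have x2 : w' t = w t := indicator_of_mem ht w
    have x3 : k' t = k t := indicator_of_mem ht k
    simp only [x1, x2, x3, RCLike.inner_apply, conj_trivial]
    ring
  rw [hfin]
  set h : ℕ → ℝ := fun j => (r - s) / (j + 2) with hh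
  have hpos : ∀ j, 0 < h j := fun j => div_pos (by linarith) (by positivity)
  have hltj : ∀ j, h j < r - s := fun j => by
    rw [hh]
    refine (div_lt_iff₀ (by positivity)).2 ?_
    have : (0 : ℝ) ≤ j := by positivity
    nlinarith
  have hlim : Tendsto h atTop (𝓝 0) := by
    have : Tendsto (fun j : ℕ => (j : ℝ) + 2) atTop atTop :=
      tendsto_atTop_add_const_right _ _ tendsto_natCast_atTop_atTop
    exact tendsto_const_nhds.div_atTop this
  refine le_of_forall_pos_le_add fun η hη => ?_
  -- The six shares of η: two for each of the two weak limits, which carry a factor 2, one for h q(v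
  -- s), and one for the lower semicontinuity at r.
  have hη' : 0 < η / 6 := by positivity
  have hev := hlsc (η / 6) hη'
  rw [eventually_iff, mem_nhdsLT_iff_exists_Ioo_subset' hlt] at hev
  obtain ⟨l, hl, hlsub⟩ := hev
  have h5 : ∀ᶠ j in atTop, h j < r - l := hlim.eventually_lt_const (by simpa using hl)
  have h6 : ∀ᶠ j in atTop, h j * q (v s) < η / 6 := by
    have : Tendsto (fun j => h j * q (v s)) atTop (𝓝 (0 * q (v s))) := hlim.mul_const _
    exact this.eventually_lt_const (by simpa using hη')
  obtain ⟨j, j1, j2, j3, j4⟩ := ((eventually_integral_inner_steklov_le hma hmw hpos hlim hη').and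
    ((eventually_integral_inner_steklov_le hmk hn hpos hlim hη').and (h5.and h6))).exists
  have hj := hint (h j) (hpos j) (hltj j)
  have hav : β r - η / 6 ≤ (h j)⁻¹ * ∫ t in (r - h j)..r, β t := by
    have : ∫ _ in (r - h j)..r, (β r - η / 6) ≤ ∫ t in (r - h j)..r, β t := by
      refine intervalIntegral.integral_mono_ae_restrict (by linarith [hpos j]) (by simp) ?_ ?_
      · refine hbi.mono_set ?_
        rw [uIcc_of_le (by linarith [hpos j]), uIcc_of_le hsr]
        exact Icc_subset_Icc (by linarith [hltj j]) le_rfl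
      · rw [← restrict_Ioo_eq_restrict_Icc]
        refine (ae_restrict_iff' measurableSet_Ioo).2 (ae_of_all _ fun t ht => ?_)
        exact hlsub ⟨by linarith [ht.1], ht.2⟩
    rw [intervalIntegral.integral_const, smul_eq_mul] at this
    calc β r - η / 6 = (h j)⁻¹ * (h j * (β r - η / 6)) := by
          rw [← mul_assoc, inv_mul_cancel₀ (hpos j).ne', one_mul]
      _ ≤ _ := by
          have := hpos j
          gcongr
          linarith
  simp only [hβ] at hav hj
  linarith

end Energy

/-! ### Weak derivatives on an interval -/

section WeakDeriv

lemma integral_primitive_mul_deriv {T : ℝ} {d : ℝ → ℝ}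
    (hd : IntervalIntegrable d volume 0 T) {ψ : ℝ → ℝ} (hψ : ContDiff ℝ ∞ ψ)
    (hsupp : tsupport ψ ⊆ Ioo 0 T) :
    ∫ t in (0 : ℝ)..T, (∫ τ in (0 : ℝ)..t, d τ) * deriv ψ t = -∫ t in (0 : ℝ)..T, d t * ψ t := by
  have h1 := hd.absolutelyContinuousOnInterval_intervalIntegral (c := 0) (by simp)
  have h2 : AbsolutelyContinuousOnInterval ψ 0 T :=
    ((hψ.of_le (by exact_mod_cast le_top)).contDiffOn).absolutelyContinuousOnInterval
  rw [h1.integral_mul_deriv_eq_deriv_mul h2]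
  have e1 : ψ T = 0 := image_eq_zero_of_notMem_tsupport fun h => absurd (hsupp h).2 (lt_irrefl _)
  rw [e1]
  simp only [mul_zero, intervalIntegral.integral_same, zero_mul, sub_zero, zero_sub]
  congr 1
  refine intervalIntegral.integral_congr_ae ?_
  filter_upwards [hd.ae_hasDerivAt_integral] with t ht hts
  rw [(ht (uIoc_subset_uIcc hts) 0 (by simp)).deriv]

lemma hasWeakDeriv_of_sub_eq_integral {T : ℝ} (hT : 0 < T) {G d : ℝ → ℝ}
    (hd : IntervalIntegrable d volume 0 T)
    (hG : ∀ t ∈ Icc 0 T, G t - G 0 = ∫ τ in (0 : ℝ)..t, d τ) : HasWeakDeriv T G d := by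
  have hD : ContinuousOn (fun t => ∫ τ in (0 : ℝ)..t, d τ) (Icc 0 T) := by
    have := intervalIntegral.continuousOn_primitive_interval' hd (by simp : (0 : ℝ) ∈ uIcc 0 T)
    rwa [uIcc_of_le hT.le] at this
  have hGe : ∀ t ∈ Icc 0 T, G t = G 0 + ∫ τ in (0 : ℝ)..t, d τ := fun t ht => by
    rw [← hG t ht]; ring
  have hGc : ContinuousOn G (Icc 0 T) := (continuousOn_const.add hD).congr hGe
  refine ⟨(hGc.integrableOn_Icc).mono_set Ioo_subset_Icc_self,
    ((intervalIntegrable_iff_integrableOn_Ioc_of_le hT.le).1 hd).mono_set Ioo_subset_Ioc_self, ?_⟩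
  intro ψ h1 h2 h3
  have e := integral_primitive_mul_deriv hd h1 h3
  rw [← integral_Ioc_eq_integral_Ioo, ← integral_Ioc_eq_integral_Ioo,
    ← intervalIntegral.integral_of_le hT.le, ← intervalIntegral.integral_of_le hT.le, ← e]
  have h4 : Continuous (deriv ψ) := h1.continuous_deriv (by exact_mod_cast le_top)
  have h5 : ∫ t in (0 : ℝ)..T, deriv ψ t = 0 := by
    rw [intervalIntegral.integral_deriv_eq_sub
      (fun x _ => (h1.differentiable (by simp)).differentiableAt) (h4.intervalIntegrable _ _)]
    rw [image_eq_zero_of_notMem_tsupport fun h => absurd (h3 h).2 (lt_irrefl _),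
      image_eq_zero_of_notMem_tsupport fun h => absurd (h3 h).1 (lt_irrefl _), sub_zero]
  have h6 : ∫ t in (0 : ℝ)..T, G t * deriv ψ t = ∫ t in (0 : ℝ)..T,
      (G 0 * deriv ψ t + (∫ τ in (0 : ℝ)..t, d τ) * deriv ψ t) := by
    refine intervalIntegral.integral_congr fun t ht => ?_
    rw [uIcc_of_le hT.le] at ht
    simp only [hGe t ht]; ring
  have h7 := intervalIntegral.integral_add ((h4.intervalIntegrable 0 T).const_mul (G 0))
    (μ := volume) ((hD.mul h4.continuousOn).intervalIntegrable_of_Icc hT.le)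
  rw [intervalIntegral.integral_const_mul, h5, mul_zero, zero_add] at h7
  exact h6.trans h7

/-- The lemma of du Bois-Reymond. -/
lemma exists_ae_eq_const {T : ℝ} (hT : 0 < T) {F : ℝ → ℝ} (hF : IntegrableOn F (Ioo 0 T))
    (h : ∀ ψ : ℝ → ℝ, ContDiff ℝ ∞ ψ → HasCompactSupport ψ → tsupport ψ ⊆ Ioo 0 T →
      ∫ t in Ioo 0 T, F t * deriv ψ t = 0) :
    ∃ c, ∀ᵐ t, t ∈ Ioo 0 T → F t = c := by
  let B : ContDiffBump (T / 2) := ⟨T / 8, T / 4, by positivity, by linarith⟩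
  set I := ∫ t, B t with hI
  have hIpos : 0 < I := B.integral_pos
  set ρ : ℝ → ℝ := fun t => I⁻¹ * B t with hρ
  have hρs : ContDiff ℝ ∞ ρ := contDiff_const.mul B.contDiff
  have hρt : tsupport ρ ⊆ Ioo 0 T := by
    refine (tsupport_mul_subset_right (f := fun _ => I⁻¹) (g := B)).trans ?_
    rw [B.tsupport_eq]
    intro x hx
    rw [Metric.mem_closedBall, Real.dist_eq] at hx
    have := abs_le.1 hx
    change -(T/4) ≤ x - T/2 ∧ x - T/2 ≤ T / 4 at this
    exact ⟨by linarith [this.1], by linarith [this.2]⟩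
  have hρc : HasCompactSupport ρ :=
    HasCompactSupport.mul_left B.hasCompactSupport
  have hρI : ∫ t, ρ t = 1 := by
    rw [hρ, integral_const_mul, inv_mul_cancel₀ hIpos.ne']
  refine ⟨∫ t in Ioo 0 T, F t * ρ t, ?_⟩
  set c := ∫ t in Ioo 0 T, F t * ρ t with hc
  have key := isOpen_Ioo.ae_eq_zero_of_integral_contDiff_smul_eq_zero (U := Ioo 0 T) (μ := volume)
    (f := fun t => F t - c)
    ((hF.sub (integrableOn_const (by simp))).locallyIntegrableOn) ?_
  · filter_upwards [key] with t ht hts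
    linarith [ht hts]
  intro θ hθ hθc hθt
  set m := ∫ t, θ t with hm
  set ζ : ℝ → ℝ := fun t => θ t - m * ρ t with hζ
  have hζs : ContDiff ℝ ∞ ζ := hθ.sub (contDiff_const.mul hρs)
  have hζi : ∀ a b, IntervalIntegrable ζ volume a b := fun a b =>
    hζs.continuous.intervalIntegrable _ _
  set K := tsupport θ ∪ tsupport ρ with hK
  have hKc : IsCompact K := hθc.isCompact.union hρc.isCompact
  have hKs : K ⊆ Ioo 0 T := union_subset hθt hρt
  have hKn : K.Nonempty := by
    by_contra hne
    rw [not_nonempty_iff_eq_empty] at hne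
    have : ∀ t, ρ t = 0 := fun t => image_eq_zero_of_notMem_tsupport fun ht => by
      have : t ∈ K := Or.inr ht
      rw [hne] at this; exact this
    simp [this] at hρI
  obtain ⟨l, hl1, hl2⟩ := hKc.exists_isLeast hKn
  obtain ⟨u, hu1, hu2⟩ := hKc.exists_isGreatest hKn
  have hζ0 : ∀ t, t ∉ K → ζ t = 0 := fun t ht => by
    have h1 : θ t = 0 := image_eq_zero_of_notMem_tsupport fun h => ht (Or.inl h)
    have h2 : ρ t = 0 := image_eq_zero_of_notMem_tsupport fun h => ht (Or.inr h)
    simp [hζ, h1, h2]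
  have hζint : ∫ t, ζ t = 0 := by
    rw [hζ, integral_sub (hθ.continuous.integrable_of_hasCompactSupport hθc)
      ((hρs.continuous.integrable_of_hasCompactSupport hρc).const_mul _), integral_const_mul, hρI,
      hm]
    simp
  set ψ : ℝ → ℝ := fun t => ∫ τ in (0 : ℝ)..t, ζ τ with hψ
  have hψd : ∀ t, HasDerivAt ψ (ζ t) t := fun t =>
    intervalIntegral.integral_hasDerivAt_right (hζi _ _)
      hζs.continuous.stronglyMeasurable.stronglyMeasurableAtFilter hζs.continuous.continuousAt
  have hψe : deriv ψ = ζ := funext fun t => (hψd t).deriv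
  have hψs : ContDiff ℝ ∞ ψ := by
    rw [contDiff_infty_iff_deriv]
    exact ⟨fun t => (hψd t).differentiableAt, by rw [hψe]; exact hζs⟩
  have hψ0 : ∀ t, t ∉ Icc l u → ψ t = 0 := by
    intro t ht
    rw [mem_Icc, not_and_or, not_le, not_le] at ht
    have hl0 := (hKs hl1).1
    rcases ht with ht | ht
    · rw [hψ]
      refine (intervalIntegral.integral_congr (g := fun _ => 0) fun τ hτ => ?_).trans (by simp)
      refine hζ0 τ fun hτK => ?_
      have h1 := hl2 hτK
      rw [mem_uIcc] at hτ
      rcases hτ with h | h <;> linarith [h.1, h.2]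
    · have e1 : ψ t = ∫ τ, ζ τ := by
        rw [hψ]
        have hut : 0 ≤ t := by linarith [hl2 hu1]
        simp only
        rw [intervalIntegral.integral_of_le hut]
        refine setIntegral_eq_integral_of_forall_compl_eq_zero fun τ hτ => hζ0 τ fun hτK => hτ ?_
        exact ⟨by linarith [hl2 hτK], by linarith [hu2 hτK]⟩
      rw [e1, hζint]
  have hψt : tsupport ψ ⊆ Icc l u := by
    refine closure_minimal (fun t ht => ?_) isClosed_Icc
    by_contra hn
    exact ht (hψ0 t hn)
  have h0 := h ψ hψs (HasCompactSupport.of_support_subset_isCompact isCompact_Icc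
    (subset_closure.trans hψt)) (hψt.trans fun t ht =>
      ⟨(hKs hl1).1.trans_le ht.1, ht.2.trans_lt (hKs hu1).2⟩)
  rw [hψe] at h0
  have b1 : Integrable (fun t => F t * θ t) (volume.restrict (Ioo 0 T)) := by
    obtain ⟨C, hC⟩ := hθ.continuous.bounded_above_of_compact_support hθc
    exact hF.mul_bdd (c := C) hθ.continuous.aestronglyMeasurable (ae_of_all _ hC)
  have b2 : Integrable (fun t => F t * ρ t) (volume.restrict (Ioo 0 T)) := by
    obtain ⟨C, hC⟩ := hρs.continuous.bounded_above_of_compact_support hρc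
    exact hF.mul_bdd (c := C) hρs.continuous.aestronglyMeasurable (ae_of_all _ hC)
  have b3 : Integrable θ := hθ.continuous.integrable_of_hasCompactSupport hθc
  have e2 : ∫ t in Ioo 0 T, F t * ζ t = (∫ t in Ioo 0 T, F t * θ t) - m * c := by
    rw [hc, ← integral_const_mul, ← integral_sub b1 (b2.const_mul m)]
    refine integral_congr_ae (ae_of_all _ fun t => ?_)
    simp only [hζ]; ring
  have e3 : ∫ t, θ t • (F t - c) = ∫ t in Ioo 0 T, (F t * θ t - c * θ t) := by
    rw [← setIntegral_eq_integral_of_forall_compl_eq_zero (s := Ioo 0 T)]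
    · refine integral_congr_ae (ae_of_all _ fun t => ?_)
      simp only [smul_eq_mul]; ring
    · intro t ht
      rw [image_eq_zero_of_notMem_tsupport fun h => ht (hθt h), zero_smul]
  have e4 : ∫ t in Ioo 0 T, θ t = m := by
    rw [hm]
    exact setIntegral_eq_integral_of_forall_compl_eq_zero fun t ht =>
      image_eq_zero_of_notMem_tsupport fun h => ht (hθt h)
  rw [e3, integral_sub b1 (b3.integrableOn.const_mul c), integral_const_mul, e4]
  linarith

/-- G minus the primitive of d has vanishing weak derivative, hence is almost everywhere constant.
Continuity removes the exceptional times, so the identity holds between any two times, endpoints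
included. -/
lemma HasWeakDeriv.sub_eq_integral {T : ℝ} (hT : 0 < T) {g d G : ℝ → ℝ} (h : HasWeakDeriv T g d)
    (hG : ContinuousOn G (Icc 0 T)) (hGg : ∀ᵐ t, t ∈ Ioo 0 T → G t = g t) {s t : ℝ} (hs : 0 ≤ s)
    (hst : s ≤ t) (ht : t ≤ T) : G t - G s = ∫ τ in s..t, d τ := by
  obtain ⟨hg, hd, hψ⟩ := h
  have hdi : IntervalIntegrable d volume 0 T :=
    (intervalIntegrable_iff_integrableOn_Ioo_of_le hT.le).2 hd
  have hD : ContinuousOn (fun t => ∫ τ in (0 : ℝ)..t, d τ) (Icc 0 T) := by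
    have := intervalIntegral.continuousOn_primitive_interval' hdi (by simp : (0 : ℝ) ∈ uIcc 0 T)
    rwa [uIcc_of_le hT.le] at this
  set F : ℝ → ℝ := fun t => G t - ∫ τ in (0 : ℝ)..t, d τ with hF
  have hFc : ContinuousOn F (Icc 0 T) := hG.sub hD
  obtain ⟨c, hc⟩ := exists_ae_eq_const hT (hFc.integrableOn_Icc.mono_set Ioo_subset_Icc_self) (by
    intro ψ h1 h2 h3
    have h4 : Continuous (deriv ψ) := h1.continuous_deriv (by exact_mod_cast le_top)
    have e := integral_primitive_mul_deriv hdi h1 h3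
    have e2 : ∫ t in Ioo 0 T, g t * deriv ψ t = ∫ t in Ioo 0 T, G t * deriv ψ t := by
      refine setIntegral_congr_ae measurableSet_Ioo ?_
      filter_upwards [hGg] with t ht hts
      rw [ht hts]
    have e3 := hψ ψ h1 h2 h3
    rw [e2] at e3
    rw [intervalIntegral.integral_of_le hT.le, intervalIntegral.integral_of_le hT.le,
      integral_Ioc_eq_integral_Ioo, integral_Ioc_eq_integral_Ioo, ← e3] at e
    simp only [hF, sub_mul]
    rw [integral_sub, e, sub_self]
    · exact ((hG.mul h4.continuousOn).integrableOn_Icc).mono_set Ioo_subset_Icc_self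
    · exact ((hD.mul h4.continuousOn).integrableOn_Icc).mono_set Ioo_subset_Icc_self)
  have hFconst : ∀ t ∈ Icc 0 T, F t = c := by
    have hae : F =ᵐ[volume.restrict (Icc 0 T)] fun _ => c := by
      rw [← restrict_Ioo_eq_restrict_Icc]
      exact (ae_restrict_iff' measurableSet_Ioo).2 hc
    exact Measure.eqOn_Icc_of_ae_eq volume hT.ne hae hFc continuousOn_const
  have h1 := hFconst t ⟨hs.trans hst, ht⟩
  have h2 := hFconst s ⟨hs, hst.trans ht⟩
  simp only [hF] at h1 h2
  rw [← intervalIntegral.integral_interval_sub_left (a := 0)]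
  · linarith
  · exact hdi.mono_set (by rw [uIcc_of_le (hs.trans hst), uIcc_of_le hT.le]; exact Icc_subset_Icc le_rfl ht)
  · exact hdi.mono_set (by rw [uIcc_of_le hs, uIcc_of_le hT.le]; exact Icc_subset_Icc le_rfl (hst.trans ht))

lemma ae_eq_zero_of_forall_integral_eq_zero {E : Type*} [NormedAddCommGroup E] [NormedSpace ℝ E]
    [CompleteSpace E] {T : ℝ} (hT : 0 < T) {d : ℝ → E}
    (hd : IntegrableOn d (Ioo 0 T)) (h : ∀ t, 0 ≤ t → t ≤ T → ∫ τ in (0 : ℝ)..t, d τ = 0) :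
    ∀ᵐ t, t ∈ Ioo 0 T → d t = 0 := by
  have hdi : IntervalIntegrable d volume 0 T :=
    (intervalIntegrable_iff_integrableOn_Ioo_of_le hT.le).2 hd
  filter_upwards [hdi.ae_hasDerivAt_integral] with t ht hts
  have h1 := ht (by rw [uIcc_of_le hT.le]; exact Ioo_subset_Icc_self hts) 0 (by simp)
  refine h1.unique ((hasDerivAt_const t (0 : E)).congr_of_eventuallyEq ?_)
  filter_upwards [Ioo_mem_nhds hts.1 hts.2] with x hx
  exact h x hx.1.le hx.2.le

end WeakDeriv

/-! ### Abstract parabolic problems with a Lipschitz leading form -/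

section Abstract

variable {X Y L : Type*} [NormedAddCommGroup X] [InnerProductSpace ℝ X] [CompleteSpace X]
  [NormedAddCommGroup Y] [InnerProductSpace ℝ Y] [CompleteSpace Y]
  [NormedAddCommGroup L] [InnerProductSpace ℝ L] [CompleteSpace L]

/-- A family of forms `N t + M t` on `X` with `N` Lipschitz in time and coercive modulo `J`, and
`M` controlled by `J`. -/
structure SplitForm (J : X →L[ℝ] L) (N M : ℝ → X →L[ℝ] X →L[ℝ] ℝ) (K Λ c₀ c₁ : ℝ) : Prop where
  symmN : ∀ t x y, N t x y = N t y x
  symmM : ∀ t x y, M t x y = M t y x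
  nonnegN : ∀ t x, 0 ≤ N t x x
  nonnegM : ∀ t x, 0 ≤ M t x x
  lipschitzN : ∀ s t, ‖N t - N s‖ ≤ K * |t - s|
  boundN : ∀ t, ‖N t‖ ≤ c₁
  boundM : ∀ t x y, |M t x y| ≤ Λ * ‖J x‖ * ‖J y‖
  continuousM : ∀ x y, Continuous fun t => M t x y
  coercive : ∀ t x, ‖x‖ ^ 2 ≤ c₀ * (N t x x + ‖J x‖ ^ 2)
  K_nonneg : 0 ≤ K
  Λ_nonneg : 0 ≤ Λ
  c₀_nonneg : 0 ≤ c₀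

/-- `u ∈ L²(0,T;X)`, extended by zero, solves `(R I u)' + N u + M u = f` weakly, and `z` is the
continuous representative of `I u`, with `z(0) = I u₀`. -/
structure IsAbstractSolution (I : X →L[ℝ] Y) (R : Y →L[ℝ] L) (N M : ℝ → X →L[ℝ] X →L[ℝ] ℝ) (T : ℝ)
    (f : ℝ → L) (u₀ : X) (u : ℝ → X) (z : ℝ → Y) : Prop where
  memLp : MemLp u 2 volume
  memLp_rhs : MemLp f 2 volume
  eq_zero : ∀ t, t ∉ Ioo 0 T → u t = 0
  continuousOn : ContinuousOn z (Icc 0 T)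
  ae_eq : ∀ᵐ t, t ∈ Ioo 0 T → I (u t) = z t
  initial : z 0 = I u₀
  equation : ∀ φ, HasWeakDeriv T (fun t => inner ℝ (R (I (u t))) (R (I φ)))
    fun t => inner ℝ (f t) (R (I φ)) - (N t (u t) φ + M t (u t) φ)

variable {I : X →L[ℝ] Y} {R : Y →L[ℝ] L} {N M : ℝ → X →L[ℝ] X →L[ℝ] ℝ} {T K Λ c₀ c₁ : ℝ}
  {f : ℝ → L} {u₀ : X} {u : ℝ → X} {z : ℝ → Y}

lemma IsAbstractSolution.inner_sub_eq_integral (hu : IsAbstractSolution I R N M T f u₀ u z)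
    (hT : 0 < T) (φ : X) {s t : ℝ} (hs : 0 ≤ s) (hst : s ≤ t) (ht : t ≤ T) :
    inner ℝ (R (z t) - R (z s)) (R (I φ))
      = ∫ τ in s..t, (inner ℝ (f τ) (R (I φ)) - (N τ (u τ) φ + M τ (u τ) φ)) := by
  rw [inner_sub_left]
  refine (hu.equation φ).sub_eq_integral (G := fun t => inner ℝ (R (z t)) (R (I φ))) hT ?_ ?_
    hs hst ht
  · exact (R.continuous.comp_continuousOn hu.continuousOn).inner continuousOn_const
  · filter_upwards [hu.ae_eq] with t ht hts
    rw [ht hts]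

lemma SplitForm.continuousN {J : X →L[ℝ] L} (hF : SplitForm J N M K Λ c₀ c₁) : Continuous N := by
  have : LipschitzWith (Real.toNNReal K) N := LipschitzWith.of_dist_le_mul fun t s => by
    rw [dist_eq_norm, Real.coe_toNNReal _ hF.K_nonneg, Real.dist_eq]
    exact hF.lipschitzN s t
  exact this.continuous

lemma IsAbstractSolution.intervalIntegrable_equation (hu : IsAbstractSolution I R N M T f u₀ u z)
    (hT : 0 < T) (φ : X) {s t : ℝ} (hs : 0 ≤ s) (hst : s ≤ t) (ht : t ≤ T) :
    IntervalIntegrable (fun τ => inner ℝ (f τ) (R (I φ)) - (N τ (u τ) φ + M τ (u τ) φ))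
      volume s t := by
  have h := (intervalIntegrable_iff_integrableOn_Ioo_of_le hT.le).2 (hu.equation φ).2.1
  refine h.mono_set ?_
  rw [uIcc_of_le hst, uIcc_of_le hT.le]
  exact Icc_subset_Icc hs ht

/-- The test function of the difference quotient method. -/
def quotientTest (h : ℝ) (u₀ : X) (u : ℝ → X) (t : ℝ) : X :=
  h⁻¹ • (u t - u (t - h) - if t ≤ h then u₀ else 0)

/-- For t ≤ h the shifted value of u is 0 by the zero extension, whereas z is evaluated at time 0.
The correction by u₀ in `quotientTest` makes up the difference. -/
lemma IsAbstractSolution.sub_eq (hu : IsAbstractSolution I R N M T f u₀ u z) {h : ℝ}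
    (hh : 0 < h) : ∀ᵐ t, t ∈ Ioo 0 T →
      R (z t) - R (z (max (t - h) 0)) = h • R (I (quotientTest h u₀ u t)) := by
  have h1 : ∀ᵐ t, t - h ∈ Ioo 0 T → I (u (t - h)) = z (t - h) :=
    (measurePreserving_sub_right volume h).quasiMeasurePreserving.ae hu.ae_eq
  filter_upwards [hu.ae_eq, h1] with t ht1 ht2 hts
  rw [quotientTest, map_smul, map_smul, smul_smul, mul_inv_cancel₀ hh.ne', one_smul, map_sub,
    map_sub, map_sub, map_sub, ht1 hts]
  by_cases hth : t ≤ h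
  · have e1 : u (t - h) = 0 := hu.eq_zero _ fun hm => by linarith [hm.1]
    rw [max_eq_right (by linarith), hu.initial, e1, if_pos hth]
    simp
  · rw [not_le] at hth
    rw [max_eq_left (by linarith), if_neg (not_le.2 hth),
      ht2 ⟨by linarith, by linarith [hts.2]⟩]
    simp

/-- The equation between t − h and t is tested with the quotient e at time t. Freezing N at time t
turns the form into N t (average of u, e). The error costs the Lipschitz constant times h, and this
h combines with e into h • e, which is bounded by values of u with no negative power of h. -/
lemma IsAbstractSolution.quotient_inequality (hF : SplitForm (R ∘L I) N M K Λ c₀ c₁)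
    (hu : IsAbstractSolution I R N M T f u₀ u z) (hT : 0 < T) {h : ℝ} (hh : 0 < h) :
    ∀ᵐ t, t ∈ Ioo 0 T → ‖R (I (quotientTest h u₀ u t))‖ ^ 2
        + N t (steklov h u t) (quotientTest h u₀ u t)
      ≤ steklov h (fun τ => ‖f τ‖ + Λ * ‖R (I (u τ))‖) t * ‖R (I (quotientTest h u₀ u t))‖
        + K * steklov h (fun τ => ‖u τ‖) t * ‖h • quotientTest h u₀ u t‖ := by
  filter_upwards [hu.sub_eq hh] with t ht hts
  set e := quotientTest h u₀ u t with he
  set σ := max (t - h) 0 with hσ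
  have hσ0 : 0 ≤ σ := le_max_right _ _
  have hσt : σ ≤ t := max_le (by linarith) hts.1.le
  have hσh : t - σ ≤ h := by have := le_max_left (t - h) 0; linarith
  have hσh' : t - h ≤ σ := le_max_left (t - h) 0
  have eq1 := hu.inner_sub_eq_integral hT e hσ0 hσt hts.2.le
  have int1 := hu.intervalIntegrable_equation hT e hσ0 hσt hts.2.le
  rw [ht hts, real_inner_smul_left, real_inner_self_eq_norm_sq] at eq1
  have intu := fun a b => intervalIntegrable_of_memLp_two hu.memLp a b
  have intf := fun a b => intervalIntegrable_of_memLp_two hu.memLp_rhs a b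
  have intJ : ∀ a b, IntervalIntegrable (fun τ => ‖R (I (u τ))‖) volume a b := fun a b =>
    (intervalIntegrable_of_memLp_two ((R ∘L I).comp_memLp' hu.memLp) a b).norm
  -- The window may be extended from σ down to t − h because u vanishes at negative times.
  have hW : ∫ τ in σ..t, N t (u τ) e = h * N t (steklov h u t) e := by
    have e1 : ∫ τ in σ..t, N t (u τ) e = N t (∫ τ in σ..t, u τ) e :=
      (((ContinuousLinearMap.apply ℝ ℝ e) ∘L (N t)).intervalIntegral_comp_comm (intu _ _))
    have e2 : ∫ τ in σ..t, u τ = ∫ τ in (t - h)..t, u τ := by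
      rw [← intervalIntegral.integral_add_adjacent_intervals (intu (t - h) σ) (intu σ t)]
      have : ∫ τ in (t - h)..σ, u τ = 0 := by
        refine (intervalIntegral.integral_congr_ae (g := fun _ => (0 : X)) ?_).trans (by simp)
        refine ae_of_all _ fun τ hτ => hu.eq_zero _ fun hm => ?_
        rw [uIoc_of_le hσh'] at hτ
        rcases le_total (t - h) 0 with h0 | h0
        · rw [hσ, max_eq_right h0] at hτ; linarith [hτ.2, hm.1]
        · rw [hσ, max_eq_left h0] at hτ; linarith [hτ.1, hτ.2]
      rw [this, zero_add]
    rw [e1, e2, steklov, map_smul, smul_apply, smul_eq_mul, ← mul_assoc, mul_inv_cancel₀ hh.ne',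
      one_mul]
  have intN : IntervalIntegrable (fun τ => N t (u τ) e) volume σ t :=
    ⟨((ContinuousLinearMap.apply ℝ ℝ e) ∘L (N t)).integrable_comp (intu σ t).1,
      ((ContinuousLinearMap.apply ℝ ℝ e) ∘L (N t)).integrable_comp (intu σ t).2⟩
  have hsum : h * ‖R (I e)‖ ^ 2 + h * N t (steklov h u t) e
      = ∫ τ in σ..t, (inner ℝ (f τ) (R (I e)) - (N τ (u τ) e + M τ (u τ) e) + N t (u τ) e) := by
    rw [intervalIntegral.integral_add int1 intN, ← eq1, hW]
  set F : ℝ → ℝ := fun τ => (‖f τ‖ + Λ * ‖R (I (u τ))‖) * ‖R (I e)‖ + K * h * ‖u τ‖ * ‖e‖ with hFdef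
  have intF : ∀ a b, IntervalIntegrable F volume a b := fun a b =>
    ((((intf a b).norm.add ((intJ a b).const_mul Λ)).mul_const _).add
      (((intu a b).norm.const_mul (K * h)).mul_const ‖e‖))
  have hF0 : ∀ τ, 0 ≤ F τ := fun τ => by
    have := hF.K_nonneg; have := hF.Λ_nonneg
    positivity
  have hle : h * ‖R (I e)‖ ^ 2 + h * N t (steklov h u t) e ≤ ∫ τ in (t - h)..t, F τ := by
    rw [hsum]
    calc _ ≤ ∫ τ in σ..t, F τ := by
          refine intervalIntegral.integral_mono_on hσt (int1.add intN) (intF _ _) fun τ hτ => ?_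
          have b1 := real_inner_le_norm (f τ) (R (I e))
          have b2 := (abs_le.1 (hF.boundM τ (u τ) e)).1
          have b3 : |(N t - N τ) (u τ) e| ≤ K * h * ‖u τ‖ * ‖e‖ := by
            calc |(N t - N τ) (u τ) e| ≤ ‖N t - N τ‖ * ‖u τ‖ * ‖e‖ := (N t - N τ).le_opNorm₂ _ _
              _ ≤ K * h * ‖u τ‖ * ‖e‖ := by
                gcongr
                refine (hF.lipschitzN _ _).trans ?_
                have := hF.K_nonneg
                gcongr
                rw [abs_of_nonneg (by linarith [hτ.2])]
                linarith [hτ.1]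
          have b4 := (abs_le.1 b3).2
          simp only [sub_apply, ContinuousLinearMap.comp_apply] at b4 b2
          simp only [hFdef]
          nlinarith
      _ ≤ ∫ τ in (t - h)..t, F τ := by
          rw [← intervalIntegral.integral_add_adjacent_intervals (intF (t - h) σ) (intF σ t)]
          have := intervalIntegral.integral_nonneg hσh' (f := F) (μ := volume) fun τ _ => hF0 τ
          linarith
  have hFint : ∫ τ in (t - h)..t, F τ
      = h * (steklov h (fun τ => ‖f τ‖ + Λ * ‖R (I (u τ))‖) t * ‖R (I e)‖
        + K * steklov h (fun τ => ‖u τ‖) t * ‖h • e‖) := by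
    rw [intervalIntegral.integral_add
      (((intf _ _).norm.add ((intJ _ _).const_mul Λ)).mul_const _)
      (((intu _ _).norm.const_mul (K * h)).mul_const ‖e‖), intervalIntegral.integral_mul_const,
      intervalIntegral.integral_mul_const, intervalIntegral.integral_const_mul, steklov, steklov,
      norm_smul, Real.norm_of_nonneg hh.le]
    simp only [smul_eq_mul]
    field_simp
  rw [hFint, ← mul_add] at hle
  exact le_of_mul_le_mul_left hle hh

end Abstract

/-! ### Uniform bounds for difference quotients -/

section AbstractBound

variable {X Y L : Type*} [NormedAddCommGroup X] [InnerProductSpace ℝ X] [CompleteSpace X]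
  [NormedAddCommGroup Y] [InnerProductSpace ℝ Y] [CompleteSpace Y]
  [NormedAddCommGroup L] [InnerProductSpace ℝ L] [CompleteSpace L]

variable {I : X →L[ℝ] Y} {R : Y →L[ℝ] L} {N M : ℝ → X →L[ℝ] X →L[ℝ] ℝ} {T K Λ c₀ c₁ : ℝ}
  {f : ℝ → L} {u₀ : X} {u : ℝ → X} {z : ℝ → Y}

lemma intervalIntegral_le_integral {g : ℝ → ℝ} (hg : Integrable g) (h0 : ∀ t, 0 ≤ g t) {s t : ℝ}
    (hst : s ≤ t) : ∫ τ in s..t, g τ ≤ ∫ τ, g τ := by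
  rw [intervalIntegral.integral_of_le hst]
  exact setIntegral_le_integral hg (ae_of_all _ h0)

lemma steklov_sub_steklov {w : ℝ → X} (hw : ∀ a b, IntervalIntegrable w volume a b) (h s t : ℝ) :
    steklov h w t - steklov h w s = ∫ τ in s..t, h⁻¹ • (w τ - w (τ - h)) := by
  have h1 : IntervalIntegrable (fun τ => w (τ - h)) volume s t := by
    simpa using (hw (s - h) (t - h)).comp_sub_right h
  rw [intervalIntegral.integral_smul, intervalIntegral.integral_sub (hw s t) h1,
    intervalIntegral.integral_comp_sub_right (fun τ => w τ) h, steklov, steklov, ← smul_sub]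
  congr 1
  rw [intervalIntegral.integral_interval_sub_interval_comm (hw _ _) (hw _ _) (hw _ _)]
  rw [intervalIntegral.integral_symm t s, intervalIntegral.integral_symm (t - h) (s - h)]
  abel

lemma SplitForm.apply_le {J : X →L[ℝ] L} (hF : SplitForm J N M K Λ c₀ c₁) (t : ℝ) (x y : X) :
    N t x y ≤ c₁ * ‖x‖ * ‖y‖ := by
  refine (le_abs_self _).trans (((N t).le_opNorm₂ x y).trans ?_)
  gcongr
  exact hF.boundN t

set_option maxHeartbeats 1000000 in
-- The Steklov average W is differentiable in time with derivative e + h⁻¹ p, where e is the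
-- quotient and p the initial correction. So `IsAbstractSolution.quotient_inequality` estimates the
-- derivative of N(W, W). The bound is only linear in the supremum m of ‖W‖, and can therefore be
-- closed afterwards by a quadratic inequality.
lemma IsAbstractSolution.steklov_energy_le (hF : SplitForm (R ∘L I) N M K Λ c₀ c₁)
    (hu : IsAbstractSolution I R N M T f u₀ u z) (hT : 0 < T) {h m : ℝ} (hh : 0 < h)
    (hm0 : 0 ≤ m) (hm : ∀ t ∈ Icc 0 T, ‖steklov h u t‖ ≤ m) {s : ℝ} (hs0 : 0 ≤ s) (hsT : s ≤ T) :
    N s (steklov h u s) (steklov h u s) + ∫ t in (0 : ℝ)..s, ‖R (I (quotientTest h u₀ u t))‖ ^ 2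
      ≤ (∫ t, (‖f t‖ + Λ * ‖R (I (u t))‖) ^ 2) + 8 * K * (∫ t, ‖u t‖ ^ 2)
        + 3 * K * T * ‖u₀‖ ^ 2 + 2 * c₁ * m * ‖u₀‖ := by
  have hK := hF.K_nonneg
  have hΛ := hF.Λ_nonneg
  have hc₁ : 0 ≤ c₁ := (norm_nonneg (N 0)).trans (hF.boundN 0)
  set W := steklov h u with hW
  set W' : ℝ → X := fun τ => h⁻¹ • (u τ - u (τ - h)) with hW'
  have hu2 := hu.memLp
  have hush : MemLp (fun τ => u (τ - h)) 2 volume :=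
    hu2.comp_measurePreserving (measurePreserving_sub_right volume h)
  have hWm := memLp_steklov hu2 hh
  have hW'm : MemLp W' 2 volume := (hu2.sub hush).const_smul h⁻¹
  have hWc : Continuous W := continuous_steklov (locallyIntegrable_of_memLp_two hu2) h
  have hNW : Continuous fun t => N t (W t) := hF.continuousN.clm_apply hWc
  set a : ℝ → X := fun t => (InnerProductSpace.toDual ℝ X).symm (N t (W t)) with ha
  have hac : Continuous a := (InnerProductSpace.toDual ℝ X).symm.continuous.comp hNW
  have hain : ∀ t x, inner ℝ (a t) x = N t (W t) x := fun t x =>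
    InnerProductSpace.toDual_symm_apply
  have ham : MemLp a 2 volume := by
    refine hWm.1.of_le_mul (c := c₁) hac.aestronglyMeasurable (ae_of_all _ fun t => ?_)
    rw [ha, LinearIsometryEquiv.norm_map]
    refine ((N t).le_opNorm _).trans ?_
    gcongr
    exact hF.boundN t
  have hbc : Continuous fun t => N t (W t) (W t) := hNW.clm_apply hWc
  -- The energy of the average starts from zero; u₀ enters only through the correction p.
  have hW0 : W 0 = 0 := by
    have : ∫ τ in (0 - h)..0, u τ = 0 := by
      refine (intervalIntegral.integral_congr (g := fun _ => (0 : X)) fun τ hτ => ?_).trans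
        (by simp)
      rw [uIcc_of_le (by linarith)] at hτ
      exact hu.eq_zero _ fun hm => by linarith [hτ.2, hm.1]
    rw [hW, steklov, this, smul_zero]
  -- After averaging, the derivative W' lies in X itself. So J is the identity and the Riesz
  -- representative of N t (W t) serves as residual.
  have energy := energy_inequality (ContinuousLinearMap.id ℝ X) N hF.symmN hF.nonnegN hs0
    (v := W) (a := a) (w := W') (k := fun _ => 0) (q := fun x => K * ‖x‖ ^ 2) ham hW'm
    (MemLp.zero (μ := volume) (p := 2)) (fun _ => le_rfl) (fun x => by positivity)
    (fun t' t _ _ _ => steklov_sub_steklov (intervalIntegrable_of_memLp_two hu2) h t' t)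
    (ae_of_all _ fun t _ φ => by simp [hain])
    (fun t' t _ h2 _ x => by
      calc N t x x - N t' x x = (N t - N t') x x := by simp
        _ ≤ ‖N t - N t'‖ * ‖x‖ * ‖x‖ := (le_abs_self _).trans ((N t - N t').le_opNorm₂ x x)
        _ ≤ (K * |t - t'|) * ‖x‖ * ‖x‖ := by gcongr; exact hF.lipschitzN _ _
        _ = _ := by rw [abs_of_nonneg (by linarith)]; ring)
    (hbc.intervalIntegrable _ _)
    ((hWc.norm.pow 2).const_mul K |>.intervalIntegrable _ _)
    (fun η hη => by
      have h1 : Tendsto (fun t => N t (W t) (W t)) (𝓝[<] s) (𝓝 (N s (W s) (W s))) :=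
        hbc.continuousAt.mono_left nhdsWithin_le_nhds
      exact (h1.eventually_const_lt (by linarith : N s (W s) (W s) - η < _)).mono
        fun t ht => ht.le)
  rw [hW0] at energy
  simp only [hain, zero_mul, mul_zero, add_zero, map_zero, zero_add] at energy
  -- the right-hand side
  set F : ℝ → ℝ := fun τ => ‖f τ‖ + Λ * ‖R (I (u τ))‖ with hFd
  have hFm : MemLp F 2 volume :=
    hu.memLp_rhs.norm.add (((R ∘L I).comp_memLp' hu2).norm.const_mul Λ)
  have hun := hu2.norm
  have hSF := memLp_steklov hFm hh
  have hSu := memLp_steklov hun hh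
  set e := quotientTest h u₀ u with he
  set p : ℝ → X := fun t => if t ≤ h then u₀ else 0 with hp
  have hpm : StronglyMeasurable p :=
    StronglyMeasurable.ite measurableSet_Iic stronglyMeasurable_const stronglyMeasurable_const
  have he_eq : ∀ t, e t = h⁻¹ • (u t - u (t - h) - p t) := fun t => rfl
  have hp_le : ∀ t, ‖p t‖ ≤ ‖u₀‖ := fun t => by
    simp only [hp]; split_ifs <;> simp
  have hJe : IntervalIntegrable (fun t => ‖R (I (e t))‖ ^ 2) volume 0 s := by
    rw [intervalIntegrable_iff, uIoc_of_le hs0]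
    have h1 : MemLp p 2 (volume.restrict (Ioc 0 s)) :=
      MemLp.of_bound hpm.aestronglyMeasurable ‖u₀‖ (ae_of_all _ hp_le)
    have h2 : MemLp e 2 (volume.restrict (Ioc 0 s)) :=
      (((hu2.sub hush).restrict _).sub h1).const_smul h⁻¹
    exact integrable_norm_sq ((R ∘L I).comp_memLp' h2)
  -- These terms collect what Young's inequality produces. Integrated, those with u amount to K + 2
  -- · 3K + K = 8K times ∫‖u‖².
  set G : ℝ → ℝ := fun t => ‖steklov h F t‖ ^ 2 + K * ‖steklov h (fun τ => ‖u τ‖) t‖ ^ 2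
    + 3 * K * (‖u t‖ ^ 2 + ‖u (t - h)‖ ^ 2) + K * ‖W t‖ ^ 2 with hG
  have i1 := integrable_norm_sq hSF.1
  have i2 := (integrable_norm_sq hSu.1).const_mul K
  have i3 := ((integrable_norm_sq hu2).add (integrable_norm_sq hush)).const_mul (3 * K)
  have i4 := (integrable_norm_sq hWm.1).const_mul K
  have hGi : Integrable G := ((i1.add i2).add i3).add i4
  have hG0 : ∀ t, 0 ≤ G t := fun t => by positivity
  have hGle : ∫ t, G t ≤ (∫ t, F t ^ 2) + 8 * K * ∫ t, ‖u t‖ ^ 2 := by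
    have e1 : ∫ t, G t = (∫ t, ‖steklov h F t‖ ^ 2)
        + (∫ t, K * ‖steklov h (fun τ => ‖u τ‖) t‖ ^ 2)
        + (∫ t, 3 * K * (‖u t‖ ^ 2 + ‖u (t - h)‖ ^ 2)) + ∫ t, K * ‖W t‖ ^ 2 := by
      have a1 := integral_add ((i1.add i2).add i3) i4
      have a2 := integral_add (i1.add i2) i3
      have a3 := integral_add i1 i2
      simp only [Pi.add_apply] at a1 a2 a3
      rw [← a3, ← a2, ← a1]
    have e2 : ∫ t, (‖u t‖ ^ 2 + ‖u (t - h)‖ ^ 2) = 2 * ∫ t, ‖u t‖ ^ 2 := by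
      rw [integral_add (integrable_norm_sq hu2) (integrable_norm_sq hush),
        integral_sub_right_eq_self (fun t => ‖u t‖ ^ 2) h]
      ring
    rw [e1, integral_const_mul, integral_const_mul, integral_const_mul, e2]
    have f1 := hSF.2
    have f2 := mul_le_mul_of_nonneg_left hSu.2 hK
    have f3 := mul_le_mul_of_nonneg_left hWm.2 hK
    simp only [Real.norm_eq_abs, sq_abs, abs_norm] at f1 f2 ⊢
    linarith only [f1, f2, f3]
  -- The correction p has size h⁻¹ ‖u₀‖ in W', but lives on an interval of length h only, so its
  -- contribution stays bounded as h → 0.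
  have hi : Integrable ((Ioc 0 h).indicator fun _ => 2 * h⁻¹ * c₁ * m * ‖u₀‖) :=
    (integrable_indicator_iff measurableSet_Ioc).2 (integrableOn_const (by simp))
  have hival : ∫ t, (Ioc 0 h).indicator (fun _ => 2 * h⁻¹ * c₁ * m * ‖u₀‖) t
      = 2 * c₁ * m * ‖u₀‖ := by
    rw [integral_indicator measurableSet_Ioc, setIntegral_const, smul_eq_mul, Real.volume_real_Ioc,
      sub_zero, max_eq_left hh.le]
    field_simp
  have hpt : ∀ᵐ t, t ∈ Ioo 0 T → 2 * N t (W t) (W' t) + K * ‖W t‖ ^ 2 ≤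
      (G t + (Ioc 0 h).indicator (fun _ => 2 * h⁻¹ * c₁ * m * ‖u₀‖) t + 3 * K * ‖u₀‖ ^ 2)
        - ‖R (I (e t))‖ ^ 2 := by
    filter_upwards [hu.quotient_inequality hF hT hh] with t ht hts
    have q1 := ht hts
    have q2 : N t (W t) (W' t) = N t (W t) (e t) + h⁻¹ * N t (W t) (p t) := by
      have : W' t = e t + h⁻¹ • p t := by
        rw [he_eq, ← smul_add, sub_add_cancel]
      rw [this, map_add, map_smul, smul_eq_mul]
    have q3 : 2 * (h⁻¹ * N t (W t) (p t))
        ≤ (Ioc 0 h).indicator (fun _ => 2 * h⁻¹ * c₁ * m * ‖u₀‖) t := by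
      by_cases hth : t ≤ h
      · rw [indicator_of_mem (show t ∈ Ioc 0 h from ⟨hts.1, hth⟩)]
        have hpe : p t = u₀ := if_pos hth
        have := hF.apply_le t (W t) (p t)
        rw [hpe] at this ⊢
        have h3 : c₁ * ‖W t‖ * ‖u₀‖ ≤ c₁ * m * ‖u₀‖ := by
          gcongr; exact hm t (Ioo_subset_Icc_self hts)
        calc 2 * (h⁻¹ * N t (W t) u₀) ≤ 2 * (h⁻¹ * (c₁ * m * ‖u₀‖)) := by
              gcongr; exact this.trans h3
          _ = _ := by ring
      · have hpe : p t = 0 := if_neg hth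
        rw [hpe, map_zero]
        simp only [mul_zero]
        exact indicator_nonneg (fun _ _ => by positivity) t
    have q4 : ‖h • e t‖ ^ 2 ≤ 3 * (‖u t‖ ^ 2 + ‖u (t - h)‖ ^ 2 + ‖u₀‖ ^ 2) := by
      rw [he_eq, smul_smul, mul_inv_cancel₀ hh.ne', one_smul]
      have n1 : ‖u t - u (t - h) - p t‖ ≤ ‖u t‖ + ‖u (t - h)‖ + ‖u₀‖ :=
        (norm_sub_le _ _).trans (add_le_add (norm_sub_le _ _) (hp_le t))
      calc _ ≤ (‖u t‖ + ‖u (t - h)‖ + ‖u₀‖) ^ 2 := by gcongr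
        _ ≤ _ := by nlinarith [sq_nonneg (‖u t‖ - ‖u (t - h)‖), sq_nonneg (‖u t‖ - ‖u₀‖),
                      sq_nonneg (‖u (t - h)‖ - ‖u₀‖)]
    have q5 := mul_le_mul_of_nonneg_left q4 hK
    have q6 : 2 * (steklov h (fun τ => ‖u τ‖) t * ‖h • e t‖)
        ≤ ‖steklov h (fun τ => ‖u τ‖) t‖ ^ 2 + ‖h • e t‖ ^ 2 := by
      rw [Real.norm_eq_abs, sq_abs]
      nlinarith [sq_nonneg (steklov h (fun τ => ‖u τ‖) t - ‖h • e t‖)]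
    have q7 := mul_le_mul_of_nonneg_left q6 hK
    -- Of the two copies of ‖R I e‖² provided by the quotient inequality, one is spent here and the
    -- other remains on the left of the estimate.
    have q8 : 2 * (steklov h F t * ‖R (I (e t))‖) ≤ ‖steklov h F t‖ ^ 2 + ‖R (I (e t))‖ ^ 2 := by
      rw [Real.norm_eq_abs, sq_abs]
      nlinarith [sq_nonneg (steklov h F t - ‖R (I (e t))‖)]
    simp only [hG]
    rw [q2]
    linarith only [q1, q3, q5, q7, q8]
  have hcint : IntervalIntegrable (fun _ : ℝ => 3 * K * ‖u₀‖ ^ 2) volume 0 s := by simp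
  have hmono : ∫ t in (0 : ℝ)..s, (2 * N t (W t) (W' t) + K * ‖W t‖ ^ 2) ≤
      ∫ t in (0 : ℝ)..s, ((G t + (Ioc 0 h).indicator (fun _ => 2 * h⁻¹ * c₁ * m * ‖u₀‖) t
        + 3 * K * ‖u₀‖ ^ 2) - ‖R (I (e t))‖ ^ 2) := by
    refine intervalIntegral.integral_mono_ae_restrict hs0 ?_
      (((hGi.intervalIntegrable.add hi.intervalIntegrable).add hcint).sub hJe) ?_
    · have h1 := (integrable_inner ham hW'm).const_mul 2
      simp only [hain] at h1
      exact (h1.add i4).intervalIntegrable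
    · rw [← restrict_Ioo_eq_restrict_Icc]
      refine (ae_restrict_iff' measurableSet_Ioo).2 ?_
      filter_upwards [hpt] with t ht hts
      exact ht ⟨hts.1, hts.2.trans_le hsT⟩
  rw [intervalIntegral.integral_sub ((hGi.intervalIntegrable.add hi.intervalIntegrable).add hcint)
      hJe, intervalIntegral.integral_add (hGi.intervalIntegrable.add hi.intervalIntegrable) hcint,
      intervalIntegral.integral_add hGi.intervalIntegrable hi.intervalIntegrable,
      intervalIntegral.integral_const, smul_eq_mul, sub_zero] at hmono
  have g1 := intervalIntegral_le_integral hGi hG0 hs0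
  have g2 := intervalIntegral_le_integral hi
    (fun t => indicator_nonneg (fun _ _ => by positivity) t) hs0
  rw [hival] at g2
  have g3 : s * (3 * K * ‖u₀‖ ^ 2) ≤ T * (3 * K * ‖u₀‖ ^ 2) := by gcongr
  linarith only [energy, hmono, g1, g2, g3, hGle]

/-- Uniform bounds for the difference quotients of a weak solution. -/
theorem IsAbstractSolution.exists_quotient_bound (hF : SplitForm (R ∘L I) N M K Λ c₀ c₁)
    (hu : IsAbstractSolution I R N M T f u₀ u z) (hT : 0 < T) :
    ∃ C, ∀ h > 0, (∀ t ∈ Icc 0 T, ‖steklov h u t‖ ≤ C) ∧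
      ∫ t in (0 : ℝ)..T, ‖h⁻¹ • (R (z t) - R (z (max (t - h) 0)))‖ ^ 2 ≤ C := by
  have hc₁ : 0 ≤ c₁ := (norm_nonneg (N 0)).trans (hF.boundN 0)
  set D := (∫ t, (‖f t‖ + Λ * ‖R (I (u t))‖) ^ 2) + 8 * K * (∫ t, ‖u t‖ ^ 2)
        + 3 * K * T * ‖u₀‖ ^ 2 with hD
  have hRz : ContinuousOn (fun t => R (z t)) (Icc 0 T) := R.continuous.comp_continuousOn hu.continuousOn
  obtain ⟨Z, hZ⟩ := isCompact_Icc.exists_bound_of_continuousOn hRz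
  have hZ0 : 0 ≤ Z := (norm_nonneg _).trans (hZ 0 ⟨le_rfl, hT.le⟩)
  have hJu : ∀ᵐ t, ‖(R ∘L I) (u t)‖ ≤ Z := by
    filter_upwards [hu.ae_eq] with t ht
    by_cases hts : t ∈ Ioo 0 T
    · rw [ContinuousLinearMap.comp_apply, ht hts]; exact hZ t (Ioo_subset_Icc_self hts)
    · rw [hu.eq_zero t hts, map_zero, norm_zero]; exact hZ0
  set B := 2 * c₀ * c₁ * ‖u₀‖ with hB
  set A := c₀ * (D + Z ^ 2) with hA
  -- From m² ≤ A + B m and 2 B m ≤ m² + B² follows m² ≤ 2A + B².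
  set m₀ := Real.sqrt (2 * |A| + B ^ 2) with hm₀
  have hm₀0 : 0 ≤ m₀ := Real.sqrt_nonneg _
  have key : ∀ h > 0, ∀ t ∈ Icc 0 T, ‖steklov h u t‖ ≤ m₀ := by
    intro h hh
    have hWc : Continuous (steklov h u) :=
      continuous_steklov (locallyIntegrable_of_memLp_two hu.memLp) h
    -- At a maximum point of the norm, the left side of the energy bound controls the same m that
    -- appears linearly on its right side.
    obtain ⟨s, hs, hmax⟩ := isCompact_Icc.exists_isMaxOn
      (nonempty_Icc.2 hT.le) hWc.norm.continuousOn
    set m := ‖steklov h u s‖ with hm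
    have e1 := hu.steklov_energy_le hF hT hh (norm_nonneg _) hmax hs.1 hs.2
    rw [← hD] at e1
    have e2 : 0 ≤ ∫ t in (0 : ℝ)..s, ‖R (I (quotientTest h u₀ u t))‖ ^ 2 :=
      intervalIntegral.integral_nonneg hs.1 fun t _ => by positivity
    have e3 : ‖(R ∘L I) (steklov h u s)‖ ≤ Z := by
      have c1 : (R ∘L I) (steklov h u s) = steklov h (fun τ => (R ∘L I) (u τ)) s := by
        rw [steklov, steklov, map_smul]
        congr 1
        exact ((R ∘L I).intervalIntegral_comp_comm
          (intervalIntegrable_of_memLp_two hu.memLp _ _)).symm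
      rw [c1, steklov, norm_smul, Real.norm_of_nonneg (by positivity)]
      have : ‖∫ τ in (s - h)..s, (R ∘L I) (u τ)‖ ≤ Z * |s - (s - h)| :=
        intervalIntegral.norm_integral_le_of_norm_le_const_ae (hJu.mono fun t ht _ => ht)
      rw [sub_sub_cancel, abs_of_pos hh] at this
      calc h⁻¹ * _ ≤ h⁻¹ * (Z * h) := by gcongr
        _ = Z := by field_simp
    have e4 := hF.coercive s (steklov h u s)
    have hc₀ := hF.c₀_nonneg
    have e5 : m ^ 2 ≤ A + B * m := by
      calc m ^ 2 ≤ c₀ * (N s (steklov h u s) (steklov h u s) + ‖(R ∘L I) (steklov h u s)‖ ^ 2) := e4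
        _ ≤ c₀ * ((D + 2 * c₁ * m * ‖u₀‖) + Z ^ 2) := by
            gcongr
            linarith
        _ = _ := by rw [hA, hB]; ring
    have e6 : m ≤ m₀ := by
      refine Real.le_sqrt_of_sq_le ?_
      nlinarith [sq_nonneg (m - B), le_abs_self A]
    intro t ht
    exact (hmax ht).trans e6
  refine ⟨max m₀ (D + 2 * c₁ * m₀ * ‖u₀‖), fun h hh => ⟨fun t ht =>
    (key h hh t ht).trans (le_max_left _ _), ?_⟩⟩
  have e1 := hu.steklov_energy_le hF hT hh hm₀0 (key h hh) hT.le le_rfl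
  rw [← hD] at e1
  have e2 := hF.nonnegN T (steklov h u T)
  have e3 : ∫ t in (0 : ℝ)..T, ‖h⁻¹ • (R (z t) - R (z (max (t - h) 0)))‖ ^ 2
      = ∫ t in (0 : ℝ)..T, ‖R (I (quotientTest h u₀ u t))‖ ^ 2 := by
    rw [intervalIntegral.integral_of_le hT.le, intervalIntegral.integral_of_le hT.le,
      integral_Ioc_eq_integral_Ioo, integral_Ioc_eq_integral_Ioo]
    refine setIntegral_congr_ae measurableSet_Ioo ?_
    filter_upwards [hu.sub_eq hh] with t ht hts
    rw [ht hts, smul_smul, inv_mul_cancel₀ hh.ne', one_smul]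
  rw [e3]
  exact le_trans (by linarith) (le_max_right _ _)

end AbstractBound

/-! ### Continuity in the energy space and the energy estimate -/

section AbstractRegularity

variable {X Y L : Type*} [NormedAddCommGroup X] [InnerProductSpace ℝ X] [CompleteSpace X]
  [NormedAddCommGroup Y] [InnerProductSpace ℝ Y] [CompleteSpace Y]
  [NormedAddCommGroup L] [InnerProductSpace ℝ L] [CompleteSpace L]

variable {I : X →L[ℝ] Y} {R : Y →L[ℝ] L} {N M : ℝ → X →L[ℝ] X →L[ℝ] ℝ} {T K Λ c₀ c₁ : ℝ}
  {f w : ℝ → L} {u₀ : X} {u v : ℝ → X} {z : ℝ → Y}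

/-- Continuity of the representative gives convergence at every positive time, not just almost
everywhere. Backward averages also work at t = T, but at t = 0 they would see only values from
outside the interval. -/
lemma tendsto_steklov_left {g : ℝ → Y} {y : ℝ → Y} {t : ℝ} (ht : 0 < t) (htT : t ≤ T)
    (hy : ContinuousOn y (Icc 0 T)) (hg : ∀ᵐ τ, τ ∈ Ioo 0 T → g τ = y τ) :
    Tendsto (fun h => steklov h g t) (𝓝[>] 0) (𝓝 (y t)) := by
  rw [Metric.tendsto_nhds]
  intro η hη
  have hc : ContinuousWithinAt y (Icc 0 T) t := hy t ⟨ht.le, htT⟩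
  obtain ⟨δ, hδ, hball⟩ := Metric.continuousWithinAt_iff.1 hc (η / 2) (by positivity)
  have : Ioo (0 : ℝ) (min δ t) ∈ 𝓝[>] (0 : ℝ) := Ioo_mem_nhdsGT (lt_min hδ ht)
  filter_upwards [this] with h hh
  have hh0 := hh.1
  have hhδ := hh.2.trans_le (min_le_left _ _)
  have hht := hh.2.trans_le (min_le_right _ _)
  have hyc : ContinuousOn y (uIcc (t - h) t) := hy.mono (by
    rw [uIcc_of_le (by linarith)]
    exact Icc_subset_Icc (by linarith) htT)
  have e1 : ∫ τ in (t - h)..t, g τ = ∫ τ in (t - h)..t, y τ := by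
    rw [intervalIntegral.integral_of_le (by linarith), intervalIntegral.integral_of_le (by linarith),
      integral_Ioc_eq_integral_Ioo, integral_Ioc_eq_integral_Ioo]
    refine setIntegral_congr_ae measurableSet_Ioo ?_
    filter_upwards [hg] with τ hτ hτs
    exact hτ ⟨by linarith [hτs.1], hτs.2.trans_le htT⟩
  have e2 : steklov h g t - y t = h⁻¹ • ∫ τ in (t - h)..t, (y τ - y t) := by
    rw [intervalIntegral.integral_sub hyc.intervalIntegrable (by simp),
      intervalIntegral.integral_const, sub_sub_cancel, smul_sub, smul_smul,
      inv_mul_cancel₀ hh0.ne', one_smul, steklov, e1]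
  rw [dist_eq_norm, e2, norm_smul, Real.norm_of_nonneg (by positivity)]
  have e3 : ‖∫ τ in (t - h)..t, (y τ - y t)‖ ≤ η / 2 * |t - (t - h)| := by
    refine intervalIntegral.norm_integral_le_of_norm_le_const fun τ hτ => ?_
    rw [uIoc_of_le (by linarith)] at hτ
    rw [← dist_eq_norm]
    refine (hball ⟨by linarith [hτ.1], hτ.2.trans htT⟩ ?_).le
    rw [Real.dist_eq, abs_lt]
    constructor <;> linarith [hτ.1, hτ.2]
  rw [sub_sub_cancel, abs_of_pos hh0] at e3
  calc h⁻¹ * _ ≤ h⁻¹ * (η / 2 * h) := by gcongr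
    _ = η / 2 := by field_simp
    _ < η := by linarith

/-- The continuous representative takes values in the energy space. -/
theorem IsAbstractSolution.exists_bounded_trajectory (hF : SplitForm (R ∘L I) N M K Λ c₀ c₁)
    (hu : IsAbstractSolution I R N M T f u₀ u z) (hT : 0 < T) (hI : Function.Injective I) :
    ∃ (v : ℝ → X) (C : ℝ), ∀ t ∈ Icc 0 T, I (v t) = z t ∧ ‖v t‖ ≤ C := by
  obtain ⟨C, hC⟩ := hu.exists_quotient_bound hF hT
  have key : ∀ t ∈ Icc 0 T, ∃ x : X, I x = z t ∧ ‖x‖ ≤ max C ‖u₀‖ := by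
    intro t ht
    rcases ht.1.eq_or_lt with h0 | h0
    -- At time 0 the averages carry no information; the value there is in the energy space because
    -- u₀ is.
    · exact ⟨u₀, by rw [← h0, hu.initial], le_max_right _ _⟩
    · have h1 : Tendsto (fun h => I (steklov h u t)) (𝓝[>] 0) (𝓝 (z t)) := by
        have := tendsto_steklov_left (g := fun τ => I (u τ)) h0 ht.2 hu.continuousOn hu.ae_eq
        refine this.congr fun h => ?_
        rw [steklov, steklov, map_smul]
        congr 1
        exact I.intervalIntegral_comp_comm (intervalIntegrable_of_memLp_two hu.memLp _ _)
      obtain ⟨x, hx1, hx2, -⟩ := exists_weak_limit_of_tendsto I hI (C := C) (by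
        filter_upwards [self_mem_nhdsWithin] with h hh
        exact (hC h hh).1 t ht) h1
      exact ⟨x, hx2, hx1.trans (le_max_left _ _)⟩
  choose! v hv using key
  exact ⟨v, _, hv⟩

/-- Boundedness in X together with strong continuity in the larger space Y gives weak continuity in
X. -/
lemma tendsto_inner_trajectory (hI : Function.Injective I) (hz : ContinuousOn z (Icc 0 T)) {C : ℝ}
    (hv : ∀ t ∈ Icc 0 T, I (v t) = z t ∧ ‖v t‖ ≤ C) {s : ℝ} (hs : s ∈ Icc 0 T) (x : X) :
    Tendsto (fun t => inner ℝ (v t) x) (𝓝[Icc 0 T] s) (𝓝 (inner ℝ (v s) x)) := by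
  have : (𝓝[Icc 0 T] s).NeBot := mem_closure_iff_nhdsWithin_neBot.1 (subset_closure hs)
  have h1 : Tendsto (fun t => I (v t)) (𝓝[Icc 0 T] s) (𝓝 (z s)) := by
    refine (hz s hs).tendsto.congr' ?_
    filter_upwards [self_mem_nhdsWithin] with t ht
    exact (hv t ht).1.symm
  obtain ⟨x₀, -, h2, h3⟩ := exists_weak_limit_of_tendsto I hI (C := C) (by
    filter_upwards [self_mem_nhdsWithin] with t ht
    exact (hv t ht).2) h1
  have : x₀ = v s := hI (h2.trans (hv s hs).1.symm)
  rw [← this]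
  exact h3 x

lemma IsAbstractSolution.ae_trajectory_eq (hu : IsAbstractSolution I R N M T f u₀ u z)
    (hI : Function.Injective I) (hv : ∀ t ∈ Icc 0 T, I (v t) = z t) :
    ∀ᵐ t, t ∈ Ioo 0 T → v t = u t := by
  filter_upwards [hu.ae_eq] with t ht hts
  exact hI ((hv t (Ioo_subset_Icc_self hts)).trans (ht hts).symm)

/-- The equation holds in strong form at almost every time. -/
theorem IsAbstractSolution.ae_equation [SecondCountableTopology X]
    (hu : IsAbstractSolution I R N M T f u₀ u z) (hT : 0 < T) (hw : MemLp w 2 volume)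
    (hzw : ∀ s t, 0 ≤ s → s ≤ t → t ≤ T → R (z t) - R (z s) = ∫ τ in s..t, w τ) :
    ∀ᵐ t, t ∈ Ioo 0 T → ∀ φ, N t (u t) φ + M t (u t) φ = inner ℝ (f t - w t) (R (I φ)) := by
  have h1 : ∀ φ, ∀ᵐ t, t ∈ Ioo 0 T →
      N t (u t) φ + M t (u t) φ = inner ℝ (f t - w t) (R (I φ)) := by
    intro φ
    have hwi := fun a b => intervalIntegrable_of_memLp_two hw a b
    have hwφ : ∀ a b, IntervalIntegrable (fun τ => inner ℝ (R (I φ)) (w τ)) volume a b := fun a b =>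
      ⟨(innerSL ℝ (R (I φ))).integrable_comp (hwi a b).1,
        (innerSL ℝ (R (I φ))).integrable_comp (hwi a b).2⟩
    have hd := hu.intervalIntegrable_equation hT φ le_rfl hT.le le_rfl
    have key := ae_eq_zero_of_forall_integral_eq_zero hT
      (d := fun τ => (inner ℝ (f τ) (R (I φ)) - (N τ (u τ) φ + M τ (u τ) φ))
        - inner ℝ (R (I φ)) (w τ))
      ((intervalIntegrable_iff_integrableOn_Ioo_of_le hT.le).1 (hd.sub (hwφ 0 T))) (by
        intro t ht0 htT
        rw [intervalIntegral.integral_sub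
          (hu.intervalIntegrable_equation hT φ le_rfl ht0 htT) (hwφ 0 t),
          ← hu.inner_sub_eq_integral hT φ le_rfl ht0 htT, hzw 0 t le_rfl ht0 htT,
          real_inner_comm, sub_eq_zero]
        exact ((innerSL ℝ (R (I φ))).intervalIntegral_comp_comm (hwi 0 t)).symm)
    filter_upwards [key] with t ht hts
    have := ht hts
    rw [inner_sub_left, real_inner_comm (R (I φ)) (w t)]
    linarith
  -- The null set of times found above depends on φ. A countable dense family yields one null set,
  -- and continuity in φ does the rest.
  have h2 : ∀ᵐ t, ∀ n : ℕ, t ∈ Ioo 0 T → N t (u t) (TopologicalSpace.denseSeq X n)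
      + M t (u t) (TopologicalSpace.denseSeq X n)
      = inner ℝ (f t - w t) (R (I (TopologicalSpace.denseSeq X n))) :=
    ae_all_iff.2 fun n => h1 _
  filter_upwards [h2] with t ht hts φ
  have c1 : Continuous fun φ => N t (u t) φ + M t (u t) φ := by fun_prop
  have c2 : Continuous fun φ => inner ℝ (f t - w t) (R (I φ)) := by fun_prop
  exact congrFun ((TopologicalSpace.denseRange_denseSeq X).equalizer c1 c2
    (funext fun n => ht n hts)) φ

lemma SplitForm.tendsto_apply (hF : SplitForm (R ∘L I) N M K Λ c₀ c₁)
    (hI : Function.Injective I) (hz : ContinuousOn z (Icc 0 T)) {C : ℝ}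
    (hv : ∀ t ∈ Icc 0 T, I (v t) = z t ∧ ‖v t‖ ≤ C) {s : ℝ} (hs : s ∈ Icc 0 T) :
    Tendsto (fun t => N t (v t) (v s)) (𝓝[Icc 0 T] s) (𝓝 (N s (v s) (v s))) := by
  set y := (InnerProductSpace.toDual ℝ X).symm (N s (v s)) with hy
  have h1 : Tendsto (fun t => N s (v s) (v t)) (𝓝[Icc 0 T] s) (𝓝 (N s (v s) (v s))) := by
    have := tendsto_inner_trajectory hI hz hv hs y
    have e : ∀ x, inner ℝ x y = N s (v s) x := fun x => by
      rw [real_inner_comm, hy, InnerProductSpace.toDual_symm_apply]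
    simpa only [e] using this
  have h2 : Tendsto (fun t => (N t (v s) - N s (v s)) (v t)) (𝓝[Icc 0 T] s) (𝓝 0) := by
    have h3 : Tendsto (fun t => ‖N t (v s) - N s (v s)‖ * C) (𝓝[Icc 0 T] s) (𝓝 0) := by
      have h4 : Continuous fun t => N t (v s) := hF.continuousN.clm_apply continuous_const
      have h5 : Continuous fun t => ‖N t (v s) - N s (v s)‖ * C :=
        ((h4.sub continuous_const).norm).mul continuous_const
      have := (h5.tendsto s).mono_left (nhdsWithin_le_nhds (s := Icc 0 T))
      simpa using this
    refine squeeze_zero_norm' ?_ h3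
    filter_upwards [self_mem_nhdsWithin] with t ht
    exact (ContinuousLinearMap.le_opNorm _ _).trans (by gcongr; exact (hv t ht).2)
  have := h1.add h2
  rw [add_zero] at this
  refine this.congr fun t => ?_
  rw [hF.symmN t (v t) (v s), sub_apply]
  ring

/-- Expanding N t (v t − v s, v t − v s) ≥ 0 bounds the energy at t from below by terms that
converge under weak continuity, by `SplitForm.tendsto_apply`. -/
lemma SplitForm.lowerSemicontinuous (hF : SplitForm (R ∘L I) N M K Λ c₀ c₁)
    (hI : Function.Injective I) (hz : ContinuousOn z (Icc 0 T)) {C : ℝ}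
    (hv : ∀ t ∈ Icc 0 T, I (v t) = z t ∧ ‖v t‖ ≤ C) {s : ℝ} (hs : s ∈ Icc 0 T) {η : ℝ}
    (hη : 0 < η) : ∀ᶠ t in 𝓝[Icc 0 T] s, N s (v s) (v s) - η ≤ N t (v t) (v t) := by
  have h1 := hF.tendsto_apply hI hz hv hs
  have h2 : Tendsto (fun t => N t (v s) (v s)) (𝓝[Icc 0 T] s) (𝓝 (N s (v s) (v s))) := by
    have : Continuous fun t => N t (v s) (v s) :=
      (hF.continuousN.clm_apply continuous_const).clm_apply continuous_const
    exact (this.tendsto s).mono_left nhdsWithin_le_nhds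
  have h3 := ((h1.const_mul 2).sub h2)
  have h4 := h3.eventually_const_lt
    (by linarith : N s (v s) (v s) - η < 2 * N s (v s) (v s) - N s (v s) (v s))
  filter_upwards [h4] with t ht
  have := hF.nonnegN t (v t - v s)
  simp only [map_sub, sub_apply] at this
  rw [hF.symmN t (v s) (v t)] at this
  linarith

lemma IsAbstractSolution.intervalIntegrable_trajectory (hF : SplitForm (R ∘L I) N M K Λ c₀ c₁)
    (hu : IsAbstractSolution I R N M T f u₀ u z) (hI : Function.Injective I)
    (hv : ∀ t ∈ Icc 0 T, I (v t) = z t) {s r : ℝ} (hs : 0 ≤ s) (hsr : s ≤ r) (hr : r ≤ T) :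
    IntervalIntegrable (fun t => N t (v t) (v t)) volume s r ∧
      IntervalIntegrable (fun t => K * ‖v t‖ ^ 2) volume s r := by
  have hvu := hu.ae_trajectory_eq hI hv
  have hae : ∀ᵐ t ∂volume.restrict (Ioo s r), v t = u t := by
    rw [ae_restrict_iff' measurableSet_Ioo]
    filter_upwards [hvu] with t ht hts
    exact ht ⟨hs.trans_lt hts.1, hts.2.trans_le hr⟩
  have hc₁ : 0 ≤ c₁ := (norm_nonneg (N 0)).trans (hF.boundN 0)
  rw [intervalIntegrable_iff_integrableOn_Ioo_of_le hsr,
    intervalIntegrable_iff_integrableOn_Ioo_of_le hsr]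
  have hsq := integrable_norm_sq hu.memLp
  constructor
  · have : Integrable (fun t => N t (u t) (u t)) volume := by
      refine (hsq.const_mul c₁).mono' ?_ (ae_of_all _ fun t => ?_)
      · have hc : Continuous fun p : ℝ × X => N p.1 p.2 p.2 :=
          ((hF.continuousN.comp continuous_fst).clm_apply continuous_snd).clm_apply continuous_snd
        exact hc.comp_aestronglyMeasurable (aestronglyMeasurable_id.prodMk hu.memLp.1)
      · rw [Real.norm_of_nonneg (hF.nonnegN t _)]
        refine (hF.apply_le t _ _).trans (le_of_eq (by ring))
    exact this.integrableOn.congr (hae.mono fun t ht => by simp only [ht])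
  · exact (hsq.const_mul K).integrableOn.congr (hae.mono fun t ht => by simp only [ht])

/-- Both-sided control of the leading energy. -/
lemma IsAbstractSolution.abs_energy_sub_le [SecondCountableTopology X]
    (hF : SplitForm (R ∘L I) N M K Λ c₀ c₁)
    (hu : IsAbstractSolution I R N M T f u₀ u z) (hT : 0 < T) (hI : Function.Injective I)
    (hw : MemLp w 2 volume)
    (hzw : ∀ s t, 0 ≤ s → s ≤ t → t ≤ T → R (z t) - R (z s) = ∫ τ in s..t, w τ)
    {C : ℝ} (hv : ∀ t ∈ Icc 0 T, I (v t) = z t ∧ ‖v t‖ ≤ C) {s r : ℝ} (hs : 0 ≤ s) (hsr : s ≤ r)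
    (hr : r ≤ T) :
    |N r (v r) (v r) - N s (v s) (v s)| ≤ ∫ t in s..r,
      (2 * ((‖f t - w t‖ + Λ * ‖R (I (u t))‖) * ‖w t‖) + K * ‖v t‖ ^ 2) := by
  have hK := hF.K_nonneg
  have hΛ := hF.Λ_nonneg
  set k : ℝ → ℝ := fun t => ‖f t - w t‖ + Λ * ‖R (I (u t))‖ with hk
  have hkm : MemLp k 2 volume :=
    (hu.memLp_rhs.sub hw).norm.add (((R ∘L I).comp_memLp' hu.memLp).norm.const_mul Λ)
  have hk0 : ∀ t, 0 ≤ k t := fun t => by positivity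
  have hres : ∀ᵐ t, t ∈ Ioo 0 T → ∀ φ, N t (v t) φ ≤ k t * ‖R (I φ)‖ := by
    filter_upwards [hu.ae_equation hT hw hzw, hu.ae_trajectory_eq hI fun t ht => (hv t ht).1]
      with t ht1 ht2 hts φ
    rw [ht2 hts]
    have e1 := ht1 hts φ
    have e2 := real_inner_le_norm (f t - w t) (R (I φ))
    have e3 := (abs_le.1 (hF.boundM t (u t) φ)).1
    simp only [ContinuousLinearMap.comp_apply] at e3
    simp only [hk]
    linarith
  have hinc : ∀ t' t x, N t x x - N t' x x ≤ |t - t'| * (K * ‖x‖ ^ 2) := fun t' t x => by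
    calc N t x x - N t' x x = (N t - N t') x x := by simp
      _ ≤ ‖N t - N t'‖ * ‖x‖ * ‖x‖ := (le_abs_self _).trans ((N t - N t').le_opNorm₂ x x)
      _ ≤ (K * |t - t'|) * ‖x‖ * ‖x‖ := by gcongr; exact hF.lipschitzN _ _
      _ = _ := by ring
  have hJ : ∀ t' t, s ≤ t' → t' ≤ t → t ≤ r →
      (R ∘L I) (v t) - (R ∘L I) (v t') = ∫ τ in t'..t, w τ := fun t' t h1 h2 h3 => by
    rw [ContinuousLinearMap.comp_apply, ContinuousLinearMap.comp_apply,
      (hv t ⟨by linarith, by linarith⟩).1, (hv t' ⟨by linarith, by linarith⟩).1]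
    exact hzw _ _ (by linarith) h2 (by linarith)
  obtain ⟨i1, i2⟩ := hu.intervalIntegrable_trajectory hF hI (fun t ht => (hv t ht).1) hs hsr hr
  have lsc : ∀ t₀ ∈ Icc s r, ∀ η > 0, ∀ᶠ t in 𝓝[Icc s r] t₀,
      N t₀ (v t₀) (v t₀) - η ≤ N t (v t) (v t) := fun t₀ ht₀ η hη =>
    (hF.lowerSemicontinuous hI hu.continuousOn hv ⟨hs.trans ht₀.1, ht₀.2.trans hr⟩ hη).filter_mono
      (nhdsWithin_mono _ (Icc_subset_Icc hs hr))
  rcases hsr.eq_or_lt with rfl | hlt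
  · simp
  -- The whole right-hand side f − w, together with M, goes into the norm bound k. Such a bound does
  -- not see the sign of the test function and so survives the time reversal below.
  have fwd := energy_inequality (R ∘L I) N hF.symmN hF.nonnegN hsr (v := v) (a := fun _ => 0)
    (w := w) (k := k) (q := fun x => K * ‖x‖ ^ 2) (MemLp.zero (μ := volume) (p := 2)) hw hkm hk0
    (fun x => by positivity) hJ (by
      filter_upwards [hres] with t ht hts φ
      rw [inner_zero_left, zero_add]
      exact ht ⟨hs.trans_lt hts.1, hts.2.trans_le hr⟩ φ)
    (fun t' t _ h2 _ x => by
      have := hinc t' t x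
      rwa [abs_of_nonneg (by linarith)] at this) i1 i2
    (fun η hη => (lsc r ⟨hsr, le_rfl⟩ η hη).filter_mono (by
      rw [← nhdsWithin_Ico_eq_nhdsLT hlt]
      exact nhdsWithin_mono _ Ico_subset_Icc_self))
  have hmp : MeasurePreserving (fun t : ℝ => s + r - t) volume volume :=
    Measure.measurePreserving_sub_left volume (s + r)
  have j1 : IntervalIntegrable (fun t => N (s + r - t) (v (s + r - t)) (v (s + r - t)))
      volume s r := by
    have := i1.comp_sub_left (s + r)
    simp only [add_sub_cancel_left, add_sub_cancel_right] at this
    exact this.symm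
  have j2 : IntervalIntegrable (fun t => K * ‖v (s + r - t)‖ ^ 2) volume s r := by
    have := i2.comp_sub_left (s + r)
    simp only [add_sub_cancel_left, add_sub_cancel_right] at this
    exact this.symm
  -- Reversing time gives the opposite inequality. This needs the two-sided Lipschitz bound of N,
  -- which the full form need not satisfy; it is the reason for splitting off M.
  have bwd := energy_inequality (R ∘L I) (fun t => N (s + r - t)) (fun t => hF.symmN _)
    (fun t => hF.nonnegN _) hsr (v := fun t => v (s + r - t)) (a := fun _ => 0)
    (w := fun t => -w (s + r - t)) (k := fun t => k (s + r - t)) (q := fun x => K * ‖x‖ ^ 2)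
    (MemLp.zero (μ := volume) (p := 2)) (hw.comp_measurePreserving hmp).neg
    (hkm.comp_measurePreserving hmp) (fun t => hk0 _) (fun x => by positivity)
    (fun t' t h1 h2 h3 => by
      have := hJ (s + r - t) (s + r - t') (by linarith) (by linarith) (by linarith)
      rw [intervalIntegral.integral_neg, intervalIntegral.integral_comp_sub_left (fun t => w t),
        ← this]
      abel) (by
      have := hmp.quasiMeasurePreserving.ae hres
      filter_upwards [this] with t ht hts φ
      rw [inner_zero_left, zero_add]
      exact ht ⟨by linarith [hts.2], by linarith [hts.1]⟩ φ)
    (fun t' t _ h2 _ x => by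
      have := hinc (s + r - t') (s + r - t) x
      rwa [sub_sub_sub_cancel_left, abs_of_nonpos (by linarith), neg_sub] at this) j1 j2
    (fun η hη => by
      have h1 := lsc s ⟨le_rfl, hsr⟩ η hη
      have h2 : Tendsto (fun t => s + r - t) (𝓝[<] r) (𝓝[Icc s r] s) := by
        rw [← nhdsWithin_Ico_eq_nhdsLT hlt]
        refine tendsto_nhdsWithin_iff.2 ⟨?_, ?_⟩
        · have : Tendsto (fun t => s + r - t) (𝓝 r) (𝓝 (s + r - r)) :=
            tendsto_const_nhds.sub tendsto_id
          rw [add_sub_cancel_right] at this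
          exact this.mono_left nhdsWithin_le_nhds
        · filter_upwards [self_mem_nhdsWithin] with t ht
          exact ⟨by linarith [ht.2], by linarith [ht.1]⟩
      have h3 := h2.eventually h1
      simpa using h3)
  have hsub := intervalIntegral.integral_comp_sub_left
    (fun t => 2 * (k t * ‖w t‖) + K * ‖v t‖ ^ 2) (a := s) (b := r) (s + r)
  simp only [add_sub_cancel_left, add_sub_cancel_right] at hsub
  simp only [inner_zero_left, mul_zero, zero_add, norm_neg, add_sub_cancel_left,
    add_sub_cancel_right] at fwd bwd
  rw [hsub] at bwd
  rw [abs_le]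
  constructor <;> linarith

/-- Strong continuity of the trajectory in the energy space. -/
theorem IsAbstractSolution.continuousOn_trajectory [SecondCountableTopology X]
    (hF : SplitForm (R ∘L I) N M K Λ c₀ c₁)
    (hu : IsAbstractSolution I R N M T f u₀ u z) (hT : 0 < T) (hI : Function.Injective I)
    (hw : MemLp w 2 volume)
    (hzw : ∀ s t, 0 ≤ s → s ≤ t → t ≤ T → R (z t) - R (z s) = ∫ τ in s..t, w τ)
    {C : ℝ} (hv : ∀ t ∈ Icc 0 T, I (v t) = z t ∧ ‖v t‖ ≤ C) : ContinuousOn v (Icc 0 T) := by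
  set κ : ℝ → ℝ := fun t => 2 * ((‖f t - w t‖ + Λ * ‖R (I (u t))‖) * ‖w t‖) + K * ‖v t‖ ^ 2 with hκ
  have hκi : IntervalIntegrable κ volume 0 T := by
    refine IntervalIntegrable.add ?_
      (hu.intervalIntegrable_trajectory hF hI (fun t ht => (hv t ht).1) le_rfl hT.le le_rfl).2
    have hkm : MemLp (fun t => ‖f t - w t‖ + Λ * ‖R (I (u t))‖) 2 volume :=
      (hu.memLp_rhs.sub hw).norm.add (((R ∘L I).comp_memLp' hu.memLp).norm.const_mul Λ)
    exact ((MemLp.integrable_mul (p := 2) (q := 2) hkm hw.norm).const_mul 2).intervalIntegrable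
  have hP : ContinuousOn (fun t => ∫ τ in (0 : ℝ)..t, κ τ) (Icc 0 T) := by
    have := intervalIntegral.continuousOn_primitive_interval' hκi (by simp : (0 : ℝ) ∈ uIcc 0 T)
    rwa [uIcc_of_le hT.le] at this
  have hκi' : ∀ t ∈ Icc 0 T, IntervalIntegrable κ volume 0 t := fun t ht =>
    hκi.mono_set (by rw [uIcc_of_le ht.1, uIcc_of_le hT.le]; exact Icc_subset_Icc le_rfl ht.2)
  set b : ℝ → ℝ := fun t => N t (v t) (v t) with hb
  have hbd : ∀ s ∈ Icc 0 T, ∀ t ∈ Icc 0 T,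
      |b t - b s| ≤ |(∫ τ in (0 : ℝ)..t, κ τ) - ∫ τ in (0 : ℝ)..s, κ τ| := by
    intro s hs t ht
    rcases le_total s t with hst | hst
    · rw [intervalIntegral.integral_interval_sub_left (hκi' t ht) (hκi' s hs)]
      exact (hu.abs_energy_sub_le hF hT hI hw hzw hv hs.1 hst ht.2).trans (le_abs_self _)
    · rw [abs_sub_comm (b t), abs_sub_comm (∫ τ in (0 : ℝ)..t, κ τ),
        intervalIntegral.integral_interval_sub_left (hκi' s hs) (hκi' t ht)]
      exact (hu.abs_energy_sub_le hF hT hI hw hzw hv ht.1 hst hs.2).trans (le_abs_self _)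
  intro s hs
  have hbs : Tendsto b (𝓝[Icc 0 T] s) (𝓝 (b s)) := by
    rw [tendsto_iff_dist_tendsto_zero]
    have h0 : Tendsto (fun t => |(∫ τ in (0 : ℝ)..t, κ τ) - ∫ τ in (0 : ℝ)..s, κ τ|)
        (𝓝[Icc 0 T] s) (𝓝 0) := by
      have := ((hP s hs).tendsto.sub_const (∫ τ in (0 : ℝ)..s, κ τ)).abs
      simpa using this
    refine squeeze_zero' (Eventually.of_forall fun t => dist_nonneg) ?_ h0
    filter_upwards [self_mem_nhdsWithin] with t ht
    rw [Real.dist_eq]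
    exact hbd s hs t ht
  have h1 := hF.tendsto_apply hI hu.continuousOn hv hs
  have h2 : Tendsto (fun t => N t (v s) (v s)) (𝓝[Icc 0 T] s) (𝓝 (N s (v s) (v s))) := by
    have : Continuous fun t => N t (v s) (v s) :=
      (hF.continuousN.clm_apply continuous_const).clm_apply continuous_const
    exact (this.tendsto s).mono_left nhdsWithin_le_nhds
  have h3 : Tendsto (fun t => ‖R (z t) - R (z s)‖ ^ 2) (𝓝[Icc 0 T] s) (𝓝 0) := by
    have := (((R.continuous.tendsto _).comp (hu.continuousOn s hs).tendsto).sub_const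
      (R (z s))).norm.pow 2
    simpa using this
  -- As in Hilbert spaces, weak convergence plus convergence of energies is strong convergence: N t
  -- (v t − v s, v t − v s) tends to 0, and coercivity is completed by the convergence of R z.
  have h4 : Tendsto (fun t => c₀ * ((b t - 2 * N t (v t) (v s) + N t (v s) (v s))
      + ‖R (z t) - R (z s)‖ ^ 2)) (𝓝[Icc 0 T] s) (𝓝 0) := by
    have := ((((hbs.sub (h1.const_mul 2)).add h2).add h3).const_mul c₀)
    have e : c₀ * (b s - 2 * N s (v s) (v s) + N s (v s) (v s) + 0) = 0 := by
      simp only [hb]; ring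
    rwa [e] at this
  have h5 : Tendsto (fun t => ‖v t - v s‖ ^ 2) (𝓝[Icc 0 T] s) (𝓝 0) := by
    refine squeeze_zero' (Eventually.of_forall fun t => by positivity) ?_ h4
    filter_upwards [self_mem_nhdsWithin] with t ht
    refine (hF.coercive t (v t - v s)).trans (le_of_eq ?_)
    rw [map_sub (R ∘L I), ContinuousLinearMap.comp_apply, ContinuousLinearMap.comp_apply,
      (hv t ht).1, (hv s hs).1]
    simp only [map_sub, sub_apply, hb]
    rw [hF.symmN t (v s) (v t)]
    ring
  rw [ContinuousWithinAt, tendsto_iff_norm_sub_tendsto_zero]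
  have := h5.sqrt
  simpa using this

/-- The energy estimate. -/
theorem IsAbstractSolution.energy_le [SecondCountableTopology X]
    (hF : SplitForm (R ∘L I) N M K Λ c₀ c₁)
    (hu : IsAbstractSolution I R N M T f u₀ u z) (hT : 0 < T) (hI : Function.Injective I)
    (hw : MemLp w 2 volume)
    (hzw : ∀ s t, 0 ≤ s → s ≤ t → t ≤ T → R (z t) - R (z s) = ∫ τ in s..t, w τ)
    (hv : ∀ t ∈ Icc 0 T, I (v t) = z t) (hvc : ContinuousOn v (Icc 0 T)) {q : X → ℝ}
    (hq : Continuous q) (hq0 : ∀ x, 0 ≤ q x)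
    (hinc : ∀ t' t, t' ≤ t → ∀ x, (N t x x + M t x x) - (N t' x x + M t' x x) ≤ (t - t') * q x)
    {r : ℝ} (hr0 : 0 ≤ r) (hr : r ≤ T) :
    N r (v r) (v r) + M r (v r) (v r) ≤ N 0 u₀ u₀ + M 0 u₀ u₀
      + ∫ t in (0 : ℝ)..r, (2 * inner ℝ (f t - w t) (w t) + q (v t)) := by
  have hv0 : v 0 = u₀ := hI ((hv 0 ⟨le_rfl, hT.le⟩).trans hu.initial)
  -- M is continuous in t only for fixed arguments. Its bound by the norms after R ∘ I handles the
  -- moving argument.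
  have hbc : ContinuousOn (fun t => (N t + M t) (v t) (v t)) (Icc 0 T) := by
    intro s hs
    have hvs := (hvc s hs).tendsto
    have h1 : Tendsto (fun t => N t (v t) (v t)) (𝓝[Icc 0 T] s) (𝓝 (N s (v s) (v s))) := by
      exact ((hF.continuousN.continuousWithinAt.clm_apply (hvc s hs)).clm_apply (hvc s hs)).tendsto
    have hJ : Tendsto (fun t => (R ∘L I) (v t - v s)) (𝓝[Icc 0 T] s) (𝓝 0) := by
      have := ((R ∘L I).continuous.tendsto _).comp (hvs.sub_const (v s))
      simpa [Function.comp_def] using this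
    have h2 : Tendsto (fun t => M t (v s) (v s)) (𝓝[Icc 0 T] s) (𝓝 (M s (v s) (v s))) :=
      ((hF.continuousM _ _).tendsto s).mono_left nhdsWithin_le_nhds
    have h3 : Tendsto (fun t => M t (v t - v s) (v t - v s)) (𝓝[Icc 0 T] s) (𝓝 0) := by
      refine squeeze_zero_norm (fun t => hF.boundM t _ _) ?_
      have := (hJ.norm.const_mul Λ).mul hJ.norm
      simpa using this
    have h4 : Tendsto (fun t => M t (v t - v s) (v s)) (𝓝[Icc 0 T] s) (𝓝 0) := by
      refine squeeze_zero_norm (fun t => hF.boundM t _ _) ?_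
      have := (hJ.norm.const_mul Λ).mul_const ‖(R ∘L I) (v s)‖
      simpa using this
    have h5 := h1.add ((h2.add h3).add (h4.const_mul 2))
    simp only [add_zero, mul_zero] at h5
    refine h5.congr fun t => ?_
    simp only [map_sub, sub_apply, add_apply]
    rw [hF.symmM t (v s) (v t)]
    ring
  have hsub : Icc 0 r ⊆ Icc 0 T := Icc_subset_Icc le_rfl hr
  rcases hr0.eq_or_lt with rfl | hlt
  · simp [hv0]
  have key := energy_inequality (R ∘L I) (fun t => N t + M t)
    (fun t x y => by simp only [add_apply]; rw [hF.symmN, hF.symmM])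
    (fun t x => by simpa using add_nonneg (hF.nonnegN t x) (hF.nonnegM t x)) hr0
    (v := v) (a := fun t => f t - w t) (w := w) (k := fun _ => 0) (q := q)
    (hu.memLp_rhs.sub hw) hw (MemLp.zero (μ := volume) (p := 2)) (fun _ => le_rfl) hq0
    (fun t' t h1 h2 h3 => by
      rw [ContinuousLinearMap.comp_apply, ContinuousLinearMap.comp_apply,
        hv t ⟨by linarith, by linarith⟩, hv t' ⟨by linarith, by linarith⟩]
      exact hzw _ _ (by linarith) h2 (by linarith))
    (by
      filter_upwards [hu.ae_equation hT hw hzw, hu.ae_trajectory_eq hI hv] with t ht1 ht2 hts φ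
      have hts' : t ∈ Ioo 0 T := ⟨hts.1, hts.2.trans_le hr⟩
      rw [ht2 hts', zero_mul, add_zero]
      exact (ht1 hts' φ).le)
    (fun t' t _ h2 _ x => by simpa using hinc t' t h2 x)
    ((hbc.mono hsub).intervalIntegrable_of_Icc hr0)
    (((hq.comp_continuousOn hvc).mono hsub).intervalIntegrable_of_Icc hr0)
    (fun η hη => by
      have h1 : Tendsto (fun t => (N t + M t) (v t) (v t)) (𝓝[<] r)
          (𝓝 ((N r + M r) (v r) (v r))) := by
        refine (hbc r ⟨hr0, hr⟩).tendsto.mono_left ?_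
        rw [← nhdsWithin_Ico_eq_nhdsLT hlt]
        exact nhdsWithin_mono _ (Ico_subset_Icc_self.trans hsub)
      exact (h1.eventually_const_lt (by linarith : (N r + M r) (v r) (v r) - η < _)).mono
        fun t ht => ht.le)
  simpa [hv0] using key

end AbstractRegularity

/-! ### Geometry of the interaction domain -/

section Geometry

variable {n : ℕ} {Ω : Set (Space n)} {ε : ℝ≥0∞}

/-- Since Ω is open, the point x can be moved slightly towards y inside Ω, which makes the distance
strictly smaller. Hence Ω̃ is the open ε-neighbourhood of Ω. -/
lemma mem_totalDomain_iff (hΩ : IsOpen Ω) (hε : 0 < ε) (y : Space n) :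
    y ∈ totalDomain ε Ω ↔ ∃ x ∈ Ω, edist y x < ε := by
  constructor
  · rintro (hy | ⟨-, x, hx, hxy⟩)
    · exact ⟨y, hy, by simpa using hε⟩
    · by_cases hyx : y = x
      · exact ⟨x, hx, by simpa [hyx] using hε⟩
      have hcont : Tendsto (fun s : ℝ => x + s • (y - x)) (𝓝 0) (𝓝 (x + (0 : ℝ) • (y - x))) :=
        Continuous.tendsto (by fun_prop) 0
      rw [zero_smul, add_zero] at hcont
      have h1 : ∀ᶠ s : ℝ in 𝓝[>] 0, x + s • (y - x) ∈ Ω :=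
        (hcont.eventually (hΩ.mem_nhds hx)).filter_mono nhdsWithin_le_nhds
      have h2 : ∀ᶠ s : ℝ in 𝓝[>] 0, s ∈ Ioo (0 : ℝ) 1 := Ioo_mem_nhdsGT one_pos
      obtain ⟨s, hs1, hs2⟩ := (h1.and h2).exists
      refine ⟨_, hs1, lt_of_lt_of_le ?_ hxy⟩
      rw [edist_dist, edist_dist]
      have hpos : 0 < dist y x := dist_pos.2 hyx
      refine (ENNReal.ofReal_lt_ofReal_iff hpos).2 ?_
      have : y - (x + s • (y - x)) = (1 - s) • (y - x) := by module
      rw [dist_eq_norm, this, norm_smul, Real.norm_of_nonneg (by linarith [hs2.2]), ← dist_eq_norm]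
      nlinarith [hs2.1]
  · rintro ⟨x, hx, hxy⟩
    by_cases hy : y ∈ Ω
    · exact Or.inl hy
    · exact Or.inr ⟨hy, x, hx, hxy.le⟩

lemma isOpen_totalDomain (hΩ : IsOpen Ω) (hε : 0 < ε) : IsOpen (totalDomain ε Ω) := by
  have : totalDomain ε Ω = ⋃ x ∈ Ω, {y | edist y x < ε} := by
    ext y
    simp [mem_totalDomain_iff hΩ hε]
  rw [this]
  exact isOpen_biUnion fun x _ => isOpen_lt (by fun_prop) continuous_const

lemma isBounded_totalDomain (hΩ : IsOpen Ω) (hΩb : Bornology.IsBounded Ω) (hε : 0 < ε)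
    (hε' : ε ≠ ⊤) : Bornology.IsBounded (totalDomain ε Ω) := by
  obtain ⟨r, hr⟩ := hΩb.subset_closedBall 0
  refine (Metric.isBounded_closedBall (x := (0 : Space n)) (r := r + ε.toReal)).subset fun y hy => ?_
  obtain ⟨x, hx, hxy⟩ := (mem_totalDomain_iff hΩ hε y).1 hy
  have h1 := hr hx
  rw [Metric.mem_closedBall] at h1 ⊢
  rw [edist_dist, ENNReal.ofReal_lt_iff_lt_toReal dist_nonneg hε'] at hxy
  linarith [dist_triangle y x 0]

/-- A finite r/2-net of the totally bounded set Ω reduces the uniform lower bound to a minimum of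
finitely many positive volumes. -/
lemma exists_pos_le_volume_inter_ball (hΩ : IsOpen Ω) (hΩb : Bornology.IsBounded Ω) {r : ℝ}
    (hr : 0 < r) : ∃ m : ℝ≥0∞, m ≠ 0 ∧ m ≠ ⊤ ∧ ∀ x ∈ Ω, m ≤ volume (Ω ∩ Metric.ball x r) := by
  have hΩt : TotallyBounded Ω := (hΩb.isCompact_closure.totallyBounded).subset subset_closure
  obtain ⟨s, hsΩ, hsf, hcov⟩ := totallyBounded_iff_subset.1 hΩt _
    (Metric.dist_mem_uniformity (half_pos hr))
  refine ⟨min 1 (⨅ y ∈ s, volume (Ω ∩ Metric.ball y (r / 2))), ?_, ?_, ?_⟩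
  · rw [← pos_iff_ne_zero, lt_min_iff]
    refine ⟨one_pos, ?_⟩
    rcases s.eq_empty_or_nonempty with rfl | hne
    · simp
    obtain ⟨y, hy, hmin⟩ := hsf.exists_minimalFor
      (fun y => volume (Ω ∩ Metric.ball y (r / 2))) s hne
    have hle : volume (Ω ∩ Metric.ball y (r / 2)) ≤ ⨅ y ∈ s, volume (Ω ∩ Metric.ball y (r / 2)) := by
      refine le_iInf₂ fun y' hy' => ?_
      rcases le_total (volume (Ω ∩ Metric.ball y (r / 2)))
        (volume (Ω ∩ Metric.ball y' (r / 2))) with h | h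
      · exact h
      · exact hmin hy' h
    refine lt_of_lt_of_le ?_ hle
    exact (hΩ.inter Metric.isOpen_ball).measure_pos volume
      ⟨y, hsΩ hy, Metric.mem_ball_self (half_pos hr)⟩
  · exact ne_top_of_le_ne_top ENNReal.one_ne_top (min_le_left _ _)
  · intro x hx
    obtain ⟨y, hy, hxy⟩ := mem_iUnion₂.1 (hcov hx)
    refine (min_le_right _ _).trans ((iInf₂_le y hy).trans (measure_mono ?_))
    refine inter_subset_inter_right _ (Metric.ball_subset_ball' ?_)
    have : dist x y < r / 2 := hxy
    rw [dist_comm]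
    linarith

/-- Squares integrate on `S₂` against squares on `S₁` and a difference energy. -/
lemma lintegral_sq_le_of_le_volume {D S₁ S₂ : Set (Space n)} (hS₁ : MeasurableSet S₁)
    (hS₁D : S₁ ⊆ D) (hS₂D : S₂ ⊆ D) {r : ℝ} {m : ℝ≥0∞} {u : Space n → ℝ}
    (hu : AEMeasurable u (volume.restrict D))
    (hm : ∀ y ∈ S₂, m ≤ volume (S₁ ∩ {x | dist y x ≤ r})) (hS₂ : MeasurableSet S₂) :
    m * ∫⁻ y in S₂, ENNReal.ofReal (u y ^ 2) ≤
      2 * (∫⁻ x in D, ∫⁻ y in D,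
          {p : Space n × Space n | dist p.2 p.1 ≤ r}.indicator
            (fun p => ENNReal.ofReal ((u p.2 - u p.1) ^ 2)) (x, y))
        + 2 * volume S₂ * ∫⁻ x in S₁, ENNReal.ofReal (u x ^ 2) := by
  set Z : Set (Space n × Space n) := {p | dist p.2 p.1 ≤ r} with hZ
  have hZm : MeasurableSet Z := measurableSet_le (by fun_prop) measurable_const
  have hu1 : AEMeasurable u (volume.restrict S₁) := hu.mono_measure (Measure.restrict_mono hS₁D le_rfl)
  have hu2 : AEMeasurable u (volume.restrict S₂) := hu.mono_measure (Measure.restrict_mono hS₂D le_rfl)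
  set A : Space n → Space n → ℝ≥0∞ := fun y x =>
    Z.indicator (fun p => ENNReal.ofReal ((u p.2 - u p.1) ^ 2)) (y, x) with hA
  have hAm : ∀ S S' : Set (Space n), S ⊆ D → S' ⊆ D → AEMeasurable (Function.uncurry A)
      ((volume.restrict S).prod (volume.restrict S')) := by
    intro S S' hS hS'
    have a1 : AEMeasurable u (volume.restrict S) := hu.mono_measure (Measure.restrict_mono hS le_rfl)
    have a2 : AEMeasurable u (volume.restrict S') := hu.mono_measure (Measure.restrict_mono hS' le_rfl)
    exact (((a2.comp_snd.sub a1.comp_fst).pow_const 2).ennreal_ofReal).indicator hZm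
  calc m * ∫⁻ y in S₂, ENNReal.ofReal (u y ^ 2)
      ≤ ∫⁻ y in S₂, m * ENNReal.ofReal (u y ^ 2) := lintegral_const_mul_le _ _
    _ ≤ ∫⁻ y in S₂, ∫⁻ x in S₁, (2 * A y x + 2 * ENNReal.ofReal (u x ^ 2)) := by
        refine setLIntegral_mono' hS₂ fun y hy => ?_
        calc m * ENNReal.ofReal (u y ^ 2)
            ≤ volume (S₁ ∩ {x | dist y x ≤ r}) * ENNReal.ofReal (u y ^ 2) := by
              gcongr; exact hm y hy
          _ = ∫⁻ x in S₁ ∩ {x | dist y x ≤ r}, ENNReal.ofReal (u y ^ 2) := by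
              rw [setLIntegral_const, mul_comm]
          _ ≤ ∫⁻ x in S₁ ∩ {x | dist y x ≤ r}, (2 * A y x + 2 * ENNReal.ofReal (u x ^ 2)) := by
              refine setLIntegral_mono' (hS₁.inter
                (measurableSet_le (by fun_prop) measurable_const)) fun x hx => ?_
              have hmem : (y, x) ∈ Z := by
                have := hx.2
                simp only [mem_ofPred_eq] at this
                simp only [hZ, mem_ofPred_eq, dist_comm x y]
                exact this
              simp only [hA, indicator_of_mem hmem]
              rw [← ENNReal.ofReal_ofNat 2, ← ENNReal.ofReal_mul (by norm_num),
                ← ENNReal.ofReal_mul (by norm_num), ← ENNReal.ofReal_add (by positivity)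
                (by positivity)]
              refine ENNReal.ofReal_le_ofReal ?_
              nlinarith [sq_nonneg (u y - 2 * u x)]
          _ ≤ _ := lintegral_mono_set inter_subset_left
    _ = 2 * (∫⁻ y in S₂, ∫⁻ x in S₁, A y x)
        + 2 * volume S₂ * ∫⁻ x in S₁, ENNReal.ofReal (u x ^ 2) := by
        have hi : AEMeasurable (fun y => ∫⁻ x in S₁, A y x) (volume.restrict S₂) :=
          (hAm S₂ S₁ hS₂D hS₁D).lintegral_prod_right'
        have e : ∀ y, ∫⁻ x in S₁, (2 * A y x + 2 * ENNReal.ofReal (u x ^ 2))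
            = (∫⁻ x in S₁, 2 * A y x) + 2 * ∫⁻ x in S₁, ENNReal.ofReal (u x ^ 2) := fun y => by
          rw [lintegral_add_right' _ (((hu1.pow_const 2).ennreal_ofReal).const_mul 2),
            lintegral_const_mul' 2 (fun x => ENNReal.ofReal (u x ^ 2)) (by simp)]
        simp_rw [e]
        rw [lintegral_add_right' _ aemeasurable_const, setLIntegral_const]
        have e2 : ∀ y, ∫⁻ x in S₁, 2 * A y x = 2 * ∫⁻ x in S₁, A y x := fun y =>
          lintegral_const_mul' _ _ (by simp)
        simp_rw [e2]
        rw [lintegral_const_mul' _ _ (by simp)]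
        ring
    _ ≤ _ := by
        gcongr

/-- On a bounded total domain the `L²(Ω̃)` norm is controlled by the `L²(Ω)` norm and the
differences at distance at most the horizon. -/
lemma exists_lintegral_sq_totalDomain_le (hΩ : IsOpen Ω) (hΩb : Bornology.IsBounded Ω)
    (hε : 0 < ε) (hε' : ε ≠ ⊤) :
    ∃ C : ℝ≥0∞, C ≠ ⊤ ∧ ∀ u : Space n → ℝ, AEMeasurable u (volume.restrict (totalDomain ε Ω)) →
      ∫⁻ y in totalDomain ε Ω, ENNReal.ofReal (u y ^ 2) ≤ C *
        ((∫⁻ x in totalDomain ε Ω, ∫⁻ y in totalDomain ε Ω,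
          {p : Space n × Space n | dist p.2 p.1 ≤ ε.toReal}.indicator
            (fun p => ENNReal.ofReal ((u p.2 - u p.1) ^ 2)) (x, y))
          + ∫⁻ x in Ω, ENNReal.ofReal (u x ^ 2)) := by
  set r := ε.toReal with hr
  have hr0 : 0 < r := ENNReal.toReal_pos hε.ne' hε'
  set D := totalDomain ε Ω with hD
  have hDo : IsOpen D := isOpen_totalDomain hΩ hε
  have hDb : volume D ≠ ⊤ := (isBounded_totalDomain hΩ hΩb hε hε').measure_lt_top.ne
  obtain ⟨m, hm0, hmt, hm⟩ := exists_pos_le_volume_inter_ball hΩ hΩb (by positivity : 0 < r / 4)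
  -- A point near the outer edge of Ω̃ may see only a tiny part of Ω, so the control passes through
  -- this intermediate set. Points of D₁ see all of Ω within r/4 of some x ∈ Ω, as 3r/4 + r/4 = r. A
  -- point y of Ω̃ sees the ball of radius r/4 about its midpoint with some x ∈ Ω, which lies in D₁
  -- because r/2 + r/4 = 3r/4.
  set D₁ : Set (Space n) := ⋃ x ∈ Ω, Metric.ball x (3 * r / 4) with hD₁
  have hD₁o : IsOpen D₁ := isOpen_biUnion fun x _ => Metric.isOpen_ball
  have hΩD : Ω ⊆ D := subset_union_left
  have hD₁D : D₁ ⊆ D := by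
    intro z hz
    obtain ⟨x, hx, hzx⟩ := mem_iUnion₂.1 hz
    refine (mem_totalDomain_iff hΩ hε z).2 ⟨x, hx, ?_⟩
    rw [edist_dist, ENNReal.ofReal_lt_iff_lt_toReal dist_nonneg hε', ← hr]
    rw [Metric.mem_ball] at hzx
    linarith
  set b : ℝ≥0∞ := volume (Metric.ball (0 : Space n) (r / 4)) with hb
  have hb0 : b ≠ 0 := (Metric.measure_ball_pos volume _ (by positivity)).ne'
  have hbt : b ≠ ⊤ := measure_ball_lt_top.ne
  refine ⟨b⁻¹ * (2 + 2 * volume D * (m⁻¹ * (2 + 2 * volume D))), ?_, fun u hu => ?_⟩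
  · have := ENNReal.inv_ne_top.2 hb0
    have := ENNReal.inv_ne_top.2 hm0
    finiteness
  set A := ∫⁻ x in D, ∫⁻ y in D, {p : Space n × Space n | dist p.2 p.1 ≤ r}.indicator
            (fun p => ENNReal.ofReal ((u p.2 - u p.1) ^ 2)) (x, y) with hA
  set U := ∫⁻ x in Ω, ENNReal.ofReal (u x ^ 2) with hU
  have s1 := lintegral_sq_le_of_le_volume (S₁ := Ω) (S₂ := D₁) (D := D) (r := r) (m := m)
    hΩ.measurableSet hΩD hD₁D hu (fun z hz => by
      obtain ⟨x, hx, hzx⟩ := mem_iUnion₂.1 hz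
      refine (hm x hx).trans (measure_mono (inter_subset_inter_right _ fun x' hx' => ?_))
      rw [Metric.mem_ball] at hzx hx'
      simp only [mem_ofPred_eq]
      have := dist_triangle z x x'
      rw [dist_comm x x'] at this
      linarith) hD₁o.measurableSet
  have s2 := lintegral_sq_le_of_le_volume (S₁ := D₁) (S₂ := D) (D := D) (r := r) (m := b)
    hD₁o.measurableSet hD₁D subset_rfl hu (fun y hy => by
      obtain ⟨x, hx, hyx⟩ := (mem_totalDomain_iff hΩ hε y).1 hy
      rw [edist_dist, ENNReal.ofReal_lt_iff_lt_toReal dist_nonneg hε', ← hr] at hyx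
      have e1 : dist (midpoint ℝ y x) x ≤ r / 2 := by
        rw [dist_midpoint_right, Real.norm_of_nonneg (by norm_num)]; linarith
      have e2 : dist (midpoint ℝ y x) y ≤ r / 2 := by
        rw [dist_midpoint_left, Real.norm_of_nonneg (by norm_num)]; linarith
      have e3 : b = volume (Metric.ball (midpoint ℝ y x) (r / 4)) := by
        exact (Measure.addHaar_ball_center volume _ _).symm
      rw [e3]
      refine measure_mono fun w hw => ⟨?_, ?_⟩
      · rw [Metric.mem_ball] at hw
        refine mem_iUnion₂.2 ⟨x, hx, ?_⟩
        rw [Metric.mem_ball]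
        linarith [dist_triangle w (midpoint ℝ y x) x]
      · rw [Metric.mem_ball] at hw
        simp only [mem_ofPred_eq]
        rw [dist_comm]
        linarith [dist_triangle w (midpoint ℝ y x) y]) hDo.measurableSet
  have cancel : ∀ k : ℝ≥0∞, k ≠ 0 → k ≠ ⊤ → ∀ x y, k * x ≤ y → x ≤ k⁻¹ * y := by
    intro k hk0 hkt x y h
    calc x = k⁻¹ * (k * x) := by rw [← mul_assoc, ENNReal.inv_mul_cancel hk0 hkt, one_mul]
      _ ≤ k⁻¹ * y := by gcongr
  have t1 := cancel m hm0 hmt _ _ s1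
  have t2 := cancel b hb0 hbt _ _ s2
  have hvol : volume D₁ ≤ volume D := measure_mono hD₁D
  have t3 : ∫⁻ y in D₁, ENNReal.ofReal (u y ^ 2) ≤ m⁻¹ * (2 + 2 * volume D) * (A + U) := by
    refine t1.trans ?_
    rw [mul_assoc (m⁻¹)]
    refine mul_le_mul' le_rfl ?_
    calc 2 * A + 2 * volume D₁ * U ≤ 2 * (A + U) + 2 * volume D * (A + U) := by
          gcongr
          · exact le_self_add
          · exact le_add_self
      _ = _ := by ring
  refine t2.trans ?_
  rw [mul_assoc (b⁻¹)]
  refine mul_le_mul' le_rfl ?_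
  calc 2 * A + 2 * volume D * ∫⁻ x in D₁, ENNReal.ofReal (u x ^ 2)
      ≤ 2 * (A + U) + 2 * volume D * (m⁻¹ * (2 + 2 * volume D) * (A + U)) := by
        gcongr
        exact le_self_add
    _ = _ := by ring

end Geometry

/-! ### Tails of the singular kernel -/

section Tail

variable {n : ℕ}

/-- Beyond distance δ the numbers r and 1 + r are comparable. The constant is uniform over exponents
s up to n + 2, hence over all orders up to 1. Later σ = n + 2b gives an integrable majorant, and σ =
0 a constant one. -/
lemma inv_rpow_le_tail {δ s σ r : ℝ} (hδ : 0 < δ) (hs : s ≤ (n : ℝ) + 2) (hσ : σ ≤ s)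
    (hσ0 : 0 ≤ σ) (hr : δ < r) :
    (r ^ s)⁻¹ ≤ ((1 + δ) / δ) ^ ((n : ℝ) + 2) * (1 + r) ^ (-σ) := by
  have hr0 : 0 < r := hδ.trans hr
  have h1 : 1 ≤ (1 + δ) / δ := by rw [le_div_iff₀ hδ]; linarith
  have h2 : 1 + r ≤ (1 + δ) / δ * r := by
    rw [div_mul_eq_mul_div, le_div_iff₀ hδ]; nlinarith
  have h3 : (1 + r) ^ s ≤ ((1 + δ) / δ) ^ s * r ^ s := by
    rw [← Real.mul_rpow (by positivity) hr0.le]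
    exact Real.rpow_le_rpow (by positivity) h2 (hσ0.trans hσ)
  have h4 : ((1 + δ) / δ) ^ s ≤ ((1 + δ) / δ) ^ ((n : ℝ) + 2) := Real.rpow_le_rpow_of_exponent_le h1 hs
  have h5 : (1 + r) ^ σ ≤ (1 + r) ^ s := Real.rpow_le_rpow_of_exponent_le (by linarith) hσ
  have p1 : 0 < r ^ s := Real.rpow_pos_of_pos hr0 _
  have p2 : 0 < (1 + r) ^ σ := Real.rpow_pos_of_pos (by linarith) _
  rw [Real.rpow_neg (by linarith), ← div_eq_mul_inv, inv_eq_one_div, div_le_div_iff₀ p1 p2, one_mul]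
  calc (1 + r) ^ σ ≤ ((1 + δ) / δ) ^ s * r ^ s := h5.trans h3
    _ ≤ _ := by gcongr

lemma lintegral_tail_lt_top {σ : ℝ} (hσ : (n : ℝ) < σ) :
    ∫⁻ x : Space n, ENNReal.ofReal ((1 + ‖x‖) ^ (-σ)) < ⊤ := by
  refine finite_integral_one_add_norm ?_
  simpa using hσ

lemma lintegral_tail_translate (σ : ℝ) (y : Space n) (S : Set (Space n)) :
    ∫⁻ x in S, ENNReal.ofReal ((1 + dist y x) ^ (-σ))
      ≤ ∫⁻ x : Space n, ENNReal.ofReal ((1 + ‖x‖) ^ (-σ)) := by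
  refine (setLIntegral_le_lintegral _ _).trans (le_of_eq ?_)
  simp_rw [dist_eq_norm]
  exact lintegral_sub_left_eq_self (fun x : Space n => ENNReal.ofReal ((1 + ‖x‖) ^ (-σ))) y

end Tail

/-! ### Measurability of functions with values in `L²` -/

section LpMeasurability

variable {Z : Type*} [MeasurableSpace Z]

instance fact_two_ne_top : Fact ((2 : ℝ≥0∞) ≠ ⊤) := ⟨by norm_num⟩

/-- A jointly measurable function defines a measurable function with values in `L²`. -/
lemma aestronglyMeasurable_of_uncurry [MeasurableSpace.CountablyGenerated Z] {ν : Measure ℝ}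
    [SFinite ν] {μ : Measure Z} [SFinite μ] {F : ℝ → Z → ℝ}
    (hF : AEStronglyMeasurable (Function.uncurry F) (ν.prod μ)) {G : ℝ → Lp ℝ 2 μ}
    (hG : ∀ᵐ t ∂ν, G t =ᵐ[μ] F t) : AEStronglyMeasurable G ν := by
  let _ : MeasurableSpace (Lp ℝ 2 μ) := borel _
  have : BorelSpace (Lp ℝ 2 μ) := ⟨rfl⟩
  set e : ℕ → Lp ℝ 2 μ := TopologicalSpace.denseSeq _ with he
  -- Distances to a dense sequence determine a point. The resulting continuous injection of a Polish
  -- space is a measurable embedding, so measurability can be tested on each distance, where Tonelli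
  -- applies.
  let Φ : Lp ℝ 2 μ → ℕ → ℝ≥0∞ := fun x k => edist x (e k)
  have hΦc : Continuous Φ := by fun_prop
  have hΦi : Function.Injective Φ := by
    intro x y hxy
    have h1 : ∀ z, edist x z = edist y z := by
      have hf : Continuous fun z : Lp ℝ 2 μ => edist x z := by fun_prop
      have hg : Continuous fun z : Lp ℝ 2 μ => edist y z := by fun_prop
      have := DenseRange.equalizer (TopologicalSpace.denseRange_denseSeq (Lp ℝ 2 μ)) hf hg
        (funext fun k => congrFun hxy k)
      exact fun z => congrFun this z
    have h2 := h1 x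
    rw [edist_self] at h2
    exact (edist_eq_zero.1 h2.symm).symm
  have hΦ : MeasurableEmbedding Φ := hΦc.measurableEmbedding hΦi
  have key : AEMeasurable (Φ ∘ G) ν := by
    rw [aemeasurable_pi_iff]
    intro k
    obtain ⟨F', hF'm, hFF'⟩ := hF
    have h1 : ∀ᵐ t ∂ν, F t =ᵐ[μ] fun z => F' (t, z) := Measure.ae_ae_of_ae_prod hFF'
    have h2 : Measurable fun t => eLpNorm (fun z => F' (t, z) - e k z) 2 μ := by
      simp_rw [eLpNorm_eq_lintegral_rpow_enorm_toReal (by norm_num : (2 : ℝ≥0∞) ≠ 0)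
        (by norm_num : (2 : ℝ≥0∞) ≠ ⊤)]
      refine Measurable.pow_const ?_ _
      refine Measurable.lintegral_prod_right' (f := fun p : ℝ × Z =>
        ‖F' p - e k p.2‖ₑ ^ (2 : ℝ≥0∞).toReal) ?_
      refine Measurable.pow_const (Measurable.enorm ?_) _
      exact hF'm.measurable.sub ((Lp.stronglyMeasurable (e k)).measurable.comp measurable_snd)
    refine ⟨_, h2, ?_⟩
    filter_upwards [hG, h1] with t ht1 ht2
    simp only [Φ, Function.comp]
    rw [Lp.edist_def]
    refine eLpNorm_congr_ae ?_
    filter_upwards [ht1, ht2] with z hz1 hz2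
    simp only [Pi.sub_apply, hz1, hz2]
  exact (hΦ.aemeasurable_comp_iff.1 key).aestronglyMeasurable

lemma lintegral_ofReal_sq_eq {μ : Measure Z} (u : Z → ℝ) :
    eLpNorm u 2 μ ^ 2 = ∫⁻ z, ENNReal.ofReal (u z ^ 2) ∂μ := by
  have h := eLpNorm_nnreal_pow_eq_lintegral (μ := μ) (f := u) (p := 2) (by norm_num)
  simp only [NNReal.coe_ofNat, ENNReal.coe_ofNat] at h
  rw [← ENNReal.rpow_natCast]
  refine h.trans (lintegral_congr fun z => ?_)
  rw [← ofReal_norm, ENNReal.ofReal_rpow_of_nonneg (norm_nonneg _) (by norm_num)]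
  congr 1
  rw [Real.norm_eq_abs]
  norm_num

lemma ofReal_norm_Lp {μ : Measure Z} (f : Lp ℝ 2 μ) : ENNReal.ofReal ‖f‖ = eLpNorm f 2 μ := by
  rw [Lp.norm_def, ENNReal.ofReal_toReal (Lp.eLpNorm_ne_top _)]

end LpMeasurability

/-! ### The jump measure and the energy space -/

section EnergySpace

variable {n : ℕ}

/-- The kernel `|y - x| ^ (-n - 2β(x))`, with `β` cut off outside `S`. -/
def jumpKernel (β : Space n → ℝ) (S : Set (Space n)) (p : Space n × Space n) : ℝ :=
  (dist p.2 p.1 ^ ((n : ℝ) + 2 * S.indicator β p.1))⁻¹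

/-- The measure `|y - x| ^ (-n - 2β(x)) dy dx` on `S × S`. -/
def jumpMeasure (β : Space n → ℝ) (S : Set (Space n)) : Measure (Space n × Space n) :=
  ((volume.restrict S).prod (volume.restrict S)).withDensity
    fun p => ENNReal.ofReal (jumpKernel β S p)

instance (β : Space n → ℝ) (S : Set (Space n)) : SigmaFinite (jumpMeasure β S) := by
  unfold jumpMeasure; infer_instance

/-- The difference `u(y) - u(x)`. -/
def increment (u : Space n → ℝ) (p : Space n × Space n) : ℝ := u p.2 - u p.1

variable {β : Space n → ℝ} {S : Set (Space n)}

lemma jumpKernel_nonneg (p : Space n × Space n) : 0 ≤ jumpKernel β S p :=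
  inv_nonneg.2 (Real.rpow_nonneg dist_nonneg _)

lemma measurable_indicator_of_continuousOn (hS : MeasurableSet S) (hβ : ContinuousOn β S) :
    Measurable (S.indicator β) := by
  classical
  rw [← piecewise_eq_indicator]
  exact hβ.measurable_piecewise continuousOn_const hS

lemma measurable_jumpKernel (hS : MeasurableSet S) (hβ : ContinuousOn β S) :
    Measurable (jumpKernel β S) := by
  have := measurable_indicator_of_continuousOn hS hβ
  unfold jumpKernel
  exact (Measurable.pow (by fun_prop) (measurable_const.add
    ((this.comp measurable_fst).const_mul 2))).inv

lemma jumpMeasure_absolutelyContinuous :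
    jumpMeasure β S ≪ (volume.restrict S).prod (volume.restrict S) :=
  withDensity_absolutelyContinuous _ _

lemma increment_congr {u v : Space n → ℝ} (h : u =ᵐ[volume.restrict S] v) :
    increment u =ᵐ[jumpMeasure β S] increment v := by
  refine jumpMeasure_absolutelyContinuous.ae_le ?_
  have h1 := (Measure.quasiMeasurePreserving_fst (μ := volume.restrict S)
    (ν := volume.restrict S)).ae h
  have h2 := (Measure.quasiMeasurePreserving_snd (μ := volume.restrict S)
    (ν := volume.restrict S)).ae h
  filter_upwards [h1, h2] with p hp1 hp2
  simp only [increment, hp1, hp2]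

lemma aestronglyMeasurable_increment {u : Space n → ℝ}
    (hu : AEStronglyMeasurable u (volume.restrict S)) :
    AEStronglyMeasurable (increment u) (jumpMeasure β S) :=
  (hu.comp_snd.sub hu.comp_fst).mono_ac jumpMeasure_absolutelyContinuous

lemma ae_mem_prod (hS : MeasurableSet S) :
    ∀ᵐ p ∂((volume.restrict S).prod (volume.restrict S)), p.1 ∈ S ∧ p.2 ∈ S := by
  rw [Measure.prod_restrict, ae_restrict_iff' (hS.prod hS)]
  exact ae_of_all _ fun p hp => hp

lemma lintegral_jumpMeasure (hS : MeasurableSet S) (hβ : ContinuousOn β S)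
    {g : Space n × Space n → ℝ≥0∞}
    (hg : AEMeasurable g ((volume.restrict S).prod (volume.restrict S))) :
    ∫⁻ p, g p ∂jumpMeasure β S
      = ∫⁻ x in S, ∫⁻ y in S, g (x, y) * ENNReal.ofReal (dist y x ^ ((n : ℝ) + 2 * β x))⁻¹ := by
  have hk := (measurable_jumpKernel hS hβ).ennreal_ofReal
  rw [jumpMeasure, lintegral_withDensity_eq_lintegral_mul₀ hk.aemeasurable hg,
    lintegral_prod _ (hk.aemeasurable.mul hg)]
  refine setLIntegral_congr_fun hS fun x hx => lintegral_congr fun y => ?_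
  simp only [Pi.mul_apply, jumpKernel, indicator_of_mem hx]
  rw [mul_comm]

lemma eLpNorm_increment_sq (hS : MeasurableSet S) (hβ : ContinuousOn β S) {u : Space n → ℝ}
    (hu : AEStronglyMeasurable u (volume.restrict S)) :
    eLpNorm (increment u) 2 (jumpMeasure β S) ^ 2 = seminormSq β S u := by
  rw [lintegral_ofReal_sq_eq, lintegral_jumpMeasure hS hβ, seminormSq]
  · refine lintegral_congr fun x => lintegral_congr fun y => ?_
    rw [← ENNReal.ofReal_mul (sq_nonneg _), div_eq_mul_inv]
    rfl
  · exact ((hu.aemeasurable.comp_snd.sub hu.aemeasurable.comp_fst).pow_const 2).ennreal_ofReal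

lemma sobolevNorm_eq (hS : MeasurableSet S) (hβ : ContinuousOn β S) {u : Space n → ℝ}
    (hu : AEStronglyMeasurable u (volume.restrict S)) :
    sobolevNorm β S u = eLpNorm u 2 (volume.restrict S)
      + eLpNorm (increment u) 2 (jumpMeasure β S) := by
  rw [sobolevNorm, ← eLpNorm_increment_sq hS hβ hu, ← ENNReal.rpow_natCast, ← ENNReal.rpow_mul]
  norm_num

lemma memSobolev_iff (hS : MeasurableSet S) (hβ : ContinuousOn β S) {u : Space n → ℝ} :
    MemSobolev β S u ↔ MemLp u 2 (volume.restrict S) ∧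
      MemLp (increment u) 2 (jumpMeasure β S) := by
  refine and_congr_right fun hu => ?_
  rw [← eLpNorm_increment_sq hS hβ hu.1]
  constructor
  · intro h
    exact ⟨aestronglyMeasurable_increment hu.1, by
      by_contra hn
      rw [not_lt, top_le_iff] at hn
      simp [hn] at h⟩
  · intro h
    exact ENNReal.pow_lt_top h.2

/-- The pairs `(u, u(y) - u(x))` with `u` in the subspace `C` of `L²(S)`, as a subspace of
`L²(S) × L²(|y - x| ^ (-n - 2β(x)) dy dx)`. -/
def energySubmodule (β : Space n → ℝ) (S : Set (Space n))
    (C : Submodule ℝ (Lp ℝ 2 (volume.restrict S))) :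
    Submodule ℝ (WithLp 2 (Lp ℝ 2 (volume.restrict S) × Lp ℝ 2 (jumpMeasure β S))) where
  carrier := {x | x.fst ∈ C ∧ x.snd =ᵐ[jumpMeasure β S] increment x.fst}
  add_mem' := by
    rintro x y ⟨hx1, hx2⟩ ⟨hy1, hy2⟩
    refine ⟨C.add_mem hx1 hy1, ?_⟩
    have h1 := increment_congr (β := β) (Lp.coeFn_add x.fst y.fst)
    filter_upwards [Lp.coeFn_add x.snd y.snd, hx2, hy2, h1] with p e1 e2 e3 e4
    rw [WithLp.add_fst, WithLp.add_snd, e1, e4, Pi.add_apply, e2, e3]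
    simp only [increment, Pi.add_apply]
    ring
  zero_mem' := by
    refine ⟨C.zero_mem, ?_⟩
    have h1 := increment_congr (β := β) (Lp.coeFn_zero ℝ 2 (volume.restrict S))
    filter_upwards [Lp.coeFn_zero ℝ 2 (jumpMeasure β S), h1] with p e1 e2
    rw [WithLp.zero_fst, WithLp.zero_snd, e1, e2]
    simp [increment]
  smul_mem' := by
    rintro c x ⟨hx1, hx2⟩
    refine ⟨C.smul_mem c hx1, ?_⟩
    have h1 := increment_congr (β := β) (Lp.coeFn_smul c x.fst)
    filter_upwards [Lp.coeFn_smul c x.snd, hx2, h1] with p e1 e2 e3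
    rw [WithLp.smul_fst, WithLp.smul_snd, e1, e3, Pi.smul_apply, e2]
    simp only [increment, Pi.smul_apply, smul_eq_mul]
    ring

variable {C : Submodule ℝ (Lp ℝ 2 (volume.restrict S))}

/-- The increment map has closed graph: along a subsequence both components converge almost
everywhere, and the relation between them is pointwise. This yields completeness of the energy
space. -/
lemma isClosed_energySubmodule (hC : IsClosed (C : Set (Lp ℝ 2 (volume.restrict S)))) :
    IsClosed (energySubmodule β S C : Set (WithLp 2
      (Lp ℝ 2 (volume.restrict S) × Lp ℝ 2 (jumpMeasure β S)))) := by
  refine IsSeqClosed.isClosed fun x x₀ hx hlim => ?_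
  have h1 : Tendsto (fun k => (x k).fst) atTop (𝓝 x₀.fst) :=
    ((WithLp.fstL 2 ℝ (Lp ℝ 2 (volume.restrict S)) (Lp ℝ 2 (jumpMeasure β S))).continuous.tendsto
      x₀).comp hlim
  have h2 : Tendsto (fun k => (x k).snd) atTop (𝓝 x₀.snd) :=
    ((WithLp.sndL 2 ℝ (Lp ℝ 2 (volume.restrict S)) (Lp ℝ 2 (jumpMeasure β S))).continuous.tendsto
      x₀).comp hlim
  refine ⟨hC.isSeqClosed (fun k => (hx k).1) h1, ?_⟩
  -- Two successive extractions: convergence of the functions first, then of the increments along a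
  -- further subsequence.
  obtain ⟨ns, hns, hns1⟩ := (tendstoInMeasure_of_tendsto_Lp h1).exists_seq_tendsto_ae
  obtain ⟨ms, hms, hms1⟩ :=
    (tendstoInMeasure_of_tendsto_Lp (h2.comp hns.tendsto_atTop)).exists_seq_tendsto_ae
  have h3 : ∀ᵐ p ∂jumpMeasure β S, Tendsto (fun k => increment (x (ns (ms k))).fst p) atTop
      (𝓝 (increment x₀.fst p)) := by
    refine jumpMeasure_absolutelyContinuous.ae_le ?_
    have a1 := (Measure.quasiMeasurePreserving_fst (μ := volume.restrict S)
      (ν := volume.restrict S)).ae hns1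
    have a2 := (Measure.quasiMeasurePreserving_snd (μ := volume.restrict S)
      (ν := volume.restrict S)).ae hns1
    filter_upwards [a1, a2] with p e1 e2
    exact (e2.comp hms.tendsto_atTop).sub (e1.comp hms.tendsto_atTop)
  have h4 : ∀ᵐ p ∂jumpMeasure β S, ∀ k, (x (ns (ms k))).snd p = increment (x (ns (ms k))).fst p :=
    ae_all_iff.2 fun k => (hx _).2
  filter_upwards [hms1, h3, h4] with p e1 e2 e3
  refine tendsto_nhds_unique e1 (e2.congr fun k => ?_)
  simp only [Function.comp]
  rw [e3]

/-- The energy space: the subspace `energySubmodule` as a Hilbert space. -/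
def EnergySpace (β : Space n → ℝ) (S : Set (Space n))
    (C : Submodule ℝ (Lp ℝ 2 (volume.restrict S))) : Type :=
  energySubmodule β S C

instance : NormedAddCommGroup (EnergySpace β S C) :=
  inferInstanceAs (NormedAddCommGroup (energySubmodule β S C))

instance : InnerProductSpace ℝ (EnergySpace β S C) :=
  inferInstanceAs (InnerProductSpace ℝ (energySubmodule β S C))

instance : SecondCountableTopology (EnergySpace β S C) :=
  have : SecondCountableTopology (WithLp 2 (Lp ℝ 2 (volume.restrict S) ×
      Lp ℝ 2 (jumpMeasure β S))) := WithLp.secondCountableTopology _ _ _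
  TopologicalSpace.Subtype.secondCountableTopology (energySubmodule β S C : Set (WithLp 2
    (Lp ℝ 2 (volume.restrict S) × Lp ℝ 2 (jumpMeasure β S))))

lemma completeSpace_energySpace (hC : IsClosed (C : Set (Lp ℝ 2 (volume.restrict S)))) :
    CompleteSpace (EnergySpace β S C) :=
  (isClosed_energySubmodule (β := β) hC).completeSpace_coe

/-- The embedding of the energy space in `L²(S)`. -/
def energyFst (β : Space n → ℝ) (S : Set (Space n))
    (C : Submodule ℝ (Lp ℝ 2 (volume.restrict S))) :
    EnergySpace β S C →L[ℝ] Lp ℝ 2 (volume.restrict S) :=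
  ((WithLp.fstL 2 ℝ _ _) ∘L (energySubmodule β S C).subtypeL :
    energySubmodule β S C →L[ℝ] Lp ℝ 2 (volume.restrict S))

/-- The map `u ↦ u(y) - u(x)` on the energy space. -/
def energySnd (β : Space n → ℝ) (S : Set (Space n))
    (C : Submodule ℝ (Lp ℝ 2 (volume.restrict S))) :
    EnergySpace β S C →L[ℝ] Lp ℝ 2 (jumpMeasure β S) :=
  ((WithLp.sndL 2 ℝ _ _) ∘L (energySubmodule β S C).subtypeL :
    energySubmodule β S C →L[ℝ] Lp ℝ 2 (jumpMeasure β S))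

lemma energySpace_norm_sq (x : EnergySpace β S C) :
    ‖x‖ ^ 2 = ‖energyFst β S C x‖ ^ 2 + ‖energySnd β S C x‖ ^ 2 := by
  exact WithLp.prod_norm_sq_eq_of_L2 x.1

lemma energyFst_mem (x : EnergySpace β S C) : energyFst β S C x ∈ C := x.2.1

lemma energySnd_ae_eq (x : EnergySpace β S C) :
    energySnd β S C x =ᵐ[jumpMeasure β S] increment (energyFst β S C x) := x.2.2

lemma energyFst_injective : Function.Injective (energyFst β S C) := by
  rw [injective_iff_map_eq_zero]
  intro x hx
  have h1 := energySnd_ae_eq x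
  rw [hx] at h1
  have h2 := increment_congr (β := β) (Lp.coeFn_zero ℝ 2 (volume.restrict S))
  have h3 : energySnd β S C x = 0 := by
    refine Lp.ext ?_
    filter_upwards [h1, h2, Lp.coeFn_zero ℝ 2 (jumpMeasure β S)] with p e1 e2 e3
    rw [e1, e2, e3]
    simp [increment]
  have h4 := energySpace_norm_sq x
  rw [hx, h3] at h4
  simpa using h4

/-- An element of the energy space from a function. -/
def toEnergySpace (hS : MeasurableSet S) (hβ : ContinuousOn β S) {u : Space n → ℝ}
    (hu : MemSobolev β S u) (hC : hu.1.toLp u ∈ C) : EnergySpace β S C :=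
  ⟨WithLp.toLp 2 (hu.1.toLp u, ((memSobolev_iff hS hβ).1 hu).2.toLp (increment u)), hC, by
    have h1 := increment_congr (β := β) hu.1.coeFn_toLp
    filter_upwards [((memSobolev_iff hS hβ).1 hu).2.coeFn_toLp, h1] with p e1 e2
    change (((memSobolev_iff hS hβ).1 hu).2.toLp (increment u) : _ → ℝ) p = _
    rw [e1]
    exact e2.symm⟩

lemma energyFst_toEnergySpace (hS : MeasurableSet S) (hβ : ContinuousOn β S) {u : Space n → ℝ}
    (hu : MemSobolev β S u) (hC : hu.1.toLp u ∈ C) :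
    energyFst β S C (toEnergySpace hS hβ hu hC) = hu.1.toLp u := rfl

lemma memSobolev_energyFst (hS : MeasurableSet S) (hβ : ContinuousOn β S)
    (x : EnergySpace β S C) : MemSobolev β S (energyFst β S C x) :=
  (memSobolev_iff hS hβ).2 ⟨Lp.memLp _, (memLp_congr_ae (energySnd_ae_eq x)).1 (Lp.memLp _)⟩

lemma sobolevNorm_energyFst (hS : MeasurableSet S) (hβ : ContinuousOn β S)
    (x : EnergySpace β S C) : sobolevNorm β S (energyFst β S C x)
      = ENNReal.ofReal (‖energyFst β S C x‖ + ‖energySnd β S C x‖) := by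
  rw [sobolevNorm_eq hS hβ (Lp.aestronglyMeasurable _), ENNReal.ofReal_add (norm_nonneg _)
    (norm_nonneg _), ofReal_norm_Lp, ofReal_norm_Lp]
  exact congrArg _ (eLpNorm_congr_ae (energySnd_ae_eq x)).symm

/-! ### The volume constraint -/

variable {ε : ℝ≥0∞} {Ω : Set (Space n)}

lemma constraintFunctional_congr (c : Constraint) {u v : Space n → ℝ}
    (h : u =ᵐ[volume.restrict (totalDomain ε Ω)] v) :
    constraintFunctional c ε Ω u = constraintFunctional c ε Ω v := by
  cases c with
  | dirichlet =>
    refine integral_congr_ae ?_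
    filter_upwards [ae_mono (Measure.restrict_mono subset_union_right le_rfl) h] with x hx
    rw [hx]
  | neumann => exact congrArg (· ^ 2) (integral_congr_ae h)

lemma dirichlet_iff {u : Space n → ℝ} (hu : MemLp u 2 (volume.restrict (totalDomain ε Ω))) :
    constraintFunctional .dirichlet ε Ω u = 0 ↔
      u =ᵐ[volume.restrict (interactionDomain ε Ω)] 0 := by
  have h1 : MemLp u 2 (volume.restrict (interactionDomain ε Ω)) :=
    hu.mono_measure (Measure.restrict_mono subset_union_right le_rfl)
  rw [constraintFunctional, integral_eq_zero_iff_of_nonneg (fun x => sq_nonneg _) h1.integrable_sq]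
  refine ⟨fun h => h.mono fun x hx => ?_, fun h => h.mono fun x hx => ?_⟩
  · simpa using hx
  · simpa using hx

/-- Both constraints, though quadratic, cut out the kernel of a continuous linear map: restriction
to Ω_I, or integration over Ω̃. The latter is continuous on L² because the volume is finite. -/
lemma exists_constraint_submodule (c : Constraint)
    (hfin : c = .neumann → volume (totalDomain ε Ω) ≠ ⊤) :
    ∃ C : Submodule ℝ (Lp ℝ 2 (volume.restrict (totalDomain ε Ω))),
      IsClosed (C : Set (Lp ℝ 2 (volume.restrict (totalDomain ε Ω)))) ∧
      ∀ y, y ∈ C ↔ constraintFunctional c ε Ω y = 0 := by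
  cases c with
  | dirichlet =>
    let R := LpToLpRestrictCLM (Space n) ℝ ℝ (volume.restrict (totalDomain ε Ω)) 2
      (interactionDomain ε Ω)
    refine ⟨R.ker, R.isClosed_ker, fun y => ?_⟩
    rw [dirichlet_iff (Lp.memLp y), LinearMap.mem_ker]
    have h1 := LpToLpRestrictCLM_coeFn (𝕜 := ℝ) (interactionDomain ε Ω) y
    have h2 : (volume.restrict (totalDomain ε Ω)).restrict (interactionDomain ε Ω)
        = volume.restrict (interactionDomain ε Ω) :=
      Measure.restrict_restrict_of_subset subset_union_right
    constructor
    · intro h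
      change R y = 0 at h
      have h3 : (R y : Space n → ℝ)
          =ᵐ[(volume.restrict (totalDomain ε Ω)).restrict (interactionDomain ε Ω)] 0 := by
        rw [h]; exact Lp.coeFn_zero _ _ _
      rw [← h2]
      exact h1.symm.trans h3
    · intro h
      refine Lp.ext (h1.trans ?_)
      rw [← h2] at h
      exact h.trans (Lp.coeFn_zero _ _ _).symm
  | neumann =>
    have hf := hfin rfl
    have : IsFiniteMeasure (volume.restrict (totalDomain ε Ω)) :=
      ⟨by rw [Measure.restrict_apply_univ]; exact hf.lt_top⟩
    let e : Lp ℝ 2 (volume.restrict (totalDomain ε Ω)) :=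
      (memLp_const (1 : ℝ)).toLp (fun _ => (1 : ℝ))
    let R := innerSL ℝ e
    refine ⟨R.ker, R.isClosed_ker, fun y => ?_⟩
    have h1 : R y = ∫ x in totalDomain ε Ω, y x := by
      change inner ℝ e y = _
      rw [L2.inner_def]
      refine integral_congr_ae ?_
      filter_upwards [(memLp_const (1 : ℝ)).coeFn_toLp (μ := volume.restrict (totalDomain ε Ω))
        (p := 2)] with x hx
      change inner ℝ (e x) (y x) = _
      rw [show e x = 1 from hx]
      simp
    rw [constraintFunctional, ← h1, sq_eq_zero_iff]
    rfl

end EnergySpace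

/-! ### Bilinear forms given by bounded weights -/

section WeightForm

variable {Z : Type*} [MeasurableSpace Z] {μ : Measure Z} {κ κ₁ κ₂ : Z → ℝ} {c c' d : ℝ}

lemma integrable_weight_mul (hκ : Measurable κ) (hc : ∀ z, |κ z| ≤ c) {f g : Z → ℝ}
    (hf : MemLp f 2 μ) (hg : MemLp g 2 μ) : Integrable (fun z => κ z * (f z * g z)) μ :=
  (hf.integrable_mul hg).bdd_mul hκ.aestronglyMeasurable (ae_of_all _ hc)

/-- Cauchy–Schwarz for the absolute values |f| and |g|, after the weight has been bounded pointwise.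
-/
lemma abs_integral_weight_mul_le (hd : 0 ≤ d) (hc : ∀ z, |κ z| ≤ d) (f g : Lp ℝ 2 μ) :
    |∫ z, κ z * (f z * g z) ∂μ| ≤ d * ‖f‖ * ‖g‖ := by
  have hfg : Integrable (fun z => |f z| * |g z|) μ :=
    ((Lp.memLp f).abs.integrable_mul (Lp.memLp g).abs)
  have h1 : ‖∫ z, κ z * (f z * g z) ∂μ‖ ≤ ∫ z, d * (|f z| * |g z|) ∂μ := by
    refine norm_integral_le_of_norm_le (hfg.const_mul d) (ae_of_all _ fun z => ?_)
    rw [norm_mul, norm_mul]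
    exact mul_le_mul_of_nonneg_right (hc z) (by positivity)
  have h2 : ∫ z, |f z| * |g z| ∂μ = inner ℝ |g| |f| := by
    rw [L2.inner_def]
    refine integral_congr_ae ?_
    filter_upwards [Lp.coeFn_abs f, Lp.coeFn_abs g] with z h1 h2
    rw [h1, h2]
    rfl
  have h3 := real_inner_le_norm |g| |f|
  rw [norm_abs_eq_norm, norm_abs_eq_norm] at h3
  rw [integral_const_mul, h2] at h1
  calc _ ≤ _ := h1
    _ ≤ d * (‖g‖ * ‖f‖) := mul_le_mul_of_nonneg_left h3 hd
    _ = _ := by ring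

/-- The form `(f, g) ↦ ∫ κ f g` on `L²(μ)`. -/
def weightForm (μ : Measure Z) (κ : Z → ℝ) (hκ : Measurable κ) (hc : ∀ z, |κ z| ≤ c) :
    Lp ℝ 2 μ →L[ℝ] Lp ℝ 2 μ →L[ℝ] ℝ :=
  LinearMap.mkContinuous₂
    (LinearMap.mk₂ ℝ (fun f g : Lp ℝ 2 μ => ∫ z, κ z * (f z * g z) ∂μ)
      (fun f f' g => by
        rw [← integral_add (integrable_weight_mul hκ hc (Lp.memLp f) (Lp.memLp g))
          (integrable_weight_mul hκ hc (Lp.memLp f') (Lp.memLp g))]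
        refine integral_congr_ae ?_
        filter_upwards [Lp.coeFn_add f f'] with z hz
        rw [hz, Pi.add_apply]; ring)
      (fun r f g => by
        rw [smul_eq_mul, ← integral_const_mul]
        refine integral_congr_ae ?_
        filter_upwards [Lp.coeFn_smul r f] with z hz
        rw [hz, Pi.smul_apply, smul_eq_mul]; ring)
      (fun f g g' => by
        rw [← integral_add (integrable_weight_mul hκ hc (Lp.memLp f) (Lp.memLp g))
          (integrable_weight_mul hκ hc (Lp.memLp f) (Lp.memLp g'))]
        refine integral_congr_ae ?_
        filter_upwards [Lp.coeFn_add g g'] with z hz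
        rw [hz, Pi.add_apply]; ring)
      (fun r f g => by
        rw [smul_eq_mul, ← integral_const_mul]
        refine integral_congr_ae ?_
        filter_upwards [Lp.coeFn_smul r g] with z hz
        rw [hz, Pi.smul_apply, smul_eq_mul]; ring))
    -- On an empty space the pointwise bound does not force c to be nonnegative.
    (max c 0) (fun f g => abs_integral_weight_mul_le (le_max_right _ _)
      (fun z => (hc z).trans (le_max_left _ _)) f g)

lemma weightForm_apply (hκ : Measurable κ) (hc : ∀ z, |κ z| ≤ c) (f g : Lp ℝ 2 μ) :
    weightForm μ κ hκ hc f g = ∫ z, κ z * (f z * g z) ∂μ := rfl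

lemma weightForm_comm (hκ : Measurable κ) (hc : ∀ z, |κ z| ≤ c) (f g : Lp ℝ 2 μ) :
    weightForm μ κ hκ hc f g = weightForm μ κ hκ hc g f := by
  simp only [weightForm_apply, mul_comm]

/-- The weights need only be ordered where f does not vanish. This is how the diagonal is
disregarded later, since increments vanish there. -/
lemma weightForm_self_le (hκ₁ : Measurable κ₁) (hc : ∀ z, |κ₁ z| ≤ c) (hκ₂ : Measurable κ₂)
    (hc' : ∀ z, |κ₂ z| ≤ c') (f : Lp ℝ 2 μ) (h : ∀ᵐ z ∂μ, f z ≠ 0 → κ₁ z ≤ κ₂ z) :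
    weightForm μ κ₁ hκ₁ hc f f ≤ weightForm μ κ₂ hκ₂ hc' f f := by
  refine integral_mono_ae (integrable_weight_mul hκ₁ hc (Lp.memLp f) (Lp.memLp f))
    (integrable_weight_mul hκ₂ hc' (Lp.memLp f) (Lp.memLp f)) ?_
  filter_upwards [h] with z hz
  by_cases h0 : f z = 0
  · simp [h0]
  · exact mul_le_mul_of_nonneg_right (hz h0) (mul_self_nonneg _)

lemma weightForm_self_nonneg (hκ : Measurable κ) (hc : ∀ z, |κ z| ≤ c) (h0 : ∀ z, 0 ≤ κ z)
    (f : Lp ℝ 2 μ) : 0 ≤ weightForm μ κ hκ hc f f :=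
  integral_nonneg fun z => mul_nonneg (h0 z) (mul_self_nonneg _)

lemma weightForm_add (hκ₁ : Measurable κ₁) (hc : ∀ z, |κ₁ z| ≤ c) (hκ₂ : Measurable κ₂)
    (hc' : ∀ z, |κ₂ z| ≤ c') (hκ : Measurable κ) (hd : ∀ z, |κ z| ≤ d)
    (h : ∀ z, κ z = κ₁ z + κ₂ z) (f g : Lp ℝ 2 μ) :
    weightForm μ κ hκ hd f g = weightForm μ κ₁ hκ₁ hc f g + weightForm μ κ₂ hκ₂ hc' f g := by
  simp only [weightForm_apply]
  rw [← integral_add (integrable_weight_mul hκ₁ hc (Lp.memLp f) (Lp.memLp g))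
    (integrable_weight_mul hκ₂ hc' (Lp.memLp f) (Lp.memLp g))]
  refine integral_congr_ae (ae_of_all _ fun z => ?_)
  simp only [h]; ring

lemma norm_weightForm_le (hκ : Measurable κ) (hc : ∀ z, |κ z| ≤ c) (hd : 0 ≤ d)
    (h : ∀ z, |κ z| ≤ d) : ‖weightForm μ κ hκ hc‖ ≤ d :=
  ContinuousLinearMap.opNorm_le_bound₂ _ hd (abs_integral_weight_mul_le hd h)

lemma norm_weightForm_sub_le (hκ₁ : Measurable κ₁) (hc : ∀ z, |κ₁ z| ≤ c) (hκ₂ : Measurable κ₂)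
    (hc' : ∀ z, |κ₂ z| ≤ c') (hd : 0 ≤ d) (h : ∀ z, |κ₁ z - κ₂ z| ≤ d) :
    ‖weightForm μ κ₁ hκ₁ hc - weightForm μ κ₂ hκ₂ hc'‖ ≤ d := by
  refine ContinuousLinearMap.opNorm_le_bound₂ _ hd fun f g => ?_
  have : (weightForm μ κ₁ hκ₁ hc - weightForm μ κ₂ hκ₂ hc') f g
      = ∫ z, (κ₁ z - κ₂ z) * (f z * g z) ∂μ := by
    rw [sub_apply, sub_apply, weightForm_apply,
      weightForm_apply, ← integral_sub (integrable_weight_mul hκ₁ hc (Lp.memLp f) (Lp.memLp g))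
      (integrable_weight_mul hκ₂ hc' (Lp.memLp f) (Lp.memLp g))]
    refine integral_congr_ae (ae_of_all _ fun z => ?_)
    simp only []; ring
  rw [this]
  exact abs_integral_weight_mul_le hd h f g

lemma continuous_weightForm {κ : ℝ → Z → ℝ} (hκ : ∀ t, Measurable (κ t))
    (hc : ∀ t z, |κ t z| ≤ c) (hcont : ∀ z, Continuous fun t => κ t z) (f g : Lp ℝ 2 μ) :
    Continuous fun t => weightForm μ (κ t) (hκ t) (hc t) f g := by
  simp only [weightForm_apply]
  refine continuous_of_dominated (bound := fun z => c * ‖f z * g z‖) (fun t =>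
    (integrable_weight_mul (hκ t) (hc t) (Lp.memLp f) (Lp.memLp g)).aestronglyMeasurable)
    (fun t => ae_of_all _ fun z => ?_)
    (((Lp.memLp f).integrable_mul (Lp.memLp g)).norm.const_mul c)
    (ae_of_all _ fun z => (hcont z).mul_const _)
  rw [norm_mul]
  exact mul_le_mul_of_nonneg_right (hc t z) (norm_nonneg _)

/-- Off F the weight annihilates both functions, so each may be replaced by its restriction to F
before Cauchy–Schwarz. -/
lemma abs_weightForm_le_of_ae (hκ : Measurable κ) (hc : ∀ z, |κ z| ≤ c) {F : Set Z}
    (hF : MeasurableSet F) (hc0 : 0 ≤ c) (f g : Lp ℝ 2 μ)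
    (hf : ∀ᵐ z ∂μ, z ∉ F → κ z * f z = 0) (hg : ∀ᵐ z ∂μ, z ∉ F → κ z * g z = 0) :
    |weightForm μ κ hκ hc f g| ≤ c * Real.sqrt (∫ z in F, f z ^ 2 ∂μ)
      * Real.sqrt (∫ z in F, g z ^ 2 ∂μ) := by
  have key : ∀ h : Lp ℝ 2 μ, Real.sqrt (∫ z in F, h z ^ 2 ∂μ)
      = ‖((Lp.memLp h).indicator hF).toLp (F.indicator h)‖ := by
    intro h
    rw [Real.sqrt_eq_iff_mul_self_eq (integral_nonneg fun z => sq_nonneg _) (norm_nonneg _),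
      ← real_inner_self_eq_norm_mul_norm, L2.inner_def, ← integral_indicator hF]
    refine integral_congr_ae ?_
    filter_upwards [((Lp.memLp h).indicator hF).coeFn_toLp] with z hz
    rw [hz]
    by_cases hzF : z ∈ F
    · simp [hzF, sq]
    · simp [hzF]
  rw [key, key]
  refine le_trans (le_of_eq ?_) (abs_integral_weight_mul_le hc0 hc _ _)
  rw [weightForm_apply]
  congr 1
  refine integral_congr_ae ?_
  filter_upwards [hf, hg, ((Lp.memLp f).indicator hF).coeFn_toLp,
    ((Lp.memLp g).indicator hF).coeFn_toLp] with z h1 h2 h3 h4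
  rw [h3, h4]
  by_cases hzF : z ∈ F
  · simp [hzF]
  · rw [← mul_assoc, h1 hzF]; simp [hzF]

end WeightForm

/-! ### The weight of the diffusion tensor -/

section TensorWeight

variable {n : ℕ}

/-- The unit vector from `p.1` to `p.2`. -/
def direction (p : Space n × Space n) : Space n := (dist p.2 p.1)⁻¹ • (p.2 - p.1)

lemma measurable_direction : Measurable (direction (n := n)) := by
  unfold direction
  exact (measurable_snd.dist measurable_fst).inv.smul (measurable_snd.sub measurable_fst)

lemma norm_direction_of_ne {p : Space n × Space n} (h : p.2 ≠ p.1) : ‖direction p‖ = 1 := by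
  rw [direction, norm_smul, norm_inv, Real.norm_of_nonneg dist_nonneg, ← dist_eq_norm]
  exact inv_mul_cancel₀ (dist_pos.2 h).ne'

lemma norm_direction_le (p : Space n × Space n) : ‖direction p‖ ≤ 1 := by
  by_cases h : p.2 = p.1
  · simp [direction, h]
  · exact (norm_direction_of_ne h).le

/-- The projection of time to `[0,T]`. -/
def clampTime (T t : ℝ) : ℝ := max 0 (min t T)

variable {T : ℝ}

lemma clampTime_mem (hT : 0 < T) (t : ℝ) : clampTime T t ∈ Icc 0 T :=
  ⟨le_max_left _ _, max_le hT.le (min_le_right _ _)⟩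

lemma clampTime_of_mem {t : ℝ} (ht : t ∈ Icc 0 T) : clampTime T t = t := by
  rw [clampTime, min_eq_left ht.2, max_eq_right ht.1]

lemma continuous_clampTime : Continuous (clampTime T) := by
  unfold clampTime; fun_prop

lemma abs_clampTime_sub_le (s t : ℝ) : |clampTime T s - clampTime T t| ≤ |s - t| := by
  unfold clampTime
  grind

lemma clampTime_mono {s t : ℝ} (h : s ≤ t) : clampTime T s ≤ clampTime T t :=
  max_le_max le_rfl (min_le_min h le_rfl)

/-- The pairs of points of the domain at distance at most `ε`. -/
def interactionPairs (ε : ℝ≥0∞) (Ω : Set (Space n)) : Set (Space n × Space n) :=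
  {p | p.1 ∈ totalDomain ε Ω ∧ p.2 ∈ totalDomain ε Ω ∧ edist p.2 p.1 ≤ ε}

/-- The quadratic form of `a` in the direction from `x` to `y`, on the interacting pairs. -/
def tensorWeight (ε : ℝ≥0∞) (Ω : Set (Space n)) (T : ℝ)
    (a : ℝ → Space n → Space n → Matrix (Fin n) (Fin n) ℝ) (t : ℝ) : Space n × Space n → ℝ :=
  (interactionPairs ε Ω).indicator fun p =>
    ∑ i, ∑ j, a (clampTime T t) p.1 p.2 i j * direction p i * direction p j

variable {ε : ℝ≥0∞} {Ω : Set (Space n)}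
  {a : ℝ → Space n → Space n → Matrix (Fin n) (Fin n) ℝ} {aLow aUp : ℝ}

lemma measurableSet_interactionPairs (hD : MeasurableSet (totalDomain ε Ω)) :
    MeasurableSet (interactionPairs ε Ω) :=
  (measurable_fst hD).inter ((measurable_snd hD).inter
    (measurableSet_le (measurable_snd.edist measurable_fst) measurable_const))

lemma tensorWeight_nonneg (ha : AdmissibleTensor ε Ω T a aLow aUp) (hT : 0 < T) (t : ℝ)
    (p : Space n × Space n) : 0 ≤ tensorWeight ε Ω T a t p := by
  refine indicator_nonneg (fun p hp => ?_) p
  exact le_trans (mul_nonneg ha.low_pos.le (sq_nonneg _))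
    (ha.lower _ (clampTime_mem hT t) _ hp.1 _ hp.2.1 hp.2.2 (direction p))

lemma tensorWeight_le (ha : AdmissibleTensor ε Ω T a aLow aUp) (hT : 0 < T) (t : ℝ)
    (p : Space n × Space n) :
    tensorWeight ε Ω T a t p ≤ (interactionPairs ε Ω).indicator (fun _ => |aUp|) p := by
  refine indicator_le_indicator' fun hp => ?_
  refine (ha.upper _ (clampTime_mem hT t) _ hp.1 _ hp.2.1 hp.2.2 (direction p)).trans ?_
  refine (mul_le_mul_of_nonneg_right (le_abs_self aUp) (sq_nonneg _)).trans ?_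
  exact mul_le_of_le_one_right (abs_nonneg _) (pow_le_one₀ (norm_nonneg _) (norm_direction_le p))

lemma abs_tensorWeight_le (ha : AdmissibleTensor ε Ω T a aLow aUp) (hT : 0 < T) (t : ℝ)
    (p : Space n × Space n) : |tensorWeight ε Ω T a t p| ≤ |aUp| := by
  rw [abs_of_nonneg (tensorWeight_nonneg ha hT t p)]
  exact (tensorWeight_le ha hT t p).trans (indicator_le_self' (fun _ _ => abs_nonneg _) p)

lemma le_tensorWeight (ha : AdmissibleTensor ε Ω T a aLow aUp) (hT : 0 < T) (t : ℝ)
    {p : Space n × Space n} (hp : p.2 ≠ p.1) :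
    (interactionPairs ε Ω).indicator (fun _ => aLow) p ≤ tensorWeight ε Ω T a t p := by
  refine indicator_le_indicator' fun hp' => ?_
  have := ha.lower _ (clampTime_mem hT t) _ hp'.1 _ hp'.2.1 hp'.2.2 (direction p)
  rwa [norm_direction_of_ne hp, one_pow, mul_one] at this

lemma AdmissibleTensor.continuousOn_entry (ha : AdmissibleTensor ε Ω T a aLow aUp) (i j : Fin n) :
    ContinuousOn (fun p : ℝ × Space n × Space n => a p.1 p.2.1 p.2.2 i j) (Icc 0 T ×ˢ univ) :=
  (ha.contDiffOn i j).continuousOn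

lemma measurable_tensorWeight (ha : AdmissibleTensor ε Ω T a aLow aUp) (hT : 0 < T)
    (hD : MeasurableSet (totalDomain ε Ω)) (t : ℝ) : Measurable (tensorWeight ε Ω T a t) := by
  refine Measurable.indicator ?_ (measurableSet_interactionPairs hD)
  refine Finset.measurable_sum _ fun i _ => Finset.measurable_sum _ fun j _ => ?_
  have h1 : Continuous fun p : Space n × Space n => a (clampTime T t) p.1 p.2 i j :=
    (ha.continuousOn_entry i j).comp_continuous (f := fun p : Space n × Space n =>
      (clampTime T t, p)) (by fun_prop) fun p => ⟨clampTime_mem hT t, mem_univ _⟩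
  have h2 : ∀ k, Measurable fun p : Space n × Space n => direction p k := fun k =>
    (EuclideanSpace.proj (𝕜 := ℝ) k).continuous.measurable.comp measurable_direction
  exact (h1.measurable.mul (h2 i)).mul (h2 j)

lemma continuous_tensorWeight (ha : AdmissibleTensor ε Ω T a aLow aUp) (hT : 0 < T)
    (p : Space n × Space n) : Continuous fun t => tensorWeight ε Ω T a t p := by
  by_cases hp : p ∈ interactionPairs ε Ω
  · simp only [tensorWeight, indicator_of_mem hp]
    refine continuous_finsetSum _ fun i _ => continuous_finsetSum _ fun j _ => ?_
    have h1 : Continuous fun t : ℝ => a (clampTime T t) p.1 p.2 i j :=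
      (ha.continuousOn_entry i j).comp_continuous (f := fun t : ℝ =>
        (clampTime T t, p)) (continuous_clampTime.prodMk continuous_const)
        fun t => ⟨clampTime_mem hT t, mem_univ _⟩
    exact (h1.mul continuous_const).mul continuous_const
  · simp only [tensorWeight, indicator_of_notMem hp]
    exact continuous_const

/-- The mean value inequality in time, one-sided because only an upper bound of the time derivative
is assumed. It holds uniformly in space, unlike the Lipschitz bound of
`exists_lipschitz_tensorWeight`. -/
lemma tensorWeight_sub_le (ha : AdmissibleTensor ε Ω T a aLow aUp) (hT : 0 < T)
    {s t : ℝ} (hst : s ≤ t) (p : Space n × Space n) :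
    tensorWeight ε Ω T a t p - tensorWeight ε Ω T a s p
      ≤ (t - s) * (interactionPairs ε Ω).indicator (fun _ => |aUp|) p := by
  by_cases hp : p ∈ interactionPairs ε Ω
  · simp only [tensorWeight, indicator_of_mem hp]
    set ξ := direction p with hξ
    set g : ℝ → ℝ := fun τ => ∑ i, ∑ j, a τ p.1 p.2 i j * ξ i * ξ j with hg
    have hdiff : ∀ i j, DifferentiableOn ℝ (fun τ => a τ p.1 p.2 i j) (Icc 0 T) := fun i j =>
      ((ha.contDiffOn i j).differentiableOn one_ne_zero).comp (f := fun τ : ℝ => (τ, p))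
        (by fun_prop) fun τ hτ => ⟨hτ, mem_univ _⟩
    have hgd : ∀ τ ∈ Icc 0 T, HasDerivWithinAt g (∑ i, ∑ j,
        derivWithin (fun τ => a τ p.1 p.2 i j) (Icc 0 T) τ * ξ i * ξ j) (Icc 0 T) τ := by
      intro τ hτ
      refine HasDerivWithinAt.fun_sum fun i _ => HasDerivWithinAt.fun_sum fun j _ => ?_
      exact ((hdiff i j τ hτ).hasDerivWithinAt.mul_const _).mul_const _
    have key := (convex_Icc (0 : ℝ) T).image_sub_le_mul_sub_of_deriv_le (f := g) (C := |aUp|)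
      (fun τ hτ => (hgd τ hτ).continuousWithinAt)
      (fun τ hτ => (hgd τ (interior_subset hτ)).differentiableWithinAt.mono interior_subset)
      (fun τ hτ => by
        have hτ' := interior_subset hτ
        rw [((hgd τ hτ').hasDerivAt (mem_interior_iff_mem_nhds.1 hτ)).deriv]
        refine (ha.deriv_upper τ hτ' _ hp.1 _ hp.2.1 hp.2.2 ξ).trans ?_
        refine (mul_le_mul_of_nonneg_right (le_abs_self aUp) (sq_nonneg _)).trans ?_
        exact mul_le_of_le_one_right (abs_nonneg _)
          (pow_le_one₀ (norm_nonneg _) (norm_direction_le p)))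
      _ (clampTime_mem hT s) _ (clampTime_mem hT t) (clampTime_mono hst)
    refine key.trans ?_
    rw [mul_comm]
    refine mul_le_mul_of_nonneg_right ?_ (abs_nonneg _)
    have := abs_clampTime_sub_le (T := T) t s
    rw [abs_of_nonneg (sub_nonneg.2 hst)] at this
    exact (le_abs_self _).trans this
  · simp [tensorWeight, indicator_of_notMem hp]

/-- A C¹ function is Lipschitz on a compact convex set. Over all of space the time derivative need
not be bounded from below, so the constant depends on the ball. -/
lemma exists_lipschitz_tensorWeight (ha : AdmissibleTensor ε Ω T a aLow aUp) (hT : 0 < T) (ρ : ℝ) :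
    ∃ K, 0 ≤ K ∧ ∀ s t, ∀ p ∈ Metric.closedBall (0 : Space n) ρ ×ˢ Metric.closedBall (0 : Space n) ρ,
      |tensorWeight ε Ω T a t p - tensorWeight ε Ω T a s p| ≤ K * |t - s| := by
  have hlip : ∀ i j, ∃ K : ℝ, 0 ≤ K ∧ ∀ s ∈ Icc 0 T, ∀ t ∈ Icc 0 T,
      ∀ p ∈ Metric.closedBall (0 : Space n) ρ ×ˢ Metric.closedBall (0 : Space n) ρ,
      |a t p.1 p.2 i j - a s p.1 p.2 i j| ≤ K * |t - s| := by
    intro i j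
    set B := Icc 0 T ×ˢ (Metric.closedBall (0 : Space n) ρ ×ˢ Metric.closedBall (0 : Space n) ρ)
    obtain ⟨K, hK⟩ := ((ha.contDiffOn i j).mono (t := B)
      (prod_mono le_rfl (subset_univ _))).exists_lipschitzOnWith one_ne_zero
      ((convex_Icc 0 T).prod ((convex_closedBall _ _).prod (convex_closedBall _ _)))
      (isCompact_Icc.prod ((isCompact_closedBall _ _).prod (isCompact_closedBall _ _)))
    refine ⟨K, K.2, fun s hs t ht p hp => ?_⟩
    have := hK.dist_le_mul (t, p) ⟨ht, hp⟩ (s, p) ⟨hs, hp⟩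
    rw [Real.dist_eq, Prod.dist_eq, dist_self, max_eq_left dist_nonneg, Real.dist_eq] at this
    exact this
  choose K hK0 hK using hlip
  refine ⟨∑ i, ∑ j, K i j, Finset.sum_nonneg fun i _ => Finset.sum_nonneg fun j _ => hK0 i j,
    fun s t p hp => ?_⟩
  by_cases hp' : p ∈ interactionPairs ε Ω
  · simp only [tensorWeight, indicator_of_mem hp']
    rw [← Finset.sum_sub_distrib, Finset.sum_mul]
    refine (Finset.abs_sum_le_sum_abs _ _).trans (Finset.sum_le_sum fun i _ => ?_)
    rw [← Finset.sum_sub_distrib, Finset.sum_mul]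
    refine (Finset.abs_sum_le_sum_abs _ _).trans (Finset.sum_le_sum fun j _ => ?_)
    rw [← sub_mul, ← sub_mul, abs_mul, abs_mul]
    have hb : ∀ k, |direction p k| ≤ 1 := fun k =>
      (PiLp.norm_apply_le (direction p) k).trans
        (norm_direction_le p)
    have h1 := hK i j _ (clampTime_mem hT s) _ (clampTime_mem hT t) p hp
    have h2 := mul_le_mul_of_nonneg_left (abs_clampTime_sub_le (T := T) t s) (hK0 i j)
    have h3 := h1.trans h2
    have h4 : 0 ≤ K i j * |t - s| := mul_nonneg (hK0 i j) (abs_nonneg _)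
    calc _ ≤ (K i j * |t - s|) * 1 * 1 :=
          mul_le_mul (mul_le_mul h3 (hb i) (abs_nonneg _) h4) (hb j) (abs_nonneg _) (by linarith)
      _ = _ := by ring
  · simp only [tensorWeight, indicator_of_notMem hp', sub_self, abs_zero]
    exact mul_nonneg (Finset.sum_nonneg fun i _ => Finset.sum_nonneg fun j _ => hK0 i j)
      (abs_nonneg _)

end TensorWeight

/-! ### Energy estimates for the jump measure -/

section JumpEnergy

variable {n : ℕ} {β : Space n → ℝ} {S : Set (Space n)}

lemma ofReal_norm_sq_Lp {Z : Type*} [MeasurableSpace Z] {μ : Measure Z} (f : Lp ℝ 2 μ) :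
    ENNReal.ofReal (‖f‖ ^ 2) = ∫⁻ z, ENNReal.ofReal (f z ^ 2) ∂μ := by
  rw [← lintegral_ofReal_sq_eq, ← ofReal_norm_Lp, ENNReal.ofReal_pow (norm_nonneg _)]

lemma ofReal_setIntegral_sq_Lp {Z : Type*} [MeasurableSpace Z] {μ : Measure Z} (f : Lp ℝ 2 μ)
    (F : Set Z) :
    ENNReal.ofReal (∫ z in F, f z ^ 2 ∂μ) = ∫⁻ z in F, ENNReal.ofReal (f z ^ 2) ∂μ :=
  ofReal_integral_eq_lintegral_ofReal (Lp.memLp f).integrable_sq.integrableOn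
    (ae_of_all _ fun _ => sq_nonneg _)

lemma aemeasurable_ofReal_increment_sq {u : Space n → ℝ} (hu : AEMeasurable u (volume.restrict S)) :
    AEMeasurable (fun p => ENNReal.ofReal (increment u p ^ 2))
      ((volume.restrict S).prod (volume.restrict S)) :=
  ((hu.comp_snd.sub hu.comp_fst).pow_const 2).ennreal_ofReal

lemma setLIntegral_jumpMeasure (hS : MeasurableSet S) (hβ : ContinuousOn β S)
    {g : Space n × Space n → ℝ≥0∞} {F : Set (Space n × Space n)} (hF : MeasurableSet F)
    (hg : AEMeasurable g ((volume.restrict S).prod (volume.restrict S))) :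
    ∫⁻ p in F, g p ∂jumpMeasure β S = ∫⁻ x in S, ∫⁻ y in S,
      F.indicator g (x, y) * ENNReal.ofReal (dist y x ^ ((n : ℝ) + 2 * β x))⁻¹ := by
  rw [← lintegral_indicator hF, lintegral_jumpMeasure hS hβ (hg.indicator hF)]

lemma measurableSet_lt_dist (δ : ℝ) : MeasurableSet {p : Space n × Space n | δ < dist p.2 p.1} :=
  measurableSet_lt measurable_const (measurable_snd.dist measurable_fst)

/-- The kernel is not symmetric, as its exponent depends on x alone, but its majorant is. After
(u(y) − u(x))² ≤ 2u(y)² + 2u(x)² each of the two terms integrates to at most 2A ∫u². -/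
lemma lintegral_far_increment_le (hS : MeasurableSet S) (hβ : ContinuousOn β S) {δ σ : ℝ}
    (hδ : 0 < δ) (hσ : 0 ≤ σ) (hβS : ∀ x ∈ S, σ ≤ n + 2 * β x ∧ β x ≤ 1) {A : ℝ≥0∞}
    (hA : ∀ x, ∫⁻ y in S,
      ENNReal.ofReal (((1 + δ) / δ) ^ ((n : ℝ) + 2) * (1 + dist x y) ^ (-σ)) ≤ A)
    {u : Space n → ℝ} (hu : AEMeasurable u (volume.restrict S)) :
    ∫⁻ p in {p | δ < dist p.2 p.1}, ENNReal.ofReal (increment u p ^ 2) ∂jumpMeasure β S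
      ≤ 4 * A * ∫⁻ x in S, ENNReal.ofReal (u x ^ 2) := by
  set H : Space n → Space n → ℝ≥0∞ := fun x y =>
    ENNReal.ofReal (((1 + δ) / δ) ^ ((n : ℝ) + 2) * (1 + dist x y) ^ (-σ)) with hH
  have hHm : Measurable (Function.uncurry H) := by
    refine (Measurable.const_mul ?_ _).ennreal_ofReal
    exact (measurable_const.add (measurable_fst.dist measurable_snd)).pow_const _
  set U : Space n → ℝ≥0∞ := fun x => ENNReal.ofReal (u x ^ 2) with hU
  have hUm : AEMeasurable U (volume.restrict S) := (hu.pow_const 2).ennreal_ofReal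
  have h1 : AEMeasurable (fun p : Space n × Space n => H p.1 p.2 * (2 * U p.2))
      ((volume.restrict S).prod (volume.restrict S)) :=
    hHm.aemeasurable.mul (hUm.comp_snd.const_mul 2)
  rw [setLIntegral_jumpMeasure hS hβ (measurableSet_lt_dist δ) (aemeasurable_ofReal_increment_sq hu)]
  calc _ ≤ ∫⁻ x in S, ∫⁻ y in S, (H x y * (2 * U y) + H x y * (2 * U x)) := by
        refine setLIntegral_mono' hS fun x hx => lintegral_mono fun y => ?_
        by_cases hxy : δ < dist y x
        · rw [indicator_of_mem (show (x, y) ∈ {p : Space n × Space n | δ < dist p.2 p.1} from hxy),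
            mul_comm, ← mul_add, ← mul_add]
          refine mul_le_mul' (ENNReal.ofReal_le_ofReal ?_) ?_
          · rw [dist_comm x y]
            exact inv_rpow_le_tail hδ (by linarith [(hβS x hx).2]) (hβS x hx).1 hσ hxy
          · rw [hU, ← ENNReal.ofReal_add (sq_nonneg _) (sq_nonneg _),
              show (2 : ℝ≥0∞) = ENNReal.ofReal 2 by simp, ← ENNReal.ofReal_mul zero_le_two]
            refine ENNReal.ofReal_le_ofReal ?_
            simp only [increment]
            nlinarith [sq_nonneg (u y + u x)]
        · rw [indicator_of_notMem (show (x, y) ∉ {p : Space n × Space n | δ < dist p.2 p.1}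
            from hxy), zero_mul]
          exact bot_le
    _ = (∫⁻ x in S, ∫⁻ y in S, H x y * (2 * U y)) + ∫⁻ x in S, ∫⁻ y in S, H x y * (2 * U x) := by
        rw [← lintegral_add_left' h1.lintegral_prod_right']
        refine lintegral_congr fun x => ?_
        rw [lintegral_add_right]
        exact (hHm.comp measurable_prodMk_left).mul_const _
    _ = (∫⁻ y in S, (2 * U y) * ∫⁻ x in S, H x y)
          + ∫⁻ x in S, (2 * U x) * ∫⁻ y in S, H x y := by
        congr 1
        · rw [lintegral_lintegral_swap h1]
          refine lintegral_congr fun y => ?_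
          rw [← lintegral_const_mul _ (hHm.of_uncurry_right (y := y))]
          exact lintegral_congr fun x => mul_comm _ _
        · refine lintegral_congr fun x => ?_
          rw [← lintegral_const_mul _ (hHm.of_uncurry_left (x := x))]
          exact lintegral_congr fun y => mul_comm _ _
    _ ≤ (∫⁻ y in S, (2 * U y) * A) + ∫⁻ x in S, (2 * U x) * A := by
        refine add_le_add (lintegral_mono fun y => mul_le_mul' le_rfl ?_)
          (lintegral_mono fun x => mul_le_mul' le_rfl (hA x))
        refine le_trans (le_of_eq ?_) (hA y)
        simp only [hH, dist_comm]
    _ = 4 * A * ∫⁻ x in S, U x := by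
        rw [lintegral_mul_const'' _ (hUm.const_mul 2), lintegral_const_mul'' _ hUm]
        ring

lemma exists_lintegral_far_increment_le (hS : MeasurableSet S) (hβ : ContinuousOn β S) {b δ : ℝ}
    (hb : 0 < b) (hβS : ∀ x ∈ S, b ≤ β x ∧ β x ≤ 1) (hδ : 0 < δ) :
    ∃ A : ℝ≥0∞, A ≠ ⊤ ∧ ∀ u : Space n → ℝ, AEMeasurable u (volume.restrict S) →
      ∫⁻ p in {p | δ < dist p.2 p.1}, ENNReal.ofReal (increment u p ^ 2) ∂jumpMeasure β S
        ≤ A * ∫⁻ x in S, ENNReal.ofReal (u x ^ 2) := by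
  set c := ((1 + δ) / δ) ^ ((n : ℝ) + 2) with hc
  have hc0 : 0 ≤ c := by positivity
  set A₀ := ENNReal.ofReal c * ∫⁻ x : Space n, ENNReal.ofReal ((1 + ‖x‖) ^ (-((n : ℝ) + 2 * b)))
  refine ⟨4 * A₀, ENNReal.mul_ne_top (by norm_num) (ENNReal.mul_ne_top ENNReal.ofReal_ne_top
    (lintegral_tail_lt_top (by linarith)).ne), fun u hu => ?_⟩
  refine lintegral_far_increment_le hS hβ hδ (σ := (n : ℝ) + 2 * b) (by positivity)
    (fun x hx => ⟨by linarith [(hβS x hx).1], (hβS x hx).2⟩) (fun x => ?_) hu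
  simp only [← hc, ENNReal.ofReal_mul hc0]
  rw [lintegral_const_mul' _ _ ENNReal.ofReal_ne_top]
  exact mul_le_mul' le_rfl (lintegral_tail_translate _ x S)

end JumpEnergy

/-! ### Control of the norm by interactions up to the horizon -/

section Geometry

variable {n : ℕ} {ε : ℝ≥0∞} {Ω : Set (Space n)}

lemma measurableSet_interactionDomain (hΩ : IsOpen Ω) (hε : 0 < ε) :
    MeasurableSet (interactionDomain ε Ω) := by
  have : interactionDomain ε Ω = totalDomain ε Ω \ Ω := by
    ext y
    simp only [totalDomain, interactionDomain, Set.mem_sdiff, mem_union, mem_ofPred_eq]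
    tauto
  rw [this]
  exact (isOpen_totalDomain hΩ hε).measurableSet.diff hΩ.measurableSet

lemma disjoint_interactionDomain : Disjoint Ω (interactionDomain ε Ω) :=
  disjoint_left.2 fun _ hx hx' => hx'.1 hx

lemma lintegral_totalDomain_of_dirichlet (hΩ : IsOpen Ω) (hε : 0 < ε) {u : Space n → ℝ}
    (hu : u =ᵐ[volume.restrict (interactionDomain ε Ω)] 0) :
    ∫⁻ x in totalDomain ε Ω, ENNReal.ofReal (u x ^ 2) = ∫⁻ x in Ω, ENNReal.ofReal (u x ^ 2) := by
  rw [totalDomain, lintegral_union (measurableSet_interactionDomain hΩ hε)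
    disjoint_interactionDomain]
  refine (congrArg _ ?_).trans (add_zero _)
  refine (lintegral_congr_ae ?_).trans lintegral_zero
  filter_upwards [hu] with x hx
  simp [hx]

/-- Up to the horizon the kernel is at least max(1, ε)^(−n−2) for every order between 0 and 1. -/
lemma lintegral_near_increment_le {β : Space n → ℝ} (hΩ : IsOpen Ω) (hε : 0 < ε)
    (hβ : ContinuousOn β (totalDomain ε Ω)) (hβS : ∀ x ∈ totalDomain ε Ω, 0 ≤ β x ∧ β x ≤ 1)
    {u : Space n → ℝ} (hu : AEMeasurable u (volume.restrict (totalDomain ε Ω))) :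
    (∫⁻ x in totalDomain ε Ω, ∫⁻ y in totalDomain ε Ω,
        {p : Space n × Space n | dist p.2 p.1 ≤ ε.toReal}.indicator
          (fun p => ENNReal.ofReal ((u p.2 - u p.1) ^ 2)) (x, y))
      ≤ ENNReal.ofReal (max 1 ε.toReal ^ ((n : ℝ) + 2)) * ∫⁻ p in interactionPairs ε Ω,
          ENNReal.ofReal (increment u p ^ 2) ∂jumpMeasure β (totalDomain ε Ω) := by
  have hD := (isOpen_totalDomain hΩ hε).measurableSet
  rw [setLIntegral_jumpMeasure hD hβ (measurableSet_interactionPairs hD)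
    (aemeasurable_ofReal_increment_sq hu), ← lintegral_const_mul' _ _ ENNReal.ofReal_ne_top]
  refine setLIntegral_mono' hD fun x hx => ?_
  rw [← lintegral_const_mul' _ _ ENNReal.ofReal_ne_top]
  refine setLIntegral_mono' hD fun y hy => ?_
  refine indicator_apply_le' (fun hxy => ?_) fun _ => bot_le
  have hE : (x, y) ∈ interactionPairs ε Ω :=
    ⟨hx, hy, by rw [edist_dist]; exact ENNReal.ofReal_le_of_le_toReal hxy⟩
  rw [indicator_of_mem hE, mul_left_comm, ← ENNReal.ofReal_mul (by positivity)]
  rcases eq_or_ne y x with rfl | hyx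
  · simp
  refine le_mul_of_one_le_right bot_le ?_
  rw [ENNReal.one_le_ofReal]
  have hd : 0 < dist y x := dist_pos.2 hyx
  rw [← div_eq_mul_inv, one_le_div (Real.rpow_pos_of_pos hd _)]
  have hs : 0 ≤ (n : ℝ) + 2 * β x := by linarith [(hβS x hx).1, (Nat.cast_nonneg n : (0 : ℝ) ≤ n)]
  refine (Real.rpow_le_rpow hd.le (hxy.trans (le_max_right 1 _)) hs).trans ?_
  exact Real.rpow_le_rpow_of_exponent_le (le_max_left _ _) (by linarith [(hβS x hx).2])

/-- The norm is controlled by the interactions up to the horizon and the `L²(Ω)` norm, with a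
constant that does not depend on the order. -/
lemma exists_energy_le (hΩ : IsOpen Ω) (hΩb : Bornology.IsBounded Ω) (hε : 0 < ε) :
    ∃ G : ℝ, 0 < G ∧ ∀ (β : Space n → ℝ), ContinuousOn β (totalDomain ε Ω) →
      (∀ x ∈ totalDomain ε Ω, 0 ≤ β x ∧ β x ≤ 1) → ∀ c : Constraint, (c = .neumann → ε ≠ ⊤) →
      ∀ u : Space n → ℝ, MemLp u 2 (volume.restrict (totalDomain ε Ω)) →
        constraintFunctional c ε Ω u = 0 →
        (∫⁻ x in totalDomain ε Ω, ENNReal.ofReal (u x ^ 2))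
          + ∫⁻ p, ENNReal.ofReal (increment u p ^ 2) ∂jumpMeasure β (totalDomain ε Ω)
        ≤ ENNReal.ofReal G * ((∫⁻ p in interactionPairs ε Ω,
            ENNReal.ofReal (increment u p ^ 2) ∂jumpMeasure β (totalDomain ε Ω))
          + ∫⁻ x in Ω, ENNReal.ofReal (u x ^ 2)) := by
  have hD := (isOpen_totalDomain hΩ hε).measurableSet
  have hsplit : ∀ (β : Space n → ℝ) (u : Space n → ℝ),
      ∫⁻ p, ENNReal.ofReal (increment u p ^ 2) ∂jumpMeasure β (totalDomain ε Ω)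
        ≤ (∫⁻ p in interactionPairs ε Ω, ENNReal.ofReal (increment u p ^ 2)
            ∂jumpMeasure β (totalDomain ε Ω))
          + ∫⁻ p in {p | ε < edist p.2 p.1}, ENNReal.ofReal (increment u p ^ 2)
            ∂jumpMeasure β (totalDomain ε Ω) := by
    intro β u
    refine le_trans ?_ (lintegral_union_le _ _ _)
    rw [Measure.restrict_eq_self_of_ae_mem]
    refine jumpMeasure_absolutelyContinuous.ae_le ?_
    filter_upwards [ae_mem_prod hD] with p hp
    by_cases h : edist p.2 p.1 ≤ ε
    · exact Or.inl ⟨hp.1, hp.2, h⟩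
    · exact Or.inr (not_le.1 h)
  rcases eq_or_ne ε ⊤ with rfl | hε'
  -- With infinite horizon only the Dirichlet case remains. All pairs interact and u vanishes
  -- outside Ω, so nothing has to be estimated.
  · refine ⟨1, one_pos, fun β hβ hβS c hc u hu hcu => ?_⟩
    have hcd : c = .dirichlet := by
      cases c
      · rfl
      · exact absurd rfl (hc rfl)
    subst hcd
    rw [lintegral_totalDomain_of_dirichlet hΩ hε ((dirichlet_iff hu).1 hcu), ENNReal.ofReal_one,
      one_mul, add_comm]
    refine add_le_add ((hsplit β u).trans (le_of_eq ?_)) le_rfl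
    simp
  · obtain ⟨C, hC, hCu⟩ := exists_lintegral_sq_totalDomain_le hΩ hΩb hε hε'
    set δ := ε.toReal with hδ
    have hδ0 : 0 < δ := ENNReal.toReal_pos hε.ne' hε'
    set K := ENNReal.ofReal (max 1 δ ^ ((n : ℝ) + 2)) with hK
    have hK1 : 1 ≤ K := by
      rw [hK, ENNReal.one_le_ofReal]
      exact Real.one_le_rpow (le_max_left _ _) (by positivity)
    set A : ℝ≥0∞ := ENNReal.ofReal (((1 + δ) / δ) ^ ((n : ℝ) + 2)) * volume (totalDomain ε Ω) with hA
    have hAt : A ≠ ⊤ := ENNReal.mul_ne_top ENNReal.ofReal_ne_top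
      (isBounded_totalDomain hΩ hΩb hε hε').measure_lt_top.ne
    set G : ℝ≥0∞ := (1 + 4 * A) * (C * K) + 1 with hG
    have hGt : G ≠ ⊤ := by
      refine ENNReal.add_ne_top.2 ⟨ENNReal.mul_ne_top (ENNReal.add_ne_top.2 ⟨by simp,
        ENNReal.mul_ne_top (by norm_num) hAt⟩) (ENNReal.mul_ne_top hC ENNReal.ofReal_ne_top), by simp⟩
    have hG0 : G ≠ 0 := by simp [hG]
    refine ⟨G.toReal, ENNReal.toReal_pos hG0 hGt, fun β hβ hβS c hc u hu hcu => ?_⟩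
    rw [ENNReal.ofReal_toReal hGt]
    have hum := hu.1.aemeasurable
    have h1 := hCu u hum
    have h2 := lintegral_near_increment_le hΩ hε hβ hβS hum
    -- For σ = 0 the majorant is constant and its integral is governed by the finite volume of Ω̃.
    -- The bound therefore does not depend on how close the order is to 0.
    have h3 := lintegral_far_increment_le hD hβ hδ0 (σ := 0) le_rfl
      (fun x hx => ⟨by linarith [(hβS x hx).1, (Nat.cast_nonneg n : (0 : ℝ) ≤ n)], (hβS x hx).2⟩)
      (A := A) (fun x => by simp [hA]) hum
    have h4 : {p : Space n × Space n | ε < edist p.2 p.1} = {p | δ < dist p.2 p.1} := by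
      ext p
      simp only [mem_ofPred_eq, edist_dist]
      rw [ENNReal.lt_ofReal_iff_toReal_lt hε']
    have h5 := hsplit β u
    rw [h4] at h5
    set Q := ∫⁻ p in interactionPairs ε Ω,
            ENNReal.ofReal (increment u p ^ 2) ∂jumpMeasure β (totalDomain ε Ω)
    set m := ∫⁻ x in Ω, ENNReal.ofReal (u x ^ 2)
    set V := ∫⁻ x in totalDomain ε Ω, ENNReal.ofReal (u x ^ 2)
    have h6 : V ≤ C * K * (Q + m) := by
      refine h1.trans ?_
      rw [mul_assoc]
      refine mul_le_mul' le_rfl ?_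
      rw [mul_add]
      exact add_le_add h2 (le_mul_of_one_le_left bot_le hK1)
    calc _ ≤ V + (Q + 4 * A * V) := add_le_add le_rfl (h5.trans (add_le_add le_rfl h3))
      _ = (1 + 4 * A) * V + Q := by ring
      _ ≤ (1 + 4 * A) * (C * K * (Q + m)) + (Q + m) :=
          add_le_add (mul_le_mul' le_rfl h6) le_self_add
      _ = G * (Q + m) := by rw [hG]; ring

end Geometry

/-! ### The nonlocal form on the energy space -/

section NonlocalFormula

variable {n : ℕ} {ε : ℝ≥0∞} {Ω : Set (Space n)} {T : ℝ}
  {a : ℝ → Space n → Space n → Matrix (Fin n) (Fin n) ℝ} {aLow aUp : ℝ} {β : Space n → ℝ}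

lemma dotProduct_smul_mulVec_smul (A : Matrix (Fin n) (Fin n) ℝ) (r s : ℝ) (ξ η : Space n) :
    (r • ξ).ofLp ⬝ᵥ (A *ᵥ (s • η).ofLp) = r * s * (ξ.ofLp ⬝ᵥ (A *ᵥ η.ofLp)) := by
  rw [WithLp.ofLp_smul, WithLp.ofLp_smul, Matrix.mulVec_smul, smul_dotProduct, dotProduct_smul,
    smul_eq_mul, smul_eq_mul]
  ring

lemma dotProduct_mulVec_self (A : Matrix (Fin n) (Fin n) ℝ) (ξ : Space n) :
    ξ.ofLp ⬝ᵥ (A *ᵥ ξ.ofLp) = ∑ i, ∑ j, A i j * ξ i * ξ j := by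
  simp only [dotProduct, Matrix.mulVec, Finset.mul_sum]
  exact Finset.sum_congr rfl fun i _ => Finset.sum_congr rfl fun j _ => by ring

lemma Dstar_dotProduct (t : ℝ) (u φ : Space n → ℝ) (x y : Space n) :
    (Dstar β ε u x y).ofLp ⬝ᵥ (a t x y *ᵥ (Dstar β ε φ x y).ofLp)
      = increment u (x, y) * increment φ (x, y) * gamma β ε a t x y := by
  rw [Dstar, Dstar, dotProduct_smul_mulVec_smul, gamma]
  simp only [increment]
  ring

/-- Each factor α is the unit direction times |y − x|^(−n/2−β(x)), and the two powers multiply to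
the kernel. On the diagonal both sides are 0. -/
lemma gamma_eq {t : ℝ} (ht : t ∈ Icc 0 T) {x y : Space n} (hx : x ∈ totalDomain ε Ω)
    (hy : y ∈ totalDomain ε Ω) :
    gamma β ε a t x y
      = tensorWeight ε Ω T a t (x, y) * jumpKernel β (totalDomain ε Ω) (x, y) := by
  by_cases h : edist y x ≤ ε
  · have hE : (x, y) ∈ interactionPairs ε Ω := ⟨hx, hy, h⟩
    rw [tensorWeight, indicator_of_mem hE, ← dotProduct_mulVec_self, clampTime_of_mem ht, gamma,
      alpha, if_pos h, jumpKernel, indicator_of_mem (show (x, y).1 ∈ totalDomain ε Ω from hx),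
      direction, dotProduct_smul_mulVec_smul, dotProduct_smul_mulVec_smul]
    rcases eq_or_ne y x with rfl | hyx
    · simp
    · have hd : 0 < dist y x := dist_pos.2 hyx
      have e1 : dist y x ^ ((n : ℝ) / 2 + β x + 1) = dist y x ^ ((n : ℝ) / 2 + β x) * dist y x := by
        rw [Real.rpow_add hd, Real.rpow_one]
      have e2 : dist y x ^ ((n : ℝ) + 2 * β x)
          = dist y x ^ ((n : ℝ) / 2 + β x) * dist y x ^ ((n : ℝ) / 2 + β x) := by
        rw [← Real.rpow_add hd]; congr 1; ring
      simp only []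
      rw [e1, e2, mul_inv, mul_inv]
      ring
  · have hE : (x, y) ∉ interactionPairs ε Ω := fun hE => h hE.2.2
    rw [tensorWeight, indicator_of_notMem hE, gamma, alpha, if_neg h]
    simp

lemma integral_jumpMeasure {S : Set (Space n)} (hS : MeasurableSet S) (hβ : ContinuousOn β S)
    {g : Space n × Space n → ℝ} (hg : Integrable g (jumpMeasure β S)) :
    Integrable (fun p => jumpKernel β S p * g p) ((volume.restrict S).prod (volume.restrict S)) ∧
    ∫ p, g p ∂jumpMeasure β S = ∫ x in S, ∫ y in S, jumpKernel β S (x, y) * g (x, y) := by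
  have hk := (measurable_jumpKernel hS hβ).ennreal_ofReal
  have hlt : ∀ᵐ p ∂(volume.restrict S).prod (volume.restrict S),
      ENNReal.ofReal (jumpKernel β S p) < ⊤ := ae_of_all _ fun _ => ENNReal.ofReal_lt_top
  have h1 : Integrable (fun p => jumpKernel β S p * g p)
      ((volume.restrict S).prod (volume.restrict S)) := by
    have := (integrable_withDensity_iff_integrable_smul' hk hlt).1 hg
    simpa only [ENNReal.toReal_ofReal (jumpKernel_nonneg _), smul_eq_mul] using this
  refine ⟨h1, ?_⟩
  rw [jumpMeasure, integral_withDensity_eq_integral_toReal_smul hk hlt]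
  simp only [ENNReal.toReal_ofReal (jumpKernel_nonneg _), smul_eq_mul]
  exact integral_prod _ h1

lemma nonlocalForm_eq (ha : AdmissibleTensor ε Ω T a aLow aUp) (hT : 0 < T)
    (hD : MeasurableSet (totalDomain ε Ω)) (hβ : ContinuousOn β (totalDomain ε Ω)) {t : ℝ}
    (ht : t ∈ Icc 0 T) {u φ : Space n → ℝ} (hu : MemSobolev β (totalDomain ε Ω) u)
    (hφ : MemSobolev β (totalDomain ε Ω) φ) :
    nonlocalForm β ε Ω a t u φ = ∫ p, tensorWeight ε Ω T a t p * (increment u p * increment φ p)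
      ∂jumpMeasure β (totalDomain ε Ω) := by
  rw [(integral_jumpMeasure hD hβ (integrable_weight_mul (measurable_tensorWeight ha hT hD t)
    (abs_tensorWeight_le ha hT t) ((memSobolev_iff hD hβ).1 hu).2
    ((memSobolev_iff hD hβ).1 hφ).2)).2, nonlocalForm]
  refine setIntegral_congr_fun hD fun x hx => setIntegral_congr_fun hD fun y hy => ?_
  simp only [Dstar_dotProduct, gamma_eq ht hx hy]
  ring

end NonlocalFormula

/-! ### Forms and horizon energy on the energy space -/

section EnergyForms

variable {n : ℕ} {ε : ℝ≥0∞} {Ω P : Set (Space n)} {T : ℝ}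
  {a : ℝ → Space n → Space n → Matrix (Fin n) (Fin n) ℝ} {aLow aUp : ℝ} {β : Space n → ℝ}
  {C : Submodule ℝ (Lp ℝ 2 (volume.restrict (totalDomain ε Ω)))} {c : Constraint}

lemma ae_jumpMeasure {S : Set (Space n)} {q : Space n → Prop}
    (h : ∀ᵐ x ∂(volume.restrict S), q x) : ∀ᵐ p ∂jumpMeasure β S, q p.1 ∧ q p.2 := by
  refine jumpMeasure_absolutelyContinuous.ae_le ?_
  filter_upwards [(Measure.quasiMeasurePreserving_fst (μ := volume.restrict S)
    (ν := volume.restrict S)).ae h, (Measure.quasiMeasurePreserving_snd (μ := volume.restrict S)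
    (ν := volume.restrict S)).ae h] with p h1 h2
  exact ⟨h1, h2⟩

/-- The form on the energy space with the given weight. -/
def energyForm (β : Space n → ℝ) (S : Set (Space n)) (C : Submodule ℝ (Lp ℝ 2 (volume.restrict S)))
    {κ : Space n × Space n → ℝ} {r : ℝ} (hκ : Measurable κ) (hr : ∀ z, |κ z| ≤ r) :
    EnergySpace β S C →L[ℝ] EnergySpace β S C →L[ℝ] ℝ :=
  (weightForm (jumpMeasure β S) κ hκ hr).bilinearComp (energySnd β S C) (energySnd β S C)

lemma energyForm_apply {S : Set (Space n)} {C : Submodule ℝ (Lp ℝ 2 (volume.restrict S))}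
    {κ : Space n × Space n → ℝ} {r : ℝ} (hκ : Measurable κ) (hr : ∀ z, |κ z| ≤ r)
    (x y : EnergySpace β S C) : energyForm β S C hκ hr x y
      = weightForm (jumpMeasure β S) κ hκ hr (energySnd β S C x) (energySnd β S C y) := rfl

lemma norm_energySnd_le {S : Set (Space n)} {C : Submodule ℝ (Lp ℝ 2 (volume.restrict S))}
    (x : EnergySpace β S C) : ‖energySnd β S C x‖ ≤ ‖x‖ := by
  refine abs_le_of_sq_le_sq' ?_ (norm_nonneg _) |>.2
  rw [energySpace_norm_sq]
  exact le_add_of_nonneg_left (sq_nonneg _)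

lemma norm_bilinearComp_energySnd_le {S : Set (Space n)}
    {C : Submodule ℝ (Lp ℝ 2 (volume.restrict S))}
    (B : Lp ℝ 2 (jumpMeasure β S) →L[ℝ] Lp ℝ 2 (jumpMeasure β S) →L[ℝ] ℝ) :
    ‖B.bilinearComp (energySnd β S C) (energySnd β S C)‖ ≤ ‖B‖ := by
  refine ContinuousLinearMap.opNorm_le_bound₂ _ (norm_nonneg B) fun x y => ?_
  refine (B.le_opNorm₂ _ _).trans ?_
  gcongr
  · exact norm_energySnd_le x
  · exact norm_energySnd_le y

/-- The energy of the interactions up to the horizon. -/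
def horizonEnergy (β : Space n → ℝ) (ε : ℝ≥0∞) (Ω : Set (Space n))
    (C : Submodule ℝ (Lp ℝ 2 (volume.restrict (totalDomain ε Ω))))
    (x : EnergySpace β (totalDomain ε Ω) C) : ℝ :=
  ∫ p in interactionPairs ε Ω, energySnd β _ C x p ^ 2 ∂jumpMeasure β (totalDomain ε Ω)

lemma horizonEnergy_nonneg (x : EnergySpace β (totalDomain ε Ω) C) :
    0 ≤ horizonEnergy β ε Ω C x := integral_nonneg fun _ => sq_nonneg _

lemma weightForm_indicator_const {Z : Type*} [MeasurableSpace Z] {μ : Measure Z} {E : Set Z}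
    (hE : MeasurableSet E) {r d : ℝ} (hκ : Measurable (E.indicator fun _ => r))
    (hr : ∀ z, |E.indicator (fun _ => r) z| ≤ d) (f : Lp ℝ 2 μ) :
    weightForm μ _ hκ hr f f = r * ∫ z in E, f z ^ 2 ∂μ := by
  rw [weightForm_apply, ← integral_const_mul, ← integral_indicator hE]
  refine integral_congr_ae (ae_of_all _ fun z => ?_)
  by_cases hz : z ∈ E
  · simp [hz, sq]
  · simp [hz]

lemma abs_indicator_const_le {Z : Type*} (E : Set Z) (r : ℝ) (z : Z) :
    |E.indicator (fun _ => r) z| ≤ |r| := by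
  by_cases hz : z ∈ E
  · simp [hz]
  · simp [hz]

lemma continuous_horizonEnergy (hD : MeasurableSet (totalDomain ε Ω)) :
    Continuous (horizonEnergy β ε Ω C) := by
  have hE := measurableSet_interactionPairs hD
  have h : horizonEnergy β ε Ω C = fun x =>
      energyForm β _ C (measurable_const.indicator hE) (abs_indicator_const_le _ 1) x x := by
    funext x
    rw [energyForm_apply, weightForm_indicator_const hE, one_mul]
    rfl
  rw [h]
  fun_prop

/-- The form of the diffusion tensor on the energy space. -/
def diffusionForm (ha : AdmissibleTensor ε Ω T a aLow aUp) (hT : 0 < T)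
    (hD : MeasurableSet (totalDomain ε Ω)) (β : Space n → ℝ)
    (C : Submodule ℝ (Lp ℝ 2 (volume.restrict (totalDomain ε Ω)))) (t : ℝ) :
    EnergySpace β (totalDomain ε Ω) C →L[ℝ] EnergySpace β (totalDomain ε Ω) C →L[ℝ] ℝ :=
  energyForm β _ C (measurable_tensorWeight ha hT hD t) (abs_tensorWeight_le ha hT t)

lemma diffusionForm_eq_nonlocalForm (ha : AdmissibleTensor ε Ω T a aLow aUp) (hT : 0 < T)
    (hD : MeasurableSet (totalDomain ε Ω)) (hβ : ContinuousOn β (totalDomain ε Ω)) {t : ℝ}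
    (ht : t ∈ Icc 0 T) {u φ : Space n → ℝ} {x y : EnergySpace β (totalDomain ε Ω) C}
    (hu : energyFst β _ C x =ᵐ[volume.restrict (totalDomain ε Ω)] u)
    (hφ : energyFst β _ C y =ᵐ[volume.restrict (totalDomain ε Ω)] φ) :
    diffusionForm ha hT hD β C t x y = nonlocalForm β ε Ω a t u φ := by
  have h1 := (energySnd_ae_eq x).trans (increment_congr hu)
  have h2 := (energySnd_ae_eq y).trans (increment_congr hφ)
  have hu' : MemSobolev β (totalDomain ε Ω) u := (memSobolev_iff hD hβ).2
    ⟨(memLp_congr_ae hu).1 (Lp.memLp _), (memLp_congr_ae h1).1 (Lp.memLp _)⟩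
  have hφ' : MemSobolev β (totalDomain ε Ω) φ := (memSobolev_iff hD hβ).2
    ⟨(memLp_congr_ae hφ).1 (Lp.memLp _), (memLp_congr_ae h2).1 (Lp.memLp _)⟩
  rw [nonlocalForm_eq ha hT hD hβ ht hu' hφ']
  rw [diffusionForm, energyForm_apply, weightForm_apply]
  refine integral_congr_ae ?_
  filter_upwards [h1, h2] with p e1 e2
  rw [e1, e2]

/-- Lets the lower ellipticity bound be used although `direction` is 0, not a unit vector, on the
diagonal. -/
lemma ae_ne_of_energySnd_ne_zero {S : Set (Space n)} {C : Submodule ℝ (Lp ℝ 2 (volume.restrict S))}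
    (x : EnergySpace β S C) :
    ∀ᵐ p ∂jumpMeasure β S, energySnd β S C x p ≠ 0 → p.2 ≠ p.1 := by
  filter_upwards [energySnd_ae_eq x] with p hp h0 h
  rw [hp, increment, h, sub_self] at h0
  exact h0 rfl

lemma le_diffusionForm (ha : AdmissibleTensor ε Ω T a aLow aUp) (hT : 0 < T)
    (hD : MeasurableSet (totalDomain ε Ω)) (t : ℝ) (x : EnergySpace β (totalDomain ε Ω) C) :
    aLow * horizonEnergy β ε Ω C x ≤ diffusionForm ha hT hD β C t x x := by
  have hE := measurableSet_interactionPairs hD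
  rw [horizonEnergy, ← weightForm_indicator_const hE (measurable_const.indicator hE)
    (abs_indicator_const_le _ aLow)]
  refine weightForm_self_le _ _ (measurable_tensorWeight ha hT hD t)
    (abs_tensorWeight_le ha hT t) _ ?_
  filter_upwards [ae_ne_of_energySnd_ne_zero x] with p hp h0
  exact le_tensorWeight ha hT t (hp h0)

lemma diffusionForm_le (ha : AdmissibleTensor ε Ω T a aLow aUp) (hT : 0 < T)
    (hD : MeasurableSet (totalDomain ε Ω)) (t : ℝ) (x : EnergySpace β (totalDomain ε Ω) C) :
    diffusionForm ha hT hD β C t x x ≤ |aUp| * horizonEnergy β ε Ω C x := by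
  have hE := measurableSet_interactionPairs hD
  rw [horizonEnergy, ← weightForm_indicator_const hE (measurable_const.indicator hE)
    (abs_indicator_const_le _ |aUp|)]
  exact weightForm_self_le (measurable_tensorWeight ha hT hD t)
    (abs_tensorWeight_le ha hT t) _ _ _ (ae_of_all _ fun p _ => tensorWeight_le ha hT t p)

lemma diffusionForm_sub_le (ha : AdmissibleTensor ε Ω T a aLow aUp) (hT : 0 < T)
    (hD : MeasurableSet (totalDomain ε Ω)) {s t : ℝ} (hst : s ≤ t)
    (x : EnergySpace β (totalDomain ε Ω) C) :
    diffusionForm ha hT hD β C t x x - diffusionForm ha hT hD β C s x x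
      ≤ (t - s) * (|aUp| * horizonEnergy β ε Ω C x) := by
  have hE := measurableSet_interactionPairs hD
  set f := energySnd β _ C x
  have h1 := integrable_weight_mul (measurable_tensorWeight ha hT hD t) (abs_tensorWeight_le ha hT t)
    (Lp.memLp f) (Lp.memLp f)
  have h2 := integrable_weight_mul (measurable_tensorWeight ha hT hD s) (abs_tensorWeight_le ha hT s)
    (Lp.memLp f) (Lp.memLp f)
  have h3 := integrable_weight_mul (c := |(|aUp|)|) (measurable_const.indicator hE)
    (abs_indicator_const_le (interactionPairs ε Ω) |aUp|) (Lp.memLp f) (Lp.memLp f)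
  have h4 := weightForm_indicator_const hE (measurable_const.indicator hE)
    (abs_indicator_const_le _ |aUp|) f
  rw [weightForm_apply] at h4
  rw [horizonEnergy, ← h4, ← integral_const_mul, diffusionForm, diffusionForm, energyForm_apply,
    energyForm_apply, weightForm_apply, weightForm_apply, ← integral_sub h1 h2]
  refine integral_mono (h1.sub h2) (h3.const_mul _) fun p => ?_
  have := mul_le_mul_of_nonneg_right (tensorWeight_sub_le ha hT hst p) (mul_self_nonneg (f p))
  refine le_trans (le_of_eq ?_) (this.trans (le_of_eq ?_))
  · simp only
    ring
  · ring

/-- The restriction from `L²(S)` to `L²(P)`. -/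
abbrev restrictTo (S P : Set (Space n)) :
    Lp ℝ 2 (volume.restrict S) →L[ℝ] Lp ℝ 2 ((volume.restrict S).restrict P) :=
  LpToLpRestrictCLM (Space n) ℝ ℝ (volume.restrict S) 2 P

lemma ofReal_norm_sq_restrictTo {S P : Set (Space n)} (hPS : P ⊆ S)
    (y : Lp ℝ 2 (volume.restrict S)) :
    ENNReal.ofReal (‖restrictTo S P y‖ ^ 2) = ∫⁻ x in P, ENNReal.ofReal (y x ^ 2) := by
  rw [ofReal_norm_sq_Lp]
  refine Eq.trans (lintegral_congr_ae ?_)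
    (by rw [Measure.restrict_restrict_of_subset hPS])
  filter_upwards [LpToLpRestrictCLM_coeFn (𝕜 := ℝ) P y] with x hx
  rw [hx]

/-- The Hilbert space form of `exists_energy_le`. G is fixed before the order, the constraint and
the set P; the independence of the final estimate from β rests on this. -/
lemma exists_norm_sq_le_horizonEnergy (hΩ : IsOpen Ω) (hΩb : Bornology.IsBounded Ω) (hε : 0 < ε) :
    ∃ G : ℝ, 0 < G ∧ ∀ (β : Space n → ℝ), ContinuousOn β (totalDomain ε Ω) →
      (∀ x ∈ totalDomain ε Ω, 0 ≤ β x ∧ β x ≤ 1) → ∀ c : Constraint, (c = .neumann → ε ≠ ⊤) →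
      ∀ C : Submodule ℝ (Lp ℝ 2 (volume.restrict (totalDomain ε Ω))),
        (∀ y ∈ C, constraintFunctional c ε Ω y = 0) →
      ∀ P : Set (Space n), Ω ⊆ P → P ⊆ totalDomain ε Ω →
      ∀ x : EnergySpace β (totalDomain ε Ω) C, ‖x‖ ^ 2 ≤ G * (horizonEnergy β ε Ω C x
        + ‖restrictTo (totalDomain ε Ω) P (energyFst β _ C x)‖ ^ 2) := by
  obtain ⟨G, hG0, hG⟩ := exists_energy_le hΩ hΩb hε
  refine ⟨G, hG0, fun β hβ hβS c hc C hC P hΩP hPD x => ?_⟩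
  have hinc : ∀ F : Set (Space n × Space n),
      ∫⁻ p in F, ENNReal.ofReal (increment (energyFst β _ C x) p ^ 2)
        ∂jumpMeasure β (totalDomain ε Ω)
      = ∫⁻ p in F, ENNReal.ofReal (energySnd β _ C x p ^ 2)
        ∂jumpMeasure β (totalDomain ε Ω) := fun F => by
    refine lintegral_congr_ae (ae_restrict_of_ae ?_)
    filter_upwards [energySnd_ae_eq x] with p hp
    rw [hp]
  have h := hG β hβ hβS c hc _ (Lp.memLp (energyFst β _ C x)) (hC _ (energyFst_mem x))
  have hinc' := hinc univ
  rw [setLIntegral_univ, setLIntegral_univ] at hinc'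
  rw [hinc, hinc', ← ofReal_norm_sq_Lp,
    ← ofReal_norm_sq_Lp, ← ofReal_setIntegral_sq_Lp, ← ENNReal.ofReal_add (sq_nonneg _) (sq_nonneg _),
    ← energySpace_norm_sq] at h
  have h' := h.trans (mul_le_mul' le_rfl (add_le_add le_rfl (lintegral_mono_set hΩP)))
  rw [← ofReal_norm_sq_restrictTo hPD, ← ENNReal.ofReal_add (integral_nonneg fun _ => sq_nonneg _)
    (sq_nonneg _), ← ENNReal.ofReal_mul hG0.le] at h'
  exact (ENNReal.ofReal_le_ofReal_iff (mul_nonneg hG0.le (add_nonneg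
    (integral_nonneg fun _ => sq_nonneg _) (sq_nonneg _)))).1 h'

end EnergyForms

/-! ### The splitting of the diffusion form -/

section Splitting

variable {n : ℕ} {ε : ℝ≥0∞} {Ω P : Set (Space n)} {T : ℝ}
  {a : ℝ → Space n → Space n → Matrix (Fin n) (Fin n) ℝ} {aLow aUp : ℝ} {β : Space n → ℝ}
  {C : Submodule ℝ (Lp ℝ 2 (volume.restrict (totalDomain ε Ω)))} {c : Constraint}

lemma norm_energyFst_le_of_dirichlet (hΩ : IsOpen Ω) (hε : 0 < ε) (hΩP : Ω ⊆ P)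
    (hPD : P ⊆ totalDomain ε Ω) (hC : ∀ y ∈ C, constraintFunctional .dirichlet ε Ω y = 0)
    (x : EnergySpace β (totalDomain ε Ω) C) :
    ‖energyFst β _ C x‖ ≤ ‖restrictTo (totalDomain ε Ω) P (energyFst β _ C x)‖ := by
  have h := (dirichlet_iff (Lp.memLp _)).1 (hC _ (energyFst_mem x))
  have h1 := lintegral_totalDomain_of_dirichlet hΩ hε h
  rw [← ofReal_norm_sq_Lp] at h1
  have h2 := h1.le.trans (lintegral_mono_set hΩP)
  rw [← ofReal_norm_sq_restrictTo hPD, ENNReal.ofReal_le_ofReal_iff (sq_nonneg _)] at h2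
  exact (abs_le_of_sq_le_sq' h2 (norm_nonneg _)).2

/-- If one point of a pair at distance at most 1/2 lies outside the ball of radius ρ, then both lie
outside the ball of radius ρ − 1, hence outside Ω, where the function vanishes. -/
lemma ae_far_of_dirichlet (hΩ : IsOpen Ω) (hε : 0 < ε)
    (hC : ∀ y ∈ C, constraintFunctional .dirichlet ε Ω y = 0) {ρ : ℝ}
    (hρ : Ω ⊆ Metric.closedBall 0 (ρ - 1)) (x : EnergySpace β (totalDomain ε Ω) C) :
    ∀ᵐ p ∂jumpMeasure β (totalDomain ε Ω), ¬ (1 / 2 < dist p.2 p.1) →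
      p ∉ Metric.closedBall (0 : Space n) ρ ×ˢ Metric.closedBall (0 : Space n) ρ →
      energySnd β _ C x p = 0 := by
  have h0 : ∀ᵐ y ∂volume.restrict (totalDomain ε Ω), y ∉ Ω → energyFst β _ C x y = 0 := by
    have h := (dirichlet_iff (Lp.memLp _)).1 (hC _ (energyFst_mem x))
    rw [EventuallyEq, ae_restrict_iff' (measurableSet_interactionDomain hΩ hε)] at h
    rw [ae_restrict_iff' (isOpen_totalDomain hΩ hε).measurableSet]
    filter_upwards [h] with y hy hyD hyΩ
    exact hy (hyD.resolve_left hyΩ)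
  filter_upwards [energySnd_ae_eq x, ae_jumpMeasure h0] with p hp h1 hfar hball
  have hb : ∀ y z : Space n, y ∉ Metric.closedBall (0 : Space n) ρ → dist z y ≤ 1 / 2 →
      z ∉ Ω := by
    intro y z hy hz hzΩ
    apply hy
    have := hρ hzΩ
    rw [Metric.mem_closedBall] at this ⊢
    linarith [dist_triangle y z 0, dist_comm y z]
  have hd := not_lt.1 hfar
  rw [hp, increment]
  rw [mem_prod, not_and_or] at hball
  rcases hball with h | h
  · rw [h1.1 (hb _ _ h (by simp)), h1.2 (hb _ _ h hd), sub_zero]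
  · rw [h1.2 (hb _ _ h (by simp)), h1.1 (hb _ _ h (by rwa [dist_comm])), sub_zero]

/-- The diffusion form satisfies the assumptions of the abstract theory. -/
lemma exists_splitForm (hΩ : IsOpen Ω) (hΩb : Bornology.IsBounded Ω) (hε : 0 < ε) (hT : 0 < T)
    (ha : AdmissibleTensor ε Ω T a aLow aUp) (hD : MeasurableSet (totalDomain ε Ω))
    (hβ : ContinuousOn β (totalDomain ε Ω)) {b : ℝ} (hb : 0 < b)
    (hβS : ∀ x ∈ totalDomain ε Ω, b ≤ β x ∧ β x ≤ 1) (hc : c = .neumann → ε ≠ ⊤)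
    (hC : ∀ y ∈ C, constraintFunctional c ε Ω y = 0) (hΩP : Ω ⊆ P) (hPD : P ⊆ totalDomain ε Ω) :
    ∃ (N M : ℝ → EnergySpace β (totalDomain ε Ω) C →L[ℝ]
        EnergySpace β (totalDomain ε Ω) C →L[ℝ] ℝ) (K Λ c₀ c₁ : ℝ),
      SplitForm (restrictTo (totalDomain ε Ω) P ∘L energyFst β _ C) N M K Λ c₀ c₁ ∧
      ∀ t x y, N t x y + M t x y = diffusionForm ha hT hD β C t x y := by
  -- The margin 1 around Ω exceeds the threshold 1/2 used for far pairs. In the Neumann case the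
  -- ball also contains all of Ω̃, so that M vanishes.
  obtain ⟨ρ, hρ1, hρ2⟩ : ∃ ρ : ℝ, Ω ⊆ Metric.closedBall 0 (ρ - 1) ∧
      (c = .neumann → totalDomain ε Ω ⊆ Metric.closedBall 0 ρ) := by
    obtain ⟨r, hr⟩ := hΩb.subset_closedBall 0
    by_cases h : c = .neumann
    · obtain ⟨r', hr'⟩ := (isBounded_totalDomain hΩ hΩb hε (hc h)).subset_closedBall 0
      exact ⟨max (r + 1) r', hr.trans (Metric.closedBall_subset_closedBall
        (by linarith [le_max_left (r + 1) r'])), fun _ => hr'.trans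
        (Metric.closedBall_subset_closedBall (le_max_right _ _))⟩
    · exact ⟨r + 1, by simpa using hr, fun h' => absurd h' h⟩
  set B := Metric.closedBall (0 : Space n) ρ ×ˢ Metric.closedBall (0 : Space n) ρ with hB
  have hBm : MeasurableSet B := (Metric.isClosed_closedBall.prod Metric.isClosed_closedBall).measurableSet
  obtain ⟨K, hK0, hK⟩ := exists_lipschitz_tensorWeight ha hT ρ
  obtain ⟨A, hA, hAu⟩ := exists_lintegral_far_increment_le hD hβ hb hβS (by norm_num : (0 : ℝ) < 1 / 2)
  obtain ⟨G, hG0, hG⟩ := exists_norm_sq_le_horizonEnergy hΩ hΩb hε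
  have hw0 := tensorWeight_nonneg ha hT
  have hwb := abs_tensorWeight_le ha hT
  have hwm := measurable_tensorWeight ha hT hD
  have hind : ∀ (E : Set (Space n × Space n)) t p,
      |E.indicator (tensorWeight ε Ω T a t) p| ≤ |aUp| := fun E t p => by
    by_cases hp : p ∈ E
    · simpa [hp] using hwb t p
    · simp [hp]
  set N : ℝ → EnergySpace β (totalDomain ε Ω) C →L[ℝ] EnergySpace β (totalDomain ε Ω) C →L[ℝ] ℝ :=
    fun t => energyForm β _ C ((hwm t).indicator hBm) (hind B t) with hN
  set M : ℝ → EnergySpace β (totalDomain ε Ω) C →L[ℝ] EnergySpace β (totalDomain ε Ω) C →L[ℝ] ℝ :=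
    fun t => energyForm β _ C ((hwm t).indicator hBm.compl) (hind Bᶜ t) with hM
  have hsum : ∀ t x y, N t x y + M t x y = diffusionForm ha hT hD β C t x y := by
    intro t x y
    refine (weightForm_add ((hwm t).indicator hBm) (hind B t) ((hwm t).indicator hBm.compl)
      (hind Bᶜ t) (hwm t) (hwb t) (fun p => ?_) _ _).symm
    exact (congrFun (indicator_self_add_compl B (tensorWeight ε Ω T a t)) p).symm
  set J := restrictTo (totalDomain ε Ω) P ∘L energyFst β _ C with hJ
  have hMbound : ∀ t x y, |M t x y| ≤ |aUp| * A.toReal * ‖J x‖ * ‖J y‖ := by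
    intro t x y
    cases c with
    | dirichlet =>
      have hF := measurableSet_lt_dist (n := n) (1 / 2)
      have hz : ∀ x : EnergySpace β (totalDomain ε Ω) C, ∀ᵐ p ∂jumpMeasure β (totalDomain ε Ω),
          p ∉ {p : Space n × Space n | 1 / 2 < dist p.2 p.1} →
          Bᶜ.indicator (tensorWeight ε Ω T a t) p * energySnd β _ C x p = 0 := by
        intro x
        filter_upwards [ae_far_of_dirichlet hΩ hε hC hρ1 x] with p hp hfar
        by_cases hpB : p ∈ B
        · simp [hpB]
        · rw [hp hfar hpB, mul_zero]
      have hs : ∀ x : EnergySpace β (totalDomain ε Ω) C,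
          Real.sqrt (∫ p in {p : Space n × Space n | 1 / 2 < dist p.2 p.1},
            energySnd β _ C x p ^ 2 ∂jumpMeasure β (totalDomain ε Ω))
          ≤ Real.sqrt A.toReal * ‖J x‖ := by
        intro x
        refine le_trans ?_ (mul_le_mul_of_nonneg_left
          (norm_energyFst_le_of_dirichlet hΩ hε hΩP hPD hC x) (Real.sqrt_nonneg _))
        rw [Real.sqrt_le_left (by positivity), mul_pow, Real.sq_sqrt ENNReal.toReal_nonneg,
          ← ENNReal.ofReal_le_ofReal_iff (by positivity), ofReal_setIntegral_sq_Lp,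
          ENNReal.ofReal_mul ENNReal.toReal_nonneg, ENNReal.ofReal_toReal hA, ofReal_norm_sq_Lp]
        refine le_trans (le_of_eq ?_) (hAu _ (Lp.aestronglyMeasurable _).aemeasurable)
        refine lintegral_congr_ae (ae_restrict_of_ae ?_)
        filter_upwards [energySnd_ae_eq x] with p hp
        rw [hp]
      refine (abs_weightForm_le_of_ae ((hwm t).indicator hBm.compl) (hind Bᶜ t) hF (abs_nonneg _)
        _ _ (hz x) (hz y)).trans ?_
      calc _ ≤ |aUp| * (Real.sqrt A.toReal * ‖J x‖) * (Real.sqrt A.toReal * ‖J y‖) := by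
            gcongr
            · exact hs x
            · exact hs y
        _ = |aUp| * (Real.sqrt A.toReal * Real.sqrt A.toReal) * ‖J x‖ * ‖J y‖ := by ring
        _ = _ := by rw [Real.mul_self_sqrt ENNReal.toReal_nonneg]
    | neumann =>
      have hz : ∀ p, |Bᶜ.indicator (tensorWeight ε Ω T a t) p| ≤ 0 := by
        intro p
        by_cases hp : p ∈ interactionPairs ε Ω
        · have : p ∈ B := ⟨hρ2 rfl hp.1, hρ2 rfl hp.2.1⟩
          simp [this]
        · have : tensorWeight ε Ω T a t p = 0 := by rw [tensorWeight, indicator_of_notMem hp]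
          by_cases hpB : p ∈ B <;> simp [hpB, this]
      have h0 := abs_integral_weight_mul_le le_rfl hz (energySnd β _ C x) (energySnd β _ C y)
      simp only [zero_mul] at h0
      exact h0.trans (by positivity)
  have hN0 : ∀ t x, 0 ≤ N t x x := fun t x =>
    weightForm_self_nonneg ((hwm t).indicator hBm) (hind B t)
      (indicator_nonneg fun p _ => hw0 t p) _
  -- Coercivity of N: the horizon energy is at most (N + M)/aLow, and M is moved to the L² side by
  -- its bound. The constant A depends on the lower bound of the order, which is harmless because
  -- these constants are used only qualitatively.
  refine ⟨N, M, K, |aUp| * A.toReal, G * (1 / aLow + |aUp| * A.toReal / aLow + 1), |aUp|,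
    ?_, hsum⟩
  constructor
  · exact fun t x y => weightForm_comm ((hwm t).indicator hBm) (hind B t) _ _
  · exact fun t x y => weightForm_comm ((hwm t).indicator hBm.compl) (hind Bᶜ t) _ _
  · exact hN0
  · exact fun t x => weightForm_self_nonneg ((hwm t).indicator hBm.compl) (hind Bᶜ t)
      (indicator_nonneg fun p _ => hw0 t p) _
  · intro s t
    have h : N t - N s = (weightForm (jumpMeasure β (totalDomain ε Ω)) _ ((hwm t).indicator hBm)
        (hind B t) - weightForm _ _ ((hwm s).indicator hBm) (hind B s)).bilinearComp
          (energySnd β _ C) (energySnd β _ C) := rfl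
    rw [h]
    refine (norm_bilinearComp_energySnd_le _).trans (norm_weightForm_sub_le ((hwm t).indicator hBm)
      (hind B t) ((hwm s).indicator hBm) (hind B s)
      (mul_nonneg hK0 (abs_nonneg _)) fun p => ?_)
    by_cases hp : p ∈ B
    · rw [indicator_of_mem hp, indicator_of_mem hp]
      exact hK s t p hp
    · rw [indicator_of_notMem hp, indicator_of_notMem hp, sub_zero, abs_zero]
      exact mul_nonneg hK0 (abs_nonneg _)
  · intro t
    exact (norm_bilinearComp_energySnd_le _).trans
      (norm_weightForm_le ((hwm t).indicator hBm) (hind B t) (abs_nonneg _) (hind B t))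
  · exact hMbound
  · intro x y
    refine continuous_weightForm (fun t => (hwm t).indicator hBm.compl) (hind Bᶜ) (fun p => ?_) _ _
    by_cases hp : p ∈ B
    · simp only [indicator_of_notMem (show p ∉ Bᶜ from fun h => h hp)]
      exact continuous_const
    · simp only [indicator_of_mem (show p ∈ Bᶜ from hp)]
      exact continuous_tensorWeight ha hT p
  · intro t x
    have h1 := hG β hβ (fun x hx => ⟨hb.le.trans (hβS x hx).1, (hβS x hx).2⟩) c hc C hC P hΩP hPD x
    have h2 := le_diffusionForm ha hT hD (β := β) t x
    rw [← hsum] at h2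
    have h3 := (le_abs_self _).trans (hMbound t x x)
    have h4 : horizonEnergy β ε Ω C x
        ≤ (N t x x + |aUp| * A.toReal * ‖J x‖ * ‖J x‖) / aLow := by
      rw [le_div_iff₀ ha.low_pos]
      linarith
    have h5 := hN0 t x
    have hl := ha.low_pos
    calc ‖x‖ ^ 2 ≤ G * (horizonEnergy β ε Ω C x + ‖J x‖ ^ 2) := h1
      _ ≤ G * ((N t x x + |aUp| * A.toReal * ‖J x‖ * ‖J x‖) / aLow + ‖J x‖ ^ 2) := by gcongr
      _ = G * (1 / aLow * N t x x + (|aUp| * A.toReal / aLow + 1) * ‖J x‖ ^ 2) := by ring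
      _ ≤ G * ((1 / aLow + |aUp| * A.toReal / aLow + 1) * N t x x
            + (1 / aLow + |aUp| * A.toReal / aLow + 1) * ‖J x‖ ^ 2) := by
          have e1 : 0 ≤ |aUp| * A.toReal / aLow := by positivity
          have e2 : 0 ≤ 1 / aLow := by positivity
          gcongr <;> linarith
      _ = _ := by ring
  · exact hK0
  · positivity
  · have := ha.low_pos
    positivity

end Splitting

/-! ### The principal value -/

section PrincipalValue

variable {n : ℕ} {ε : ℝ≥0∞} {Ω : Set (Space n)} {T : ℝ}
  {a : ℝ → Space n → Space n → Matrix (Fin n) (Fin n) ℝ} {aLow aUp : ℝ} {β : Space n → ℝ}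

/-- The kernel has uniformly bounded mass away from the diagonal, so φ(x) alone is square integrable
there. This allows the increment of φ to be split into φ(y) and φ(x), which near the diagonal would
diverge. -/
lemma memLp_far_fst {S : Set (Space n)} (hS : MeasurableSet S) (hβ : ContinuousOn β S) {b δ : ℝ}
    (hb : 0 < b) (hβS : ∀ x ∈ S, b ≤ β x ∧ β x ≤ 1) (hδ : 0 < δ) {φ : Space n → ℝ}
    (hφ : MemLp φ 2 (volume.restrict S)) :
    MemLp ({p : Space n × Space n | δ < dist p.2 p.1}.indicator fun p => φ p.1) 2
      (jumpMeasure β S) := by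
  have hm : AEStronglyMeasurable (fun p : Space n × Space n => φ p.1)
      ((volume.restrict S).prod (volume.restrict S)) := hφ.1.comp_fst
  refine ⟨(hm.mono_ac jumpMeasure_absolutelyContinuous).indicator (measurableSet_lt_dist δ), ?_⟩
  set c := ((1 + δ) / δ) ^ ((n : ℝ) + 2) with hc
  have hc0 : 0 ≤ c := by positivity
  set A := ENNReal.ofReal c * ∫⁻ x : Space n, ENNReal.ofReal ((1 + ‖x‖) ^ (-((n : ℝ) + 2 * b)))
  have hA : A ≠ ⊤ := ENNReal.mul_ne_top ENNReal.ofReal_ne_top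
    (lintegral_tail_lt_top (by linarith)).ne
  have key : eLpNorm ({p : Space n × Space n | δ < dist p.2 p.1}.indicator fun p => φ p.1) 2
      (jumpMeasure β S) ^ 2 < ⊤ := by
    rw [lintegral_ofReal_sq_eq]
    have h0 : ∀ p, ENNReal.ofReal ({p : Space n × Space n | δ < dist p.2 p.1}.indicator
        (fun p => φ p.1) p ^ 2) = {p : Space n × Space n | δ < dist p.2 p.1}.indicator
        (fun p => ENNReal.ofReal (φ p.1 ^ 2)) p := by
      intro p
      by_cases hp : p ∈ {p : Space n × Space n | δ < dist p.2 p.1}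
      · rw [indicator_of_mem hp, indicator_of_mem hp]
      · rw [indicator_of_notMem hp, indicator_of_notMem hp]; simp
    simp only [h0]
    rw [lintegral_indicator (measurableSet_lt_dist δ), setLIntegral_jumpMeasure hS hβ
      (measurableSet_lt_dist δ) (hm.aemeasurable.pow_const 2).ennreal_ofReal]
    calc _ ≤ ∫⁻ x in S, ∫⁻ y in S, ENNReal.ofReal (φ x ^ 2) *
          (ENNReal.ofReal c * ENNReal.ofReal ((1 + dist x y) ^ (-((n : ℝ) + 2 * b)))) := by
          refine setLIntegral_mono' hS fun x hx => lintegral_mono fun y => ?_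
          by_cases hxy : δ < dist y x
          · rw [indicator_of_mem
              (show (x, y) ∈ {p : Space n × Space n | δ < dist p.2 p.1} from hxy),
              ← ENNReal.ofReal_mul hc0, dist_comm x y]
            exact mul_le_mul' le_rfl (ENNReal.ofReal_le_ofReal (inv_rpow_le_tail hδ
              (by linarith [(hβS x hx).2]) (by linarith [(hβS x hx).1]) (by positivity) hxy))
          · rw [indicator_of_notMem (show (x, y) ∉ {p : Space n × Space n | δ < dist p.2 p.1}
              from hxy), zero_mul]
            exact bot_le
      _ ≤ ∫⁻ x in S, ENNReal.ofReal (φ x ^ 2) * A := by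
          refine lintegral_mono fun x => ?_
          rw [lintegral_const_mul' _ _ ENNReal.ofReal_ne_top,
            lintegral_const_mul' _ _ ENNReal.ofReal_ne_top]
          exact mul_le_mul' le_rfl (mul_le_mul' le_rfl (lintegral_tail_translate _ x S))
      _ < ⊤ := by
          rw [lintegral_mul_const' _ _ hA, ← lintegral_ofReal_sq_eq]
          exact ENNReal.mul_lt_top (ENNReal.pow_lt_top hφ.2) hA.lt_top
  by_contra hn
  rw [not_lt, top_le_iff] at hn
  rw [hn] at key
  simp at key

/-- The usual symmetrization: interchanging x and y in the half of the symmetrized kernel that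
carries γ(t,y,x) replaces φ(x) by −φ(y), and the two halves combine to an increment of φ. -/
lemma setIntegral_truncatedOperator_eq (ha : AdmissibleTensor ε Ω T a aLow aUp) (hΩ : IsOpen Ω)
    (hε : 0 < ε) (hT : 0 < T) (hβ : ContinuousOn β (totalDomain ε Ω)) {b : ℝ} (hb : 0 < b)
    (hβS : ∀ x ∈ totalDomain ε Ω, b ≤ β x ∧ β x ≤ 1) {t : ℝ} (ht : t ∈ Icc 0 T)
    {u φ : Space n → ℝ} (hu : MemSobolev β (totalDomain ε Ω) u)
    (hφ : MemSobolevC .dirichlet β ε Ω φ) {δ : ℝ} (hδ : 0 < δ) :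
    ∫ x in Ω, truncatedOperator β ε Ω a t δ u x * φ x
      = -(1 / 2) * ∫ p, {p : Space n × Space n | δ < dist p.2 p.1}.indicator
        (fun p => tensorWeight ε Ω T a t p * (increment u p * increment φ p)) p
          ∂jumpMeasure β (totalDomain ε Ω) := by
  set D := totalDomain ε Ω with hDdef
  have hD : MeasurableSet D := (isOpen_totalDomain hΩ hε).measurableSet
  set F : Set (Space n × Space n) := {p | δ < dist p.2 p.1} with hF
  have hFm : MeasurableSet F := measurableSet_lt_dist δ
  set κ := tensorWeight ε Ω T a t with hκ
  have hκm := measurable_tensorWeight ha hT hD t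
  have hκb := abs_tensorWeight_le ha hT t
  have hDu := ((memSobolev_iff hD hβ).1 hu).2
  have hDφ := ((memSobolev_iff hD hβ).1 hφ.1).2
  have hφ1 := memLp_far_fst hD hβ hb hβS hδ hφ.1.1
  -- The jump measure is not symmetric, so φ(y) is recovered as increment plus φ(x) rather than by
  -- exchanging the variables.
  have hφ2 : MemLp (F.indicator fun p => φ p.2) 2 (jumpMeasure β D) := by
    refine ((hDφ.indicator hFm).add hφ1).congr_norm ?_ (ae_of_all _ fun p => ?_)
    · exact ((hφ.1.1.1.comp_snd (μ := volume.restrict D)).mono_ac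
        jumpMeasure_absolutelyContinuous).indicator hFm
    · by_cases hp : p ∈ F
      · simp [hp, ← hF, increment]
      · simp [hp, ← hF]
  set g₁ : Space n × Space n → ℝ := fun p => κ p * (increment u p * F.indicator (fun p => φ p.1) p)
    with hg₁
  set g₂ : Space n × Space n → ℝ := fun p => κ p * (increment u p * F.indicator (fun p => φ p.2) p)
    with hg₂
  have hi₁ : Integrable g₁ (jumpMeasure β D) := integrable_weight_mul hκm hκb hDu hφ1
  have hi₂ : Integrable g₂ (jumpMeasure β D) := integrable_weight_mul hκm hκb hDu hφ2
  obtain ⟨hG₁, -⟩ := integral_jumpMeasure hD hβ hi₁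
  obtain ⟨hG₂, -⟩ := integral_jumpMeasure hD hβ hi₂
  set G₁ : Space n × Space n → ℝ := fun p => jumpKernel β D p * g₁ p with hG₁'
  set G₂ : Space n × Space n → ℝ := fun p => jumpKernel β D p * g₂ p with hG₂'
  have step1 : ∫ x in Ω, truncatedOperator β ε Ω a t δ u x * φ x
      = ∫ x in D, truncatedOperator β ε Ω a t δ u x * φ x := by
    symm
    refine setIntegral_eq_of_subset_of_ae_sdiff_eq_zero hD.nullMeasurableSet subset_union_left ?_
    have h := (dirichlet_iff hφ.1.1).1 hφ.2
    rw [EventuallyEq, ae_restrict_iff' (measurableSet_interactionDomain hΩ hε)] at h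
    filter_upwards [h] with y hy hyD
    rw [hy (hyD.1.resolve_left hyD.2), Pi.zero_apply, mul_zero]
  have step2 : ∫ x in D, truncatedOperator β ε Ω a t δ u x * φ x
      = ∫ x in D, ∫ y in D, (1 / 2) * (G₁ (x, y) - G₂ (y, x)) := by
    refine setIntegral_congr_fun hD fun x hx => ?_
    simp only [truncatedOperator]
    have hm : MeasurableSet {y : Space n | δ < dist y x} :=
      measurableSet_lt measurable_const (measurable_id.dist measurable_const)
    rw [← setIntegral_indicator hm, ← integral_mul_const]
    refine setIntegral_congr_fun hD fun y hy => ?_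
    simp only [hG₁', hG₂', hg₁, hg₂]
    by_cases hxy : δ < dist y x
    · have h1 : (x, y) ∈ F := hxy
      have h2 : (y, x) ∈ F := by change δ < dist x y; rwa [dist_comm]
      rw [indicator_of_mem h1, indicator_of_mem h2,
        indicator_of_mem (show y ∈ {y : Space n | δ < dist y x} from hxy), gammaSymm,
        gamma_eq ht hx hy, gamma_eq ht hy hx]
      simp only [increment]
      ring
    · have h1 : (x, y) ∉ F := hxy
      have h2 : (y, x) ∉ F := by change ¬ δ < dist x y; rwa [dist_comm]
      rw [indicator_of_notMem h1, indicator_of_notMem h2,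
        indicator_of_notMem (show y ∉ {y : Space n | δ < dist y x} from hxy)]
      ring
  have step3 : ∫ x in D, ∫ y in D, (1 / 2) * (G₁ (x, y) - G₂ (y, x))
      = (1 / 2) * (∫ p, G₁ p ∂(volume.restrict D).prod (volume.restrict D)
        - ∫ p, G₂ p ∂(volume.restrict D).prod (volume.restrict D)) := by
    have hs : Integrable (fun p : Space n × Space n => G₂ p.swap)
        ((volume.restrict D).prod (volume.restrict D)) := hG₂.swap
    have hs' : ∫ p : Space n × Space n, G₂ p.swap ∂(volume.restrict D).prod (volume.restrict D)
        = ∫ p, G₂ p ∂(volume.restrict D).prod (volume.restrict D) := integral_prod_swap _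
    rw [← hs', ← integral_sub hG₁ hs, ← integral_const_mul]
    exact (integral_prod _ ((hG₁.sub hs).const_mul (1 / 2))).symm
  have e₁ := integral_jumpMeasure hD hβ hi₁
  have e₂ := integral_jumpMeasure hD hβ hi₂
  rw [step1, step2, step3, integral_prod _ hG₁, integral_prod _ hG₂, ← e₁.2, ← e₂.2,
    ← integral_sub hi₁ hi₂, neg_mul, ← mul_neg, ← integral_neg]
  congr 1
  refine integral_congr_ae (ae_of_all _ fun p => ?_)
  simp only [hg₁, hg₂]
  by_cases hp : p ∈ F
  · simp only [indicator_of_mem hp, increment]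
    ring
  · simp only [indicator_of_notMem hp]
    ring

/-- Tested with functions that vanish outside `Ω`, the truncated singular integrals converge to
`-1/2` times the bilinear form. -/
lemma tendsto_truncatedOperator (ha : AdmissibleTensor ε Ω T a aLow aUp) (hΩ : IsOpen Ω)
    (hε : 0 < ε) (hT : 0 < T) (hβ : ContinuousOn β (totalDomain ε Ω)) {b : ℝ} (hb : 0 < b)
    (hβS : ∀ x ∈ totalDomain ε Ω, b ≤ β x ∧ β x ≤ 1) {t : ℝ} (ht : t ∈ Icc 0 T)
    {u φ : Space n → ℝ} (hu : MemSobolev β (totalDomain ε Ω) u)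
    (hφ : MemSobolevC .dirichlet β ε Ω φ) :
    Tendsto (fun δ => ∫ x in Ω, truncatedOperator β ε Ω a t δ u x * φ x) (𝓝[>] 0)
      (𝓝 (-(1 / 2) * nonlocalForm β ε Ω a t u φ)) := by
  have hD : MeasurableSet (totalDomain ε Ω) := (isOpen_totalDomain hΩ hε).measurableSet
  rw [nonlocalForm_eq ha hT hD hβ ht hu hφ.1]
  have hi := integrable_weight_mul (measurable_tensorWeight ha hT hD t) (abs_tensorWeight_le ha hT t)
    ((memSobolev_iff hD hβ).1 hu).2 ((memSobolev_iff hD hβ).1 hφ.1).2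
  have key : Tendsto (fun δ : ℝ => ∫ p, {p : Space n × Space n | δ < dist p.2 p.1}.indicator
      (fun p => tensorWeight ε Ω T a t p * (increment u p * increment φ p)) p
        ∂jumpMeasure β (totalDomain ε Ω)) (𝓝[>] 0)
      (𝓝 (∫ p, tensorWeight ε Ω T a t p * (increment u p * increment φ p)
        ∂jumpMeasure β (totalDomain ε Ω))) := by
    refine tendsto_integral_filter_of_dominated_convergence
      (fun p => ‖tensorWeight ε Ω T a t p * (increment u p * increment φ p)‖)
      (Eventually.of_forall fun δ => hi.aestronglyMeasurable.indicator (measurableSet_lt_dist δ))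
      (Eventually.of_forall fun δ => ae_of_all _ fun p => norm_indicator_le_norm_self _ _)
      hi.norm (ae_of_all _ fun p => ?_)
    rcases eq_or_ne p.2 p.1 with h | h
    · refine tendsto_const_nhds.congr fun δ => ?_
      by_cases hp : p ∈ {p : Space n × Space n | δ < dist p.2 p.1}
      · rw [indicator_of_mem hp]
      · rw [indicator_of_notMem hp, increment, h]; simp
    · refine tendsto_const_nhds.congr' ?_
      filter_upwards [Ioo_mem_nhdsGT (dist_pos.2 h)] with δ hδ
      rw [indicator_of_mem (show p ∈ {p : Space n × Space n | δ < dist p.2 p.1} from hδ.2)]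
  refine (key.const_mul (-(1 / 2))).congr' ?_
  filter_upwards [self_mem_nhdsWithin] with δ hδ
  rw [setIntegral_truncatedOperator_eq ha hΩ hε hT hβ hb hβS ht hu hφ hδ]

end PrincipalValue

/-! ### Functions of time with values in `L²` and their joint versions -/

section Bochner

variable {Z : Type*} [MeasurableSpace Z] {μ : Measure Z} [SFinite μ] {T : ℝ}

lemma ofReal_integral_norm_sq {E : Type*} [NormedAddCommGroup E] {W : ℝ → E} (hT : 0 < T)
    (hW : MemLp W 2 (volume.restrict (Ioo 0 T))) :
    ENNReal.ofReal (∫ t in (0 : ℝ)..T, ‖W t‖ ^ 2) = ∫⁻ t in Ioo 0 T, ENNReal.ofReal (‖W t‖ ^ 2) := by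
  rw [intervalIntegral.integral_of_le hT.le, integral_Ioc_eq_integral_Ioo,
    ofReal_integral_eq_lintegral_ofReal (integrable_norm_sq hW) (ae_of_all _ fun t => sq_nonneg _)]

lemma eLpNorm_uncurry_sq {w : ℝ → Z → ℝ}
    (hw : AEStronglyMeasurable (Function.uncurry w) ((volume.restrict (Ioo 0 T)).prod μ))
    {W : ℝ → Lp ℝ 2 μ} (hW : ∀ᵐ t, t ∈ Ioo 0 T → W t =ᵐ[μ] w t) :
    eLpNorm (Function.uncurry w) 2 ((volume.restrict (Ioo 0 T)).prod μ) ^ 2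
      = ∫⁻ t in Ioo 0 T, ENNReal.ofReal (‖W t‖ ^ 2) := by
  rw [lintegral_ofReal_sq_eq, lintegral_prod _ (hw.aemeasurable.pow_const 2).ennreal_ofReal]
  refine lintegral_congr_ae ?_
  rw [EventuallyEq, ae_restrict_iff' measurableSet_Ioo]
  filter_upwards [hW] with t ht hts
  rw [ofReal_norm_sq_Lp]
  refine lintegral_congr_ae ?_
  filter_upwards [ht hts] with z hz
  rw [hz]
  rfl

lemma memLp_of_lintegral_sq_lt_top {E : Type*} [NormedAddCommGroup E] {α : Type*}
    [MeasurableSpace α] {ν : Measure α} {W : α → E} (hm : AEStronglyMeasurable W ν)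
    (h : ∫⁻ t, ENNReal.ofReal (‖W t‖ ^ 2) ∂ν < ⊤) : MemLp W 2 ν := by
  refine ⟨hm, ?_⟩
  rw [← eLpNorm_norm]
  have h1 := lintegral_ofReal_sq_eq (μ := ν) fun t => ‖W t‖
  rw [← h1] at h
  by_contra hn
  rw [not_lt, top_le_iff] at hn
  rw [hn] at h
  simp at h

/-- A function in `L²((0,T) × Z)` as a function of time with values in `L²(Z)`. -/
lemma exists_bochner [MeasurableSpace.CountablyGenerated Z] {w : ℝ → Z → ℝ}
    (hw : MemLp (Function.uncurry w) 2 ((volume.restrict (Ioo 0 T)).prod μ)) :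
    ∃ W : ℝ → Lp ℝ 2 μ, MemLp W 2 volume ∧ (∀ t, t ∉ Ioo 0 T → W t = 0) ∧
      ∀ᵐ t, t ∈ Ioo 0 T → W t =ᵐ[μ] w t := by
  classical
  have h1 : ∀ᵐ t ∂volume.restrict (Ioo 0 T), MemLp (w t) 2 μ := by
    have h2 : ∫⁻ t in Ioo 0 T, ∫⁻ z, ENNReal.ofReal (w t z ^ 2) ∂μ ≠ ⊤ := by
      have := lintegral_prod (μ := volume.restrict (Ioo 0 T)) (ν := μ) _
        (hw.1.aemeasurable.pow_const 2).ennreal_ofReal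
      rw [← lintegral_ofReal_sq_eq] at this
      refine ne_of_eq_of_ne this.symm (ENNReal.pow_lt_top hw.2).ne
    have h3 := ae_lt_top' ((hw.1.aemeasurable.pow_const 2).ennreal_ofReal.lintegral_prod_right') h2
    filter_upwards [h3, hw.1.prodMk_left] with t ht htm
    refine memLp_of_lintegral_sq_lt_top htm ?_
    simpa using ht
  set W : ℝ → Lp ℝ 2 μ := fun t =>
    if h : t ∈ Ioo 0 T ∧ MemLp (w t) 2 μ then h.2.toLp (w t) else 0 with hWdef
  have h2 : ∀ᵐ t, t ∈ Ioo 0 T → W t =ᵐ[μ] w t := by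
    rw [ae_restrict_iff' measurableSet_Ioo] at h1
    filter_upwards [h1] with t ht hts
    simp only [hWdef, dif_pos (And.intro hts (ht hts))]
    exact (ht hts).coeFn_toLp
  have h0 : ∀ t, t ∉ Ioo 0 T → W t = 0 := fun t ht => dif_neg fun h => ht h.1
  have hm : AEStronglyMeasurable W (volume.restrict (Ioo 0 T)) :=
    aestronglyMeasurable_of_uncurry hw.1 ((ae_restrict_iff' measurableSet_Ioo).2 h2)
  have hWL : MemLp W 2 (volume.restrict (Ioo 0 T)) := by
    refine memLp_of_lintegral_sq_lt_top hm ?_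
    rw [← eLpNorm_uncurry_sq hw.1 h2]
    exact ENNReal.pow_lt_top hw.2
  refine ⟨W, ?_, h0, h2⟩
  have : (Ioo 0 T).indicator W = W := by
    funext t
    by_cases ht : t ∈ Ioo 0 T
    · rw [indicator_of_mem ht]
    · rw [indicator_of_notMem ht, h0 t ht]
  rw [← this]
  exact (memLp_indicator_iff_restrict measurableSet_Ioo).2 hWL

/-- The function `1_{(s,r]}(t) g(z)`. -/
def testFunction (s r : ℝ) (g : Z → ℝ) : ℝ × Z → ℝ :=
  (Ioc s r ×ˢ univ).indicator fun p => g p.2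

lemma memLp_testFunction (s r : ℝ) {g : Z → ℝ} (hg : MemLp g 2 μ) :
    MemLp (testFunction s r g) 2 ((volume.restrict (Ioo 0 T)).prod μ) := by
  have : IsFiniteMeasure ((volume : Measure ℝ).restrict (Ioo 0 T)) := inferInstance
  exact (hg.comp_snd (volume.restrict (Ioo 0 T))).indicator (measurableSet_Ioc.prod .univ)

/-- Products of a time interval and a spatial function are enough to recover the time integrals of
W. They convert weak limits on the cylinder into identities between vector-valued integrals. -/
lemma inner_testFunction {w : ℝ → Z → ℝ}
    (hw : MemLp (Function.uncurry w) 2 ((volume.restrict (Ioo 0 T)).prod μ))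
    {W : ℝ → Lp ℝ 2 μ} (hW : ∀ᵐ t, t ∈ Ioo 0 T → W t =ᵐ[μ] w t) (g : Lp ℝ 2 μ) {s r : ℝ}
    (hs : 0 ≤ s) (hsr : s ≤ r) (hr : r ≤ T) :
    inner ℝ (hw.toLp _) ((memLp_testFunction (T := T) s r (Lp.memLp g)).toLp _)
      = ∫ t in s..r, inner ℝ (W t) g := by
  have hint := (memLp_testFunction (T := T) s r (Lp.memLp g)).integrable_mul hw
  have h1 : inner ℝ (hw.toLp _) ((memLp_testFunction (T := T) s r (Lp.memLp g)).toLp _)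
      = ∫ p, testFunction s r g p * Function.uncurry w p
        ∂((volume.restrict (Ioo 0 T)).prod μ) := by
    rw [L2.inner_def]
    refine integral_congr_ae ?_
    filter_upwards [hw.coeFn_toLp, (memLp_testFunction (T := T) s r (Lp.memLp g)).coeFn_toLp]
      with p e1 e2
    rw [e1, e2]
    rfl
  rw [h1]
  refine (integral_prod _ hint).trans ?_
  have h2 : ∫ t in s..r, inner ℝ (W t) g = ∫ t in Ioo 0 T, (Ioo s r).indicator
      (fun t => inner ℝ (W t) g) t := by
    rw [setIntegral_indicator measurableSet_Ioo, inter_eq_right.2 (Ioo_subset_Ioo hs hr),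
      intervalIntegral.integral_of_le hsr, integral_Ioc_eq_integral_Ioo]
  rw [h2]
  refine integral_congr_ae ?_
  rw [EventuallyEq, ae_restrict_iff' measurableSet_Ioo]
  have hne : ∀ᵐ t : ℝ, t ≠ r := by
    rw [ae_iff]; simp
  filter_upwards [hW, hne] with t ht htr htT
  by_cases hts : t ∈ Ioo s r
  · rw [indicator_of_mem hts, L2.inner_def]
    refine integral_congr_ae ?_
    filter_upwards [ht htT] with z hz
    have : ((t, z) : ℝ × Z) ∈ Ioc s r ×ˢ (univ : Set Z) := ⟨⟨hts.1, hts.2.le⟩, mem_univ _⟩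
    simp only [testFunction, Pi.mul_apply, indicator_of_mem this, Function.uncurry_apply_pair, hz]
    rfl
  · rw [indicator_of_notMem hts]
    have : ∀ z, ((t, z) : ℝ × Z) ∉ Ioc s r ×ˢ (univ : Set Z) := fun z hz =>
      hts ⟨hz.1.1, lt_of_le_of_ne hz.1.2 htr⟩
    simp [testFunction, indicator_of_notMem (this _)]

end Bochner

/-! ### Time derivatives as weak limits of difference quotients -/

section WeakTimeDerivative

lemma tendsto_integral_difference_quotient {E : Type*} [NormedAddCommGroup E] [NormedSpace ℝ E]
    [CompleteSpace E] {G : ℝ → E} (hG : Continuous G) (s r : ℝ) :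
    Tendsto (fun h : ℝ => ∫ t in s..r, h⁻¹ • (G t - G (t - h))) (𝓝[>] 0) (𝓝 (G r - G s)) := by
  have hi : ∀ x y, IntervalIntegrable G volume x y := fun x y => hG.intervalIntegrable _ _
  have hd : ∀ x, Tendsto (fun h : ℝ => h⁻¹ • ∫ t in (x - h)..x, G t) (𝓝[>] 0) (𝓝 (G x)) := by
    intro x
    have h1 : HasDerivAt (fun h : ℝ => ∫ t in (x - h)..x, G t) (G x) 0 := by
      have h2 : HasDerivAt (fun y => ∫ t in y..x, G t) (-G x) (x - 0) := by
        rw [sub_zero]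
        exact intervalIntegral.integral_hasDerivAt_left (hi _ _)
          (hG.stronglyMeasurableAtFilter _ _) hG.continuousAt
      have h3 := h2.scomp (0 : ℝ) ((hasDerivAt_const (0 : ℝ) x).sub (hasDerivAt_id (0 : ℝ)))
      rw [zero_sub, smul_neg, neg_smul, one_smul, neg_neg] at h3
      exact h3
    have h4 := h1.tendsto_slope_zero_right
    simpa using h4
  refine ((hd r).sub (hd s)).congr fun h => ?_
  have h1 : ∫ t in s..r, G (t - h) = ∫ t in (s - h)..(r - h), G t :=
    intervalIntegral.integral_comp_sub_right _ _
  have h2 : IntervalIntegrable (fun t => G (t - h)) volume s r :=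
    Continuous.intervalIntegrable (by fun_prop) _ _
  rw [intervalIntegral.integral_smul, intervalIntegral.integral_sub (hi _ _) h2, h1, ← smul_sub]
  congr 1
  have e1 := intervalIntegral.integral_add_adjacent_intervals (hi (s - h) (r - h)) (hi (r - h) r)
  have e2 := intervalIntegral.integral_add_adjacent_intervals (hi (s - h) s) (hi s r)
  rw [sub_eq_sub_iff_add_eq_add, add_comm, e1, ← e2, add_comm]

variable {Z : Type*} [MeasurableSpace Z] [MeasurableSpace.CountablyGenerated Z] {μ : Measure Z}
  [SFinite μ] {T : ℝ}

/-- The quotients are bounded in L² of the cylinder. Taking the weak limit there, rather than among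
vector-valued functions, provides a jointly measurable w together with W. Testing with 1_(s,r] g,
the integrated quotients telescope to ζ(r) − ζ(s). -/
lemma exists_weak_time_deriv (hT : 0 < T) {ζ : ℝ → Lp ℝ 2 μ} (hζ : Continuous ζ) {F : ℝ → Z → ℝ}
    (hF : AEStronglyMeasurable (Function.uncurry F) ((volume : Measure ℝ).prod μ))
    (hζF : ∀ᵐ t, ζ t =ᵐ[μ] F t) {C : ℝ}
    (hC : ∀ h > 0, ∫ t in (0 : ℝ)..T, ‖h⁻¹ • (ζ t - ζ (t - h))‖ ^ 2 ≤ C) :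
    ∃ (w : ℝ → Z → ℝ) (W : ℝ → Lp ℝ 2 μ),
      MemLp (Function.uncurry w) 2 ((volume.restrict (Ioo 0 T)).prod μ) ∧
      MemLp W 2 volume ∧ (∀ t, t ∉ Ioo 0 T → W t = 0) ∧ (∀ᵐ t, t ∈ Ioo 0 T → W t =ᵐ[μ] w t) ∧
      ∀ s t, 0 ≤ s → s ≤ t → t ≤ T → ζ t - ζ s = ∫ τ in s..t, W τ := by
  set ν := (volume.restrict (Ioo 0 T)).prod μ with hν
  set q : ℝ → ℝ → Z → ℝ := fun h t z => h⁻¹ * (F t z - F (t - h) z) with hq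
  set Q : ℝ → ℝ → Lp ℝ 2 μ := fun h t => h⁻¹ • (ζ t - ζ (t - h)) with hQ
  have hQc : ∀ h, Continuous (Q h) := fun h => by
    simp only [hQ]; fun_prop
  have hac : ν ≪ (volume : Measure ℝ).prod μ :=
    Measure.AbsolutelyContinuous.prod Measure.restrict_le_self.absolutelyContinuous .rfl
  have hqm : ∀ h, AEStronglyMeasurable (Function.uncurry (q h)) ν := by
    intro h
    refine AEStronglyMeasurable.mono_ac hac ?_
    have hmp : MeasurePreserving (fun p : ℝ × Z => (p.1 - h, p.2)) ((volume : Measure ℝ).prod μ)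
        ((volume : Measure ℝ).prod μ) :=
      (measurePreserving_sub_right volume h).prod (MeasurePreserving.id μ)
    exact (hF.sub (hF.comp_measurePreserving hmp)).const_mul h⁻¹
  have hqQ : ∀ h, ∀ᵐ t, t ∈ Ioo 0 T → Q h t =ᵐ[μ] q h t := by
    intro h
    have h1 : ∀ᵐ t, ζ (t - h) =ᵐ[μ] F (t - h) :=
      (measurePreserving_sub_right volume h).quasiMeasurePreserving.ae hζF
    filter_upwards [hζF, h1] with t e1 e2 _
    filter_upwards [e1, e2, Lp.coeFn_smul h⁻¹ (ζ t - ζ (t - h)), Lp.coeFn_sub (ζ t) (ζ (t - h))]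
      with z a1 a2 a3 a4
    simp only [hQ, hq]
    rw [a3, Pi.smul_apply, a4, Pi.sub_apply, a1, a2, smul_eq_mul]
  have hQL : ∀ h, MemLp (Q h) 2 (volume.restrict (Ioo 0 T)) := fun h => by
    obtain ⟨c, hc⟩ := (isCompact_Icc (a := (0 : ℝ)) (b := T)).exists_bound_of_continuousOn
      (hQc h).continuousOn
    exact MemLp.of_bound (hQc h).aestronglyMeasurable c ((ae_restrict_iff' measurableSet_Ioo).2
      (ae_of_all _ fun t ht => hc t (Ioo_subset_Icc_self ht)))
  have hqL : ∀ h, MemLp (Function.uncurry (q h)) 2 ν := by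
    intro h
    refine ⟨hqm h, ?_⟩
    have h1 := eLpNorm_uncurry_sq (hqm h) (hqQ h)
    rw [← ofReal_integral_norm_sq hT (hQL h)] at h1
    by_contra hn
    rw [not_lt, top_le_iff] at hn
    rw [hn] at h1
    simp at h1
  have hqb : ∀ h > 0, ‖(hqL h).toLp _‖ ≤ Real.sqrt C := by
    intro h hh
    refine Real.le_sqrt_of_sq_le ?_
    have h1 := eLpNorm_uncurry_sq (hqm h) (hqQ h)
    rw [← ofReal_integral_norm_sq hT (hQL h)] at h1
    have h2 : ENNReal.ofReal (‖(hqL h).toLp _‖ ^ 2) = ENNReal.ofReal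
        (∫ t in (0 : ℝ)..T, ‖Q h t‖ ^ 2) := by
      rw [← h1, ENNReal.ofReal_pow (norm_nonneg _), Lp.norm_toLp, ENNReal.ofReal_toReal (hqL h).2.ne]
    have h3 : 0 ≤ ∫ t in (0 : ℝ)..T, ‖Q h t‖ ^ 2 :=
      intervalIntegral.integral_nonneg hT.le fun t _ => sq_nonneg _
    rw [ENNReal.ofReal_eq_ofReal_iff (sq_nonneg _) h3] at h2
    rw [h2]
    exact hC h hh
  set U : Ultrafilter ℝ := Ultrafilter.of (𝓝[>] 0) with hU
  have hU0 : (U : Filter ℝ) ≤ 𝓝[>] 0 := Ultrafilter.of_le _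
  obtain ⟨y, -, hy⟩ := exists_weak_limit U (x := fun h => (hqL h).toLp _) (C := Real.sqrt C)
    (hU0 (by filter_upwards [self_mem_nhdsWithin] with h hh using hqb h hh))
  set w : ℝ → Z → ℝ := fun t z => y (t, z) with hw
  have hwL : MemLp (Function.uncurry w) 2 ν := Lp.memLp y
  obtain ⟨W, hWL, hW0, hWw⟩ := exists_bochner hwL
  refine ⟨w, W, hwL, hWL, hW0, hWw, fun s r hs hsr hr => ?_⟩
  refine ext_inner_right ℝ fun g => ?_
  have h1 := hy ((memLp_testFunction (T := T) s r (Lp.memLp g)).toLp _)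
  have h2 : inner ℝ y ((memLp_testFunction (T := T) s r (Lp.memLp g)).toLp _)
      = ∫ t in s..r, inner ℝ (W t) g := by
    rw [← inner_testFunction hwL hWw g hs hsr hr]
    congr 1
    exact (Lp.toLp_coeFn y _).symm
  rw [h2] at h1
  simp only [inner_testFunction (hqL _) (hqQ _) g hs hsr hr] at h1
  have h3 := tendsto_integral_difference_quotient (G := fun t => inner ℝ (ζ t) g)
    (by fun_prop) s r
  have h4 : Tendsto (fun h => ∫ t in s..r, inner ℝ (Q h t) g) (𝓝[>] 0)
      (𝓝 (inner ℝ (ζ r) g - inner ℝ (ζ s) g)) := by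
    refine h3.congr fun h => intervalIntegral.integral_congr fun t _ => ?_
    simp only [hQ, inner_smul_left, inner_sub_left]
    rfl
  have h5 := tendsto_nhds_unique h1 (h4.mono_left hU0)
  rw [inner_sub_left, ← h5]
  have hWi := intervalIntegrable_of_memLp_two hWL s r
  have h6 := ((innerSL ℝ g).intervalIntegral_comp_comm hWi)
  simp only [innerSL_apply_apply] at h6
  rw [real_inner_comm, ← h6]
  exact intervalIntegral.integral_congr fun t _ => real_inner_comm _ _

end WeakTimeDerivative

/-! ### Weak solutions as abstract solutions -/

section EnergyBochner

variable {n : ℕ} {β : Space n → ℝ} {S : Set (Space n)}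
  {C : Submodule ℝ (Lp ℝ 2 (volume.restrict S))} {T : ℝ}

lemma norm_energySpace_le (x : EnergySpace β S C) :
    ‖x‖ ≤ ‖energyFst β S C x‖ + ‖energySnd β S C x‖ := by
  refine (abs_le_of_sq_le_sq' ?_ (by positivity)).2
  rw [energySpace_norm_sq]
  nlinarith [norm_nonneg (energyFst β S C x), norm_nonneg (energySnd β S C x)]

lemma norm_energyFst_le (x : EnergySpace β S C) : ‖energyFst β S C x‖ ≤ ‖x‖ := by
  refine (abs_le_of_sq_le_sq' ?_ (norm_nonneg _)).2
  rw [energySpace_norm_sq]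
  exact le_add_of_nonneg_right (sq_nonneg _)

lemma sobolevNorm_energyFst_le (hS : MeasurableSet S) (hβ : ContinuousOn β S)
    (x : EnergySpace β S C) :
    sobolevNorm β S (energyFst β S C x) ≤ ENNReal.ofReal (2 * ‖x‖) := by
  rw [sobolevNorm_energyFst hS hβ]
  refine ENNReal.ofReal_le_ofReal ?_
  linarith [norm_energyFst_le x, norm_energySnd_le x]

lemma le_sobolevNorm_energyFst (hS : MeasurableSet S) (hβ : ContinuousOn β S)
    (x : EnergySpace β S C) :
    ENNReal.ofReal ‖x‖ ≤ sobolevNorm β S (energyFst β S C x) := by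
  rw [sobolevNorm_energyFst hS hβ]
  exact ENNReal.ofReal_le_ofReal (norm_energySpace_le x)

lemma sobolevNorm_congr (hS : MeasurableSet S) (hβ : ContinuousOn β S) {u v : Space n → ℝ}
    (hu : AEStronglyMeasurable u (volume.restrict S)) (h : u =ᵐ[volume.restrict S] v) :
    sobolevNorm β S u = sobolevNorm β S v := by
  rw [sobolevNorm_eq hS hβ hu, sobolevNorm_eq hS hβ (hu.congr h), eLpNorm_congr_ae h,
    eLpNorm_congr_ae (increment_congr h)]

lemma memSobolev_congr (hS : MeasurableSet S) (hβ : ContinuousOn β S) {u v : Space n → ℝ}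
    (h : u =ᵐ[volume.restrict S] v) (hu : MemSobolev β S u) : MemSobolev β S v := by
  rw [memSobolev_iff hS hβ] at hu ⊢
  exact ⟨(memLp_congr_ae h).1 hu.1, (memLp_congr_ae (increment_congr h)).1 hu.2⟩

/-- The two components embed the energy space in the product of the two L² spaces, where
measurability is checked for each separately. -/
lemma aestronglyMeasurable_energySpace {α : Type*} [MeasurableSpace α] {ν : Measure α}
    {u : α → EnergySpace β S C} (h₁ : AEStronglyMeasurable (fun t => energyFst β S C (u t)) ν)
    (h₂ : AEStronglyMeasurable (fun t => energySnd β S C (u t)) ν) : AEStronglyMeasurable u ν := by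
  set j := (energyFst β S C).prod (energySnd β S C) with hj
  have hanti : AntilipschitzWith 2 j := by
    refine AddMonoidHomClass.antilipschitz_of_bound j fun x => ?_
    refine (norm_energySpace_le x).trans ?_
    have h1 : ‖energyFst β S C x‖ ≤ ‖j x‖ := norm_fst_le (j x)
    have h2 : ‖energySnd β S C x‖ ≤ ‖j x‖ := norm_snd_le (j x)
    push_cast
    linarith
  have hemb : Topology.IsEmbedding j :=
    (hanti.isUniformEmbedding j.uniformContinuous).isEmbedding
  exact hemb.aestronglyMeasurable_comp_iff.1 (h₁.prodMk h₂)

lemma aestronglyMeasurable_uncurry_increment {ν : Measure ℝ} [SFinite ν] {u : ℝ → Space n → ℝ}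
    (hu : AEStronglyMeasurable (Function.uncurry u) (ν.prod (volume.restrict S))) :
    AEStronglyMeasurable (Function.uncurry fun t => increment (u t))
      (ν.prod (jumpMeasure β S)) := by
  have hac : ν.prod (jumpMeasure β S)
      ≪ ν.prod ((volume.restrict S).prod (volume.restrict S)) :=
    Measure.AbsolutelyContinuous.prod .rfl jumpMeasure_absolutelyContinuous
  refine AEStronglyMeasurable.mono_ac hac ?_
  have h1 := hu.comp_quasiMeasurePreserving (QuasiMeasurePreserving.prodMap (Measure.QuasiMeasurePreserving.id ν)
    (Measure.quasiMeasurePreserving_fst (μ := volume.restrict S) (ν := volume.restrict S)))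
  have h2 := hu.comp_quasiMeasurePreserving (QuasiMeasurePreserving.prodMap (Measure.QuasiMeasurePreserving.id ν)
    (Measure.quasiMeasurePreserving_snd (μ := volume.restrict S) (ν := volume.restrict S)))
  exact h2.sub h1

end EnergyBochner

/-! ### Lifting weak solutions to the energy space -/

section WeakSolution

variable {n : ℕ} {ε : ℝ≥0∞} {Ω P : Set (Space n)} {T : ℝ}
  {a : ℝ → Space n → Space n → Matrix (Fin n) (Fin n) ℝ} {aLow aUp : ℝ} {β : Space n → ℝ}
  {C : Submodule ℝ (Lp ℝ 2 (volume.restrict (totalDomain ε Ω)))} {c : Constraint}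

lemma toLp_mem (hC : ∀ y, y ∈ C ↔ constraintFunctional c ε Ω y = 0) {u : Space n → ℝ}
    (hu : MemSobolevC c β ε Ω u) : hu.1.1.toLp u ∈ C := by
  rw [hC, constraintFunctional_congr c hu.1.1.coeFn_toLp]
  exact hu.2

lemma memSobolevC_energyFst (hD : MeasurableSet (totalDomain ε Ω))
    (hβ : ContinuousOn β (totalDomain ε Ω))
    (hC : ∀ y, y ∈ C ↔ constraintFunctional c ε Ω y = 0)
    (x : EnergySpace β (totalDomain ε Ω) C) : MemSobolevC c β ε Ω (energyFst β _ C x) :=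
  ⟨memSobolev_energyFst hD hβ x, (hC _).1 (energyFst_mem x)⟩

lemma exists_energy_bochner (hD : MeasurableSet (totalDomain ε Ω))
    (hβ : ContinuousOn β (totalDomain ε Ω))
    (hC : ∀ y, y ∈ C ↔ constraintFunctional c ε Ω y = 0) {u : ℝ → Space n → ℝ}
    (hu : MemL2Sobolev c β ε Ω T u) :
    ∃ U : ℝ → EnergySpace β (totalDomain ε Ω) C, MemLp U 2 volume ∧ (∀ t, t ∉ Ioo 0 T → U t = 0) ∧
      ∀ᵐ t, t ∈ Ioo 0 T → energyFst β _ C (U t) =ᵐ[volume.restrict (totalDomain ε Ω)] u t := by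
  classical
  obtain ⟨hum, huc, hub⟩ := hu
  set U : ℝ → EnergySpace β (totalDomain ε Ω) C := fun t =>
    if h : t ∈ Ioo 0 T ∧ MemSobolevC c β ε Ω (u t) then
      toEnergySpace hD hβ h.2.1 (toLp_mem hC h.2) else 0 with hU
  have h0 : ∀ t, t ∉ Ioo 0 T → U t = 0 := fun t ht => dif_neg fun h => ht h.1
  have h1 : ∀ᵐ t ∂volume.restrict (Ioo 0 T),
      energyFst β _ C (U t) =ᵐ[volume.restrict (totalDomain ε Ω)] u t := by
    rw [ae_restrict_iff' measurableSet_Ioo] at huc ⊢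
    filter_upwards [huc] with t ht hts
    simp only [hU, dif_pos (And.intro hts (ht hts)), energyFst_toEnergySpace]
    exact (ht hts).1.1.coeFn_toLp
  have h2 : ∀ᵐ t ∂volume.restrict (Ioo 0 T),
      energySnd β _ C (U t) =ᵐ[jumpMeasure β (totalDomain ε Ω)] increment (u t) := by
    filter_upwards [h1] with t ht
    exact (energySnd_ae_eq (U t)).trans (increment_congr ht)
  have hm : AEStronglyMeasurable U (volume.restrict (Ioo 0 T)) :=
    aestronglyMeasurable_energySpace (aestronglyMeasurable_of_uncurry hum h1)
      (aestronglyMeasurable_of_uncurry (aestronglyMeasurable_uncurry_increment hum) h2)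
  have hL : MemLp U 2 (volume.restrict (Ioo 0 T)) := by
    refine memLp_of_lintegral_sq_lt_top hm (lt_of_le_of_lt (lintegral_mono_ae ?_) hub)
    filter_upwards [h1] with t ht
    rw [ENNReal.ofReal_pow (norm_nonneg _), ← sobolevNorm_congr hD hβ (Lp.aestronglyMeasurable _) ht]
    exact pow_le_pow_left' (le_sobolevNorm_energyFst hD hβ _) 2
  refine ⟨U, ?_, h0, (ae_restrict_iff' measurableSet_Ioo).1 h1⟩
  have : (Ioo 0 T).indicator U = U := by
    funext t
    by_cases ht : t ∈ Ioo 0 T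
    · rw [indicator_of_mem ht]
    · rw [indicator_of_notMem ht, h0 t ht]
  rw [← this]
  exact (memLp_indicator_iff_restrict measurableSet_Ioo).2 hL

lemma inner_Lp_eq {Z : Type*} [MeasurableSpace Z] {μ : Measure Z} {f g : Lp ℝ 2 μ} {f' g' : Z → ℝ}
    (hf : f =ᵐ[μ] f') (hg : g =ᵐ[μ] g') : inner ℝ f g = ∫ z, f' z * g' z ∂μ := by
  rw [L2.inner_def]
  refine integral_congr_ae ?_
  filter_upwards [hf, hg] with z h1 h2
  rw [h1, h2]
  exact mul_comm _ _

lemma restrictTo_ae_eq {S P : Set (Space n)} {y : Lp ℝ 2 (volume.restrict S)} {u : Space n → ℝ}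
    (h : y =ᵐ[volume.restrict S] u) :
    restrictTo S P y =ᵐ[(volume.restrict S).restrict P] u :=
  (LpToLpRestrictCLM_coeFn ℝ P y).trans (ae_restrict_of_ae h)

lemma HasWeakDeriv.congr {g g' d d' : ℝ → ℝ} (h : HasWeakDeriv T g d)
    (hg : ∀ᵐ t, t ∈ Ioo 0 T → g t = g' t) (hd : ∀ᵐ t, t ∈ Ioo 0 T → d t = d' t) :
    HasWeakDeriv T g' d' := by
  have hg' : g =ᵐ[volume.restrict (Ioo 0 T)] g' := (ae_restrict_iff' measurableSet_Ioo).2 hg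
  have hd' : d =ᵐ[volume.restrict (Ioo 0 T)] d' := (ae_restrict_iff' measurableSet_Ioo).2 hd
  refine ⟨h.1.congr hg', h.2.1.congr hd', fun ψ h1 h2 h3 => ?_⟩
  have e1 : ∫ t in Ioo 0 T, g' t * deriv ψ t = ∫ t in Ioo 0 T, g t * deriv ψ t :=
    integral_congr_ae (hg'.mono fun t ht => by simp only [ht])
  have e2 : ∫ t in Ioo 0 T, d' t * ψ t = ∫ t in Ioo 0 T, d t * ψ t :=
    integral_congr_ae (hd'.mono fun t ht => by simp only [ht])
  rw [e1, e2]
  exact h.2.2 ψ h1 h2 h3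

lemma cylinder_restrict (hPD : P ⊆ totalDomain ε Ω) :
    (volume.restrict (Ioo 0 T)).prod ((volume.restrict (totalDomain ε Ω)).restrict P)
      = cylinder T P := by
  rw [Measure.restrict_restrict_of_subset hPD, cylinder]

lemma exists_continuous_version {u : ℝ → Space n → ℝ} {u₀ : Space n → ℝ} {S : Set (Space n)}
    (h : HasInitialValue T S u u₀) (hT : 0 < T) :
    ∃ z : ℝ → Lp ℝ 2 (volume.restrict S), ContinuousOn z (Icc 0 T) ∧
      (∀ᵐ t, t ∈ Ioo 0 T → z t =ᵐ[volume.restrict S] u t) ∧ z 0 =ᵐ[volume.restrict S] u₀ := by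
  classical
  obtain ⟨v, hvu, hvL, hvc, hv0⟩ := h
  set z : ℝ → Lp ℝ 2 (volume.restrict S) := fun t =>
    if h : t ∈ Icc 0 T then (hvL t h).toLp (v t) else 0 with hz
  have hzv : ∀ t (ht : t ∈ Icc 0 T), z t = (hvL t ht).toLp (v t) := fun t ht => dif_pos ht
  refine ⟨z, fun s hs => ?_, ?_, ?_⟩
  · rw [ContinuousWithinAt, tendsto_iff_edist_tendsto_0]
    refine (hvc s hs).congr' ?_
    filter_upwards [self_mem_nhdsWithin] with t ht
    rw [hzv t ht, hzv s hs, Lp.edist_toLp_toLp]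
  · rw [IsVersion, ae_restrict_iff' measurableSet_Ioo] at hvu
    filter_upwards [hvu] with t ht hts
    rw [hzv t (Ioo_subset_Icc_self hts)]
    exact (hvL t (Ioo_subset_Icc_self hts)).coeFn_toLp.trans (ht hts)
  · rw [hzv 0 ⟨le_rfl, hT.le⟩]
    exact (hvL 0 ⟨le_rfl, hT.le⟩).coeFn_toLp.trans hv0

/-- The pivot space is L²(P), which covers both readings of the weak formulation. When P = Ω the
time derivative is seen on Ω only; initial value and continuity are then still carried by z in
L²(Ω̃). -/
lemma IsWeakSolution.exists_abstractSolution (ha : AdmissibleTensor ε Ω T a aLow aUp)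
    (hD : MeasurableSet (totalDomain ε Ω)) (hβ : ContinuousOn β (totalDomain ε Ω)) (hT : 0 < T)
    (hC : ∀ y, y ∈ C ↔ constraintFunctional c ε Ω y = 0) (hPD : P ⊆ totalDomain ε Ω)
    {u₀ : Space n → ℝ} {f u : ℝ → Space n → ℝ} (hu₀ : MemSobolevC c β ε Ω u₀)
    (hf : MemLp (Function.uncurry f) 2 (cylinder T (totalDomain ε Ω)))
    (hu : IsWeakSolution c β ε Ω P T a f u₀ u)
    {N M : ℝ → EnergySpace β (totalDomain ε Ω) C →L[ℝ] EnergySpace β (totalDomain ε Ω) C →L[ℝ] ℝ}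
    (hNM : ∀ t x y, N t x y + M t x y = diffusionForm ha hT hD β C t x y) :
    ∃ (F : ℝ → Lp ℝ 2 ((volume.restrict (totalDomain ε Ω)).restrict P))
      (U : ℝ → EnergySpace β (totalDomain ε Ω) C) (z : ℝ → Lp ℝ 2 (volume.restrict (totalDomain ε Ω)))
      (U₀ : EnergySpace β (totalDomain ε Ω) C),
      IsAbstractSolution (energyFst β _ C) (restrictTo (totalDomain ε Ω) P) N M T F U₀ U z ∧
      energyFst β _ C U₀ =ᵐ[volume.restrict (totalDomain ε Ω)] u₀ ∧
      (∀ᵐ t, t ∈ Ioo 0 T → energyFst β _ C (U t) =ᵐ[volume.restrict (totalDomain ε Ω)] u t) ∧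
      (∀ᵐ t, t ∈ Ioo 0 T → F t =ᵐ[(volume.restrict (totalDomain ε Ω)).restrict P] f t) ∧
      ∀ t, t ∉ Ioo 0 T → F t = 0 := by
  obtain ⟨U, hUL, hU0, hUu⟩ := exists_energy_bochner hD hβ hC hu.memL2
  obtain ⟨z, hzc, hzu, hz0⟩ := exists_continuous_version hu.initial hT
  have hfP : MemLp (Function.uncurry f) 2 ((volume.restrict (Ioo 0 T)).prod
      ((volume.restrict (totalDomain ε Ω)).restrict P)) :=
    hf.mono_measure (Measure.prod_mono le_rfl Measure.restrict_le_self)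
  obtain ⟨F, hFL, hF0, hFf⟩ := exists_bochner hfP
  set U₀ := toEnergySpace hD hβ hu₀.1 (toLp_mem hC hu₀) with hU₀
  have hU₀u : energyFst β _ C U₀ =ᵐ[volume.restrict (totalDomain ε Ω)] u₀ := hu₀.1.1.coeFn_toLp
  refine ⟨F, U, z, U₀, ?_, hU₀u, hUu, hFf, hF0⟩
  refine ⟨hUL, hFL, hU0, hzc, ?_, Lp.ext (hz0.trans hU₀u.symm), fun φ => ?_⟩
  · filter_upwards [hUu, hzu] with t h1 h2 ht
    exact Lp.ext ((h1 ht).trans (h2 ht).symm)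
  · obtain ⟨d, hd, hde⟩ := hu.equation _ (memSobolevC_energyFst hD hβ hC φ)
    rw [ae_restrict_iff' measurableSet_Ioo] at hde
    refine hd.congr ?_ ?_
    · filter_upwards [hUu] with t ht hts
      rw [inner_Lp_eq (restrictTo_ae_eq (ht hts)) (restrictTo_ae_eq (ae_eq_refl _)),
        Measure.restrict_restrict_of_subset hPD]
    · filter_upwards [hUu, hFf, hde] with t h1 h2 h3 hts
      rw [inner_Lp_eq (h2 hts) (restrictTo_ae_eq (ae_eq_refl _)), hNM,
        diffusionForm_eq_nonlocalForm ha hT hD hβ (Ioo_subset_Icc_self hts) (h1 hts) (ae_eq_refl _),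
        Measure.restrict_restrict_of_subset hPD, ← h3 hts]
      ring

end WeakSolution

/-! ### Regularity of weak solutions -/

section TimeDeriv

variable {X Y Z : Type*} [NormedAddCommGroup X] [InnerProductSpace ℝ X] [CompleteSpace X]
  [NormedAddCommGroup Y] [InnerProductSpace ℝ Y] [CompleteSpace Y]
  [MeasurableSpace Z] [MeasurableSpace.CountablyGenerated Z] {μ : Measure Z} [SFinite μ]
  {I : X →L[ℝ] Y} {R : Y →L[ℝ] Lp ℝ 2 μ} {N M : ℝ → X →L[ℝ] X →L[ℝ] ℝ} {T K Λ c₀ c₁ : ℝ}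
  {f : ℝ → Lp ℝ 2 μ} {u₀ : X} {u : ℝ → X} {z : ℝ → Y}

lemma aestronglyMeasurable_uncurry_indicator {s : Set ℝ} (hs : MeasurableSet s) {F : ℝ → Z → ℝ}
    (hF : AEStronglyMeasurable (Function.uncurry F) ((volume.restrict s).prod μ)) :
    AEStronglyMeasurable (Function.uncurry (s.indicator F)) ((volume : Measure ℝ).prod μ) := by
  have h1 : Function.uncurry (s.indicator F) = (s ×ˢ univ).indicator (Function.uncurry F) := by
    funext ⟨t, x⟩
    by_cases ht : t ∈ s <;> simp [ht]
  rw [h1, aestronglyMeasurable_indicator_iff (hs.prod .univ), ← Measure.prod_restrict,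
    Measure.restrict_univ]
  exact hF

theorem IsAbstractSolution.exists_time_deriv (hF : SplitForm (R ∘L I) N M K Λ c₀ c₁)
    (hu : IsAbstractSolution I R N M T f u₀ u z) (hT : 0 < T) {u' : ℝ → Z → ℝ}
    (hum : AEStronglyMeasurable (Function.uncurry u') ((volume.restrict (Ioo 0 T)).prod μ))
    (huu : ∀ᵐ t, t ∈ Ioo 0 T → R (z t) =ᵐ[μ] u' t) :
    ∃ (w : ℝ → Z → ℝ) (W : ℝ → Lp ℝ 2 μ),
      MemLp (Function.uncurry w) 2 ((volume.restrict (Ioo 0 T)).prod μ) ∧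
      MemLp W 2 volume ∧ (∀ᵐ t, t ∈ Ioo 0 T → W t =ᵐ[μ] w t) ∧
      ∀ s t, 0 ≤ s → s ≤ t → t ≤ T → R (z t) - R (z s) = ∫ τ in s..t, W τ := by
  obtain ⟨C, hC⟩ := hu.exists_quotient_bound hF hT
  -- The constant extension makes the quotients of ζ on [0, T] equal to those already bounded, in
  -- which t − h is replaced by max(t − h, 0).
  set ζ : ℝ → Lp ℝ 2 μ := fun t => R (z (clampTime T t)) with hζ
  have hζc : Continuous ζ := by
    have h1 : ContinuousOn (fun t => R (z t)) (Icc 0 T) :=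
      R.continuous.comp_continuousOn hu.continuousOn
    exact h1.comp_continuous continuous_clampTime (clampTime_mem hT)
  -- A jointly measurable representative of the extension, glued from the two end values and the
  -- given function in between.
  set F : ℝ → Z → ℝ := (Iic 0).indicator (fun _ : ℝ => (R (z 0) : Z → ℝ)) + (Ioo 0 T).indicator u'
    + (Ici T).indicator (fun _ : ℝ => (R (z T) : Z → ℝ)) with hFd
  have hconst : ∀ (s : Set ℝ) (y : Lp ℝ 2 μ), AEStronglyMeasurable
      (Function.uncurry fun (_ : ℝ) => (y : Z → ℝ)) ((volume.restrict s).prod μ) := fun s y =>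
    (Lp.aestronglyMeasurable y).comp_snd
  have hFm : AEStronglyMeasurable (Function.uncurry F) ((volume : Measure ℝ).prod μ) :=
    ((aestronglyMeasurable_uncurry_indicator measurableSet_Iic (hconst _ _)).add
      (aestronglyMeasurable_uncurry_indicator measurableSet_Ioo hum)).add
      (aestronglyMeasurable_uncurry_indicator measurableSet_Ici (hconst _ _))
  have hζF : ∀ᵐ t, ζ t =ᵐ[μ] F t := by
    filter_upwards [huu] with t ht
    rcases le_or_gt t 0 with h0 | h0
    · have e1 : clampTime T t = 0 := max_eq_left ((min_le_left _ _).trans h0)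
      have e2 : F t = R (z 0) := by
        simp [hFd, h0, h0.trans_lt hT]
      simp only [e2, hζ, e1]; rfl
    · rcases lt_or_ge t T with h1 | h1
      · have e1 : clampTime T t = t := clampTime_of_mem ⟨h0.le, h1.le⟩
        have e2 : F t = u' t := by
          simp [hFd, h0, h1]
        simp only [e2, hζ, e1]
        exact ht ⟨h0, h1⟩
      · have e1 : clampTime T t = T := by
          rw [clampTime, min_eq_right h1, max_eq_right hT.le]
        have e2 : F t = R (z T) := by
          simp [hFd, h0, h1]
        simp only [e2, hζ, e1]; rfl
  have hζe : ∀ t ∈ Icc 0 T, ζ t = R (z t) := fun t ht => by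
    rw [hζ]; simp only [clampTime_of_mem ht]
  obtain ⟨w, W, h1, h2, -, h4, h5⟩ := exists_weak_time_deriv hT hζc hFm hζF (C := C) (by
    intro h hh
    refine le_of_eq_of_le (intervalIntegral.integral_congr fun t ht => ?_) (hC h hh).2
    rw [uIcc_of_le hT.le] at ht
    have e : clampTime T (t - h) = max (t - h) 0 := by
      rw [clampTime, min_eq_left (by linarith [ht.2]), max_comm]
    simp only [hζ, e, clampTime_of_mem ht])
  refine ⟨w, W, h1, h2, h4, fun s t hs hst ht => ?_⟩
  rw [← hζe t ⟨hs.trans hst, ht⟩, ← hζe s ⟨hs, hst.trans ht⟩]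
  exact h5 s t hs hst ht

end TimeDeriv

/-! ### Grönwall's inequality and the a priori estimate -/

section Abstract

variable {X Y L : Type*} [NormedAddCommGroup X] [InnerProductSpace ℝ X] [CompleteSpace X]
  [NormedAddCommGroup Y] [InnerProductSpace ℝ Y] [CompleteSpace Y]
  [NormedAddCommGroup L] [InnerProductSpace ℝ L] [CompleteSpace L]
  {I : X →L[ℝ] Y} {R : Y →L[ℝ] L} {N M : ℝ → X →L[ℝ] X →L[ℝ] ℝ} {T K Λ c₀ c₁ : ℝ}
  {f w : ℝ → L} {u₀ : X} {u v : ℝ → X} {z : ℝ → Y}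

/-- The integral form of Grönwall's inequality follows from the differential form for the primitive
of q, whose right derivative is q. -/
lemma le_mul_exp_of_le_integral {q : ℝ → ℝ} {A k : ℝ} (hq : ContinuousOn q (Icc 0 T))
    (hk : 0 < k) (h : ∀ r ∈ Icc 0 T, q r ≤ A + k * ∫ t in (0 : ℝ)..r, q t)
    (hq0 : ∀ r ∈ Icc 0 T, 0 ≤ q r) : ∀ r ∈ Icc 0 T, q r ≤ A * Real.exp (k * r) := by
  intro r hr
  have hT : 0 ≤ T := hr.1.trans hr.2
  have hqi : ∀ s ∈ Icc 0 T, IntervalIntegrable q volume 0 s := fun s hs =>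
    (hq.mono (by rw [uIcc_of_le hs.1]; exact Icc_subset_Icc_right hs.2)).intervalIntegrable
  set Φ : ℝ → ℝ := fun r => ∫ t in (0 : ℝ)..r, q t with hΦ
  have hΦ0 : ∀ s ∈ Icc 0 T, 0 ≤ Φ s := fun s hs =>
    intervalIntegral.integral_nonneg hs.1 fun t ht => hq0 t ⟨ht.1, ht.2.trans hs.2⟩
  have hΦc : ContinuousOn Φ (Icc 0 T) := by
    have := intervalIntegral.continuousOn_primitive_interval (μ := volume) (f := q) (a := 0) (b := T)
      (by rw [uIcc_of_le hT]; exact hq.integrableOn_Icc)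
    rwa [uIcc_of_le hT] at this
  have hΦd : ∀ s ∈ Ico 0 T, HasDerivWithinAt Φ (q s) (Ici s) s := fun s hs => by
    have hm : Icc 0 T ∈ 𝓝[>] s := mem_of_superset (Ioc_mem_nhdsGT hs.2)
      fun t ht => ⟨hs.1.trans ht.1.le, ht.2⟩
    have hm' : Icc s T ∈ 𝓝[≥] s := Icc_mem_nhdsGE hs.2
    refine intervalIntegral.integral_hasDerivWithinAt_right (s := Ici s) (t := Ioi s)
      (hqi s ⟨hs.1, hs.2.le⟩) ?_ ?_
    · exact ⟨Icc 0 T, hm, hq.aestronglyMeasurable measurableSet_Icc⟩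
    · exact (hq s ⟨hs.1, hs.2.le⟩).mono_of_mem_nhdsWithin hm
  have hG := norm_le_gronwallBound_of_norm_deriv_right_le (f := Φ) (f' := q) (δ := 0) (K := k)
    (ε := A) (a := 0) (b := T) hΦc hΦd (by simp [hΦ]) (fun s hs => by
      have hs' : s ∈ Icc 0 T := ⟨hs.1, hs.2.le⟩
      rw [Real.norm_of_nonneg (hq0 s hs'), Real.norm_of_nonneg (hΦ0 s hs')]
      linarith [h s hs'])
  have h1 := hG r hr
  rw [Real.norm_of_nonneg (hΦ0 r hr), gronwallBound_of_K_ne_0 hk.ne', sub_zero] at h1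
  simp only [zero_mul, zero_add] at h1
  calc q r ≤ A + k * Φ r := h r hr
    _ ≤ A + k * (A / k * (Real.exp (k * r) - 1)) := by gcongr
    _ = A * Real.exp (k * r) := by field_simp; ring

/-- The constant of the a priori estimate `IsAbstractSolution.energy_bound`. -/
def energyConst (m A T : ℝ) : ℝ :=
  (A + 1) / m * Real.exp (A / m * T)
    + (2 * T + 1) * (A + 1 + A * T * ((A + 1) / m * Real.exp (A / m * T))) + 2

lemma energyConst_pos {m A T : ℝ} (hm : 0 < m) (hA : 0 < A) (hT : 0 < T) :
    0 < energyConst m A T := by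
  unfold energyConst
  positivity

/-- The a priori estimate for an abstract parabolic problem, in terms of the energy `q`. -/
theorem IsAbstractSolution.energy_bound [SecondCountableTopology X]
    (hF : SplitForm (R ∘L I) N M K Λ c₀ c₁)
    (hu : IsAbstractSolution I R N M T f u₀ u z) (hT : 0 < T) (hI : Function.Injective I)
    (hw : MemLp w 2 volume)
    (hzw : ∀ s t, 0 ≤ s → s ≤ t → t ≤ T → R (z t) - R (z s) = ∫ τ in s..t, w τ)
    (hv : ∀ t ∈ Icc 0 T, I (v t) = z t) (hvc : ContinuousOn v (Icc 0 T)) {q : X → ℝ} {m A : ℝ}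
    (hm : 0 < m) (hA : 0 < A) (hq : Continuous q) (hq0 : ∀ x, 0 ≤ q x)
    (hinc : ∀ t' t, t' ≤ t → ∀ x, (N t x x + M t x x) - (N t' x x + M t' x x)
      ≤ (t - t') * (A * q x))
    (hlow : ∀ t x, m * q x ≤ N t x x + M t x x) (hup : ∀ t x, N t x x + M t x x ≤ A * q x) :
    ∀ r ∈ Icc 0 T,
      q (v r) + ‖R (z r)‖ ^ 2 + ∫ t in (0 : ℝ)..T, ‖w t‖ ^ 2
        ≤ energyConst m A T * (q u₀ + ‖R (I u₀)‖ ^ 2 + ∫ t in (0 : ℝ)..T, ‖f t‖ ^ 2) := by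
  set E := q u₀ + ‖R (I u₀)‖ ^ 2 + ∫ t in (0 : ℝ)..T, ‖f t‖ ^ 2 with hE
  have hf0 : 0 ≤ ∫ t in (0 : ℝ)..T, ‖f t‖ ^ 2 :=
    intervalIntegral.integral_nonneg hT.le fun t _ => sq_nonneg _
  have hqu := hq0 u₀
  have hRu := sq_nonneg ‖R (I u₀)‖
  have hE0 : 0 ≤ E := by positivity
  have hfi : ∀ a b, IntervalIntegrable (fun t => ‖f t‖ ^ 2) volume a b := fun a b =>
    (integrable_norm_sq hu.memLp_rhs).intervalIntegrable
  have hwi : ∀ a b, IntervalIntegrable (fun t => ‖w t‖ ^ 2) volume a b := fun a b =>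
    (integrable_norm_sq hw).intervalIntegrable
  have hii : ∀ a b, IntervalIntegrable (fun t => inner ℝ (f t - w t) (w t)) volume a b := fun a b =>
    (integrable_inner (hu.memLp_rhs.sub hw) hw).intervalIntegrable
  have hqc : ContinuousOn (fun t => q (v t)) (Icc 0 T) := hq.comp_continuousOn hvc
  have hqi : ∀ r ∈ Icc 0 T, IntervalIntegrable (fun t => q (v t)) volume 0 r := fun r hr =>
    (hqc.mono (by rw [uIcc_of_le hr.1]; exact Icc_subset_Icc_right hr.2)).intervalIntegrable
  have key : ∀ r ∈ Icc 0 T, m * q (v r) + ∫ t in (0 : ℝ)..r, ‖w t‖ ^ 2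
      ≤ (A + 1) * E + A * ∫ t in (0 : ℝ)..r, q (v t) := by
    intro r hr
    have h1 := hu.energy_le hF hT hI hw hzw hv hvc (q := fun x => A * q x) (by fun_prop)
      (fun x => mul_nonneg hA.le (hq0 x)) hinc hr.1 hr.2
    -- The identity 2(f − w, w) = ‖f‖² − ‖w‖² − ‖f − w‖² makes ∫‖w‖² appear on the good side with
    -- coefficient 1.
    have h2 : ∫ t in (0 : ℝ)..r, (2 * inner ℝ (f t - w t) (w t) + A * q (v t))
        ≤ ∫ t in (0 : ℝ)..r, (‖f t‖ ^ 2 - ‖w t‖ ^ 2 + A * q (v t)) := by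
      refine intervalIntegral.integral_mono_on hr.1 (((hii _ _).const_mul 2).add
        ((hqi r hr).const_mul A)) (((hfi _ _).sub (hwi _ _)).add ((hqi r hr).const_mul A))
        fun t _ => ?_
      have e := norm_sub_sq_real (f t) (w t)
      have e' := sq_nonneg ‖f t - w t‖
      rw [inner_sub_left, real_inner_self_eq_norm_sq]
      linarith
    rw [intervalIntegral.integral_add ((hfi _ _).sub (hwi _ _)) ((hqi r hr).const_mul A),
      intervalIntegral.integral_sub (hfi _ _) (hwi _ _), intervalIntegral.integral_const_mul] at h2
    have h3 : ∫ t in (0 : ℝ)..r, ‖f t‖ ^ 2 ≤ ∫ t in (0 : ℝ)..T, ‖f t‖ ^ 2 :=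
      intervalIntegral.integral_mono_interval le_rfl hr.1 hr.2
        (ae_of_all _ fun t => sq_nonneg _) (hfi _ _)
    have h4 := hlow r (v r)
    have h5 := hup 0 u₀
    have h6 : A * q u₀ ≤ A * E := by gcongr; linarith
    linarith
  have hB : ∀ r ∈ Icc 0 T, q (v r) ≤ (A + 1) / m * Real.exp (A / m * T) * E := by
    intro r hr
    have h1 := le_mul_exp_of_le_integral (A := (A + 1) / m * E) (k := A / m) hqc
      (by positivity) (fun s hs => by
        have h2 := key s hs
        have h3 : 0 ≤ ∫ t in (0 : ℝ)..s, ‖w t‖ ^ 2 :=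
          intervalIntegral.integral_nonneg hs.1 fun t _ => sq_nonneg _
        have h4 : m * q (v s) ≤ m * ((A + 1) / m * E + A / m * ∫ t in (0 : ℝ)..s, q (v t)) := by
          have : m * ((A + 1) / m * E + A / m * ∫ t in (0 : ℝ)..s, q (v t))
              = (A + 1) * E + A * ∫ t in (0 : ℝ)..s, q (v t) := by field_simp
          linarith
        exact le_of_mul_le_mul_left h4 hm) (fun s _ => hq0 _) r hr
    refine h1.trans ?_
    have : Real.exp (A / m * r) ≤ Real.exp (A / m * T) :=
      Real.exp_le_exp.2 (mul_le_mul_of_nonneg_left hr.2 (by positivity))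
    calc (A + 1) / m * E * Real.exp (A / m * r) ≤ (A + 1) / m * E * Real.exp (A / m * T) := by gcongr
      _ = _ := by ring
  set B := (A + 1) / m * Real.exp (A / m * T) with hBd
  have hW : ∫ t in (0 : ℝ)..T, ‖w t‖ ^ 2 ≤ (A + 1 + A * T * B) * E := by
    have h1 := key T ⟨hT.le, le_rfl⟩
    have h2 : ∫ t in (0 : ℝ)..T, q (v t) ≤ ∫ t in (0 : ℝ)..T, B * E :=
      intervalIntegral.integral_mono_on hT.le (hqi T ⟨hT.le, le_rfl⟩)
        intervalIntegrable_const hB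
    rw [intervalIntegral.integral_const, smul_eq_mul, sub_zero] at h2
    have h3 := mul_nonneg hm.le (hq0 (v T))
    have h4 := mul_le_mul_of_nonneg_left h2 hA.le
    linarith
  intro r hr
  -- The energy q need not control the L² part, so this part is integrated from its initial value.
  -- The Cauchy–Schwarz step is the averaging inequality with window r.
  have hR : ‖R (z r)‖ ^ 2 ≤ 2 * E + 2 * T * ∫ t in (0 : ℝ)..T, ‖w t‖ ^ 2 := by
    have h0 := hzw 0 r le_rfl hr.1 hr.2
    have h1 : ‖∫ τ in (0 : ℝ)..r, w τ‖ ^ 2 ≤ T * ∫ t in (0 : ℝ)..T, ‖w t‖ ^ 2 := by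
      rcases hr.1.eq_or_lt with h | h
      · rw [← h]
        simpa using mul_nonneg hT.le
          (intervalIntegral.integral_nonneg hT.le fun t _ => sq_nonneg ‖w t‖)
      · have h2 := norm_steklov_sq_le hw h r
        simp only [steklov, sub_self, norm_smul, smul_eq_mul, mul_pow, norm_inv,
          Real.norm_of_nonneg hr.1] at h2
        have h3 : ‖∫ τ in (0 : ℝ)..r, w τ‖ ^ 2 ≤ r * ∫ τ in (0 : ℝ)..r, ‖w τ‖ ^ 2 := by
          have h4 := mul_le_mul_of_nonneg_left h2 (sq_nonneg r)
          have e1 : r ^ 2 * (r⁻¹ ^ 2 * ‖∫ τ in (0 : ℝ)..r, w τ‖ ^ 2)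
            = ‖∫ τ in (0 : ℝ)..r, w τ‖ ^ 2 := by field_simp
          have e2 : r ^ 2 * (r⁻¹ * ∫ τ in (0 : ℝ)..r, ‖w τ‖ ^ 2)
            = r * ∫ τ in (0 : ℝ)..r, ‖w τ‖ ^ 2 := by field_simp
          rwa [e1, e2] at h4
        refine h3.trans (mul_le_mul hr.2 ?_ ?_ hT.le)
        · exact intervalIntegral.integral_mono_interval le_rfl hr.1 hr.2
            (ae_of_all _ fun t => sq_nonneg _) (hwi _ _)
        · exact intervalIntegral.integral_nonneg hr.1 fun t _ => sq_nonneg _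
    have h2 : R (z r) = R (I u₀) + ∫ τ in (0 : ℝ)..r, w τ := by
      rw [← h0, hu.initial]; abel
    have h3 : ‖R (z r)‖ ≤ ‖R (I u₀)‖ + ‖∫ τ in (0 : ℝ)..r, w τ‖ := by
      rw [h2]; exact norm_add_le _ _
    have h4 := pow_le_pow_left₀ (norm_nonneg _) h3 2
    nlinarith [sq_nonneg (‖R (I u₀)‖ - ‖∫ τ in (0 : ℝ)..r, w τ‖)]
  have h5 := mul_le_mul_of_nonneg_left hW (by positivity : 0 ≤ 2 * T + 1)
  have h6 := hB r hr
  have h7 : energyConst m A T = B + (2 * T + 1) * (A + 1 + A * T * B) + 2 := rfl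
  rw [h7]
  linarith

end Abstract

/-! ### Time derivative on Ω and identification of the principal value -/

section Interior

variable {n : ℕ} {ε : ℝ≥0∞} {Ω P : Set (Space n)} {T : ℝ}
  {a : ℝ → Space n → Space n → Matrix (Fin n) (Fin n) ℝ} {aLow aUp : ℝ} {β : Space n → ℝ}
  {C : Submodule ℝ (Lp ℝ 2 (volume.restrict (totalDomain ε Ω)))} {c : Constraint}

lemma hasL2TimeDeriv_of_sub_eq_integral (hT : 0 < T) (hΩ : MeasurableSet Ω) (hΩP : Ω ⊆ P)
    (hPD : P ⊆ totalDomain ε Ω) {u w : ℝ → Space n → ℝ}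
    (hw : MemLp (Function.uncurry w) 2 (cylinder T P))
    {W : ℝ → Lp ℝ 2 ((volume.restrict (totalDomain ε Ω)).restrict P)} (hW : MemLp W 2 volume)
    (hWw : ∀ᵐ t, t ∈ Ioo 0 T → W t =ᵐ[(volume.restrict (totalDomain ε Ω)).restrict P] w t)
    {z : ℝ → Lp ℝ 2 (volume.restrict (totalDomain ε Ω))}
    (hzu : ∀ᵐ t, t ∈ Ioo 0 T → z t =ᵐ[volume.restrict (totalDomain ε Ω)] u t)
    (hzW : ∀ s t, 0 ≤ s → s ≤ t → t ≤ T → restrictTo (totalDomain ε Ω) P (z t)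
      - restrictTo (totalDomain ε Ω) P (z s) = ∫ τ in s..t, W τ) :
    HasL2TimeDeriv Ω T u w := by
  refine ⟨hw.mono_measure (Measure.prod_mono le_rfl (Measure.restrict_mono hΩP le_rfl)),
    fun h hh => ?_⟩
  have e1 := Measure.restrict_restrict_of_subset (μ := (volume : Measure (Space n))) hPD
  have hhP : MemLp (Ω.indicator h) 2 ((volume.restrict (totalDomain ε Ω)).restrict P) := by
    rw [e1, memLp_indicator_iff_restrict hΩ, Measure.restrict_restrict_of_subset hΩP]
    exact hh
  set η := hhP.toLp (Ω.indicator h) with hη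
  have hint : ∀ k : Space n → ℝ, ∫ x, k x * Ω.indicator h x
      ∂((volume.restrict (totalDomain ε Ω)).restrict P) = ∫ x in Ω, k x * h x := fun k => by
    rw [e1, ← Measure.restrict_restrict_of_subset hΩP, ← integral_indicator hΩ]
    refine integral_congr_ae (ae_of_all _ fun x => ?_)
    by_cases hx : x ∈ Ω <;> simp [hx]
  have hWi : ∀ s t, IntervalIntegrable W volume s t := intervalIntegrable_of_memLp_two hW
  have h1 : HasWeakDeriv T (fun t => inner ℝ (restrictTo (totalDomain ε Ω) P (z t)) η)
      fun t => inner ℝ (W t) η := by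
    refine hasWeakDeriv_of_sub_eq_integral hT ?_ fun t ht => ?_
    · have hi := hWi 0 T
      simp only [real_inner_comm η]
      exact ⟨(innerSL ℝ η).integrable_comp hi.1, (innerSL ℝ η).integrable_comp hi.2⟩
    · rw [← inner_sub_left, hzW 0 t le_rfl ht.1 ht.2]
      simp only [real_inner_comm η]
      exact ((innerSL ℝ η).intervalIntegral_comp_comm (hWi 0 t)).symm
  refine h1.congr ?_ ?_
  · filter_upwards [hzu] with t ht hts
    rw [inner_Lp_eq (restrictTo_ae_eq (ht hts)) hhP.coeFn_toLp, hint]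
  · filter_upwards [hWw] with t ht hts
    rw [inner_Lp_eq (ht hts) hhP.coeFn_toLp, hint]

/-- Functions vanishing outside Ω are not Neumann test functions until their mean is removed. A
constant does not change increments, so the form is unaffected. The two cases share one formula,
with s = 0 for Dirichlet and s = 1/|Ω̃| for Neumann. -/
lemma exists_memSobolevC_sub_mean (hΩ : IsOpen Ω) (hΩb : Bornology.IsBounded Ω) (hε : 0 < ε)
    (hβ : ContinuousOn β (totalDomain ε Ω)) (hc : c = .neumann → ε ≠ ⊤) :
    ∃ s : ℝ, (s ≠ 0 → volume (totalDomain ε Ω) ≠ ⊤ ∧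
        ENNReal.ofReal |s| * volume (totalDomain ε Ω) ≤ 1) ∧
      ∀ φ, MemSobolevC .dirichlet β ε Ω φ →
        MemSobolevC c β ε Ω (fun x => φ x - s * ∫ y in Ω, φ y) := by
  have hD : MeasurableSet (totalDomain ε Ω) := (isOpen_totalDomain hΩ hε).measurableSet
  cases c with
  | dirichlet => exact ⟨0, by simp, fun φ hφ => by simpa using hφ⟩
  | neumann =>
    have hfin : volume (totalDomain ε Ω) ≠ ⊤ :=
      (isBounded_totalDomain hΩ hΩb hε (hc rfl)).measure_lt_top.ne
    have : IsFiniteMeasure (volume.restrict (totalDomain ε Ω)) := isFiniteMeasure_restrict.2 hfin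
    refine ⟨(volume.real (totalDomain ε Ω))⁻¹, fun hs => ⟨hfin, ?_⟩, fun φ hφ => ?_⟩
    · rw [abs_of_nonneg (by positivity), measureReal_def, ← ENNReal.toReal_inv]
      refine (mul_le_mul_left ENNReal.ofReal_toReal_le _).trans ?_
      exact ENNReal.inv_mul_le_one _
    · set k := (volume.real (totalDomain ε Ω))⁻¹ * ∫ y in Ω, φ y with hk
      have hinc : increment (fun x => φ x - k) = increment φ := by
        funext p; simp [increment]
      refine ⟨?_, ?_⟩
      · have h := hφ.1
        rw [memSobolev_iff hD hβ] at h ⊢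
        rw [hinc]
        exact ⟨h.1.sub (memLp_const k), h.2⟩
      · have hφ0 := (dirichlet_iff hφ.1.1).1 hφ.2
        have hφi : Integrable φ (volume.restrict (totalDomain ε Ω)) :=
          hφ.1.1.integrable (by norm_num)
        have e1 : ∫ x in totalDomain ε Ω, φ x = ∫ x in Ω, φ x := by
          rw [totalDomain, setIntegral_union disjoint_interactionDomain
            (measurableSet_interactionDomain hΩ hε) (hφi.mono_measure
              (Measure.restrict_mono subset_union_left le_rfl))
            (hφi.mono_measure (Measure.restrict_mono subset_union_right le_rfl)),
            integral_congr_ae hφ0]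
          simp
        have e2 : ∫ x in totalDomain ε Ω, (φ x - k) = 0 := by
          rw [integral_sub hφi (integrable_const k), integral_const, e1, hk, measureReal_restrict_apply_univ,
            smul_eq_mul]
          by_cases h0 : volume.real (totalDomain ε Ω) = 0
          · have h0' : volume Ω = 0 := by
              refine measure_mono_null subset_union_left (t := totalDomain ε Ω) ?_
              rwa [measureReal_def, ENNReal.toReal_eq_zero_iff, or_iff_left hfin] at h0
            rw [h0, setIntegral_measure_zero _ h0']
            simp
          · field_simp
            ring
        show (∫ x in totalDomain ε Ω, (φ x - k)) ^ 2 = 0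
        rw [e2]; norm_num

/-- The equation is tested with φ minus its mean correction. The correction is then transferred from
φ to k by ∫_P k (φ − s∫_Ω φ) = ∫_Ω (k − s∫_P k) φ, where φ vanishes on P outside Ω. -/
lemma nonlocalForm_eq_setIntegral (ha : AdmissibleTensor ε Ω T a aLow aUp) (hT : 0 < T)
    (hΩ : IsOpen Ω) (hε : 0 < ε) (hβ : ContinuousOn β (totalDomain ε Ω))
    (hC : ∀ y, y ∈ C ↔ constraintFunctional c ε Ω y = 0) (hPm : MeasurableSet P) (hΩP : Ω ⊆ P)
    (hPD : P ⊆ totalDomain ε Ω)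
    {s : ℝ} (hs : s ≠ 0 → volume (totalDomain ε Ω) ≠ ⊤) {t : ℝ} (ht : t ∈ Icc 0 T)
    {u k φ : Space n → ℝ} {x : EnergySpace β (totalDomain ε Ω) C}
    (hxu : energyFst β _ C x =ᵐ[volume.restrict (totalDomain ε Ω)] u)
    {κ : Lp ℝ 2 ((volume.restrict (totalDomain ε Ω)).restrict P)}
    (hκ : κ =ᵐ[(volume.restrict (totalDomain ε Ω)).restrict P] k)
    (hx : ∀ y : EnergySpace β (totalDomain ε Ω) C, diffusionForm ha hT
      (isOpen_totalDomain hΩ hε).measurableSet β C t x y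
        = inner ℝ κ (restrictTo (totalDomain ε Ω) P (energyFst β _ C y)))
    (hφ : MemSobolevC .dirichlet β ε Ω φ)
    (hφs : MemSobolevC c β ε Ω (fun x => φ x - s * ∫ y in Ω, φ y)) :
    nonlocalForm β ε Ω a t u φ = ∫ x in Ω, (k x - s * ∫ y in P, k y) * φ x := by
  have hD : MeasurableSet (totalDomain ε Ω) := (isOpen_totalDomain hΩ hε).measurableSet
  have e1 := Measure.restrict_restrict_of_subset (μ := (volume : Measure (Space n))) hPD
  set y := toEnergySpace hD hβ hφs.1 (toLp_mem hC hφs) with hy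
  have hyφ : energyFst β _ C y =ᵐ[volume.restrict (totalDomain ε Ω)]
      fun x => φ x - s * ∫ y in Ω, φ y := hφs.1.1.coeFn_toLp
  have hu : MemSobolev β (totalDomain ε Ω) u :=
    memSobolev_congr hD hβ hxu (memSobolev_energyFst hD hβ x)
  have hinc : increment (fun x => φ x - s * ∫ y in Ω, φ y) = increment φ := by
    funext p; simp [increment]
  have h1 := hx y
  rw [diffusionForm_eq_nonlocalForm ha hT hD hβ ht hxu hyφ, nonlocalForm_eq ha hT hD hβ ht hu hφs.1,
    hinc, ← nonlocalForm_eq ha hT hD hβ ht hu hφ.1, inner_Lp_eq hκ (restrictTo_ae_eq hyφ), e1] at h1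
  rw [h1]
  have hkL : MemLp k 2 (volume.restrict P) := by
    rw [← e1]; exact (memLp_congr_ae hκ).1 (Lp.memLp κ)
  have hφP : MemLp φ 2 (volume.restrict P) := hφ.1.1.mono_measure (Measure.restrict_mono hPD le_rfl)
  have hφΩ := hφP.mono_measure (Measure.restrict_mono hΩP le_rfl)
  have hkΩ := hkL.mono_measure (Measure.restrict_mono hΩP le_rfl)
  have hφ0 := (dirichlet_iff hφ.1.1).1 hφ.2
  have e2 : ∫ x in P, k x * φ x = ∫ x in Ω, k x * φ x := by
    refine setIntegral_eq_of_subset_of_ae_sdiff_eq_zero hPm.nullMeasurableSet hΩP ?_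
    rw [EventuallyEq, ae_restrict_iff' (measurableSet_interactionDomain hΩ hε)] at hφ0
    filter_upwards [hφ0] with x hx hxP
    have : x ∈ interactionDomain ε Ω := (hPD hxP.1).resolve_left hxP.2
    rw [hx this]; simp
  have hkφ : Integrable (fun x => k x * φ x) (volume.restrict P) := hkL.integrable_mul hφP
  have hkφΩ : Integrable (fun x => k x * φ x) (volume.restrict Ω) := hkΩ.integrable_mul hφΩ
  by_cases h0 : s = 0
  · simp only [h0, zero_mul, sub_zero]; exact e2
  · have hfin : IsFiniteMeasure (volume.restrict (totalDomain ε Ω)) :=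
      isFiniteMeasure_restrict.2 (hs h0)
    have hfin' : IsFiniteMeasure (volume.restrict P) :=
      isFiniteMeasure_restrict.2 (measure_ne_top_of_subset hPD (hs h0))
    have hfin'' : IsFiniteMeasure (volume.restrict Ω) :=
      isFiniteMeasure_restrict.2 (measure_ne_top_of_subset subset_union_left (hs h0))
    have i1 : Integrable k (volume.restrict P) := hkL.integrable (by norm_num)
    have i2 : Integrable φ (volume.restrict Ω) := hφΩ.integrable (by norm_num)
    simp only [mul_sub, sub_mul]
    rw [integral_sub hkφ (i1.mul_const _), integral_sub hkφΩ (i2.const_mul _), e2,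
      integral_mul_const, integral_const_mul]
    ring

lemma enorm_integral_sq_mul_le {μ : Measure (Space n)} {k : Space n → ℝ}
    (hk : AEStronglyMeasurable k μ) :
    ENNReal.ofReal ((∫ x, k x ∂μ) ^ 2) ≤ μ univ * ∫⁻ x, ENNReal.ofReal (k x ^ 2) ∂μ := by
  have h1 := eLpNorm_le_eLpNorm_mul_rpow_measure_univ (μ := μ) (f := k) (p := 1) (q := 2)
    (by norm_num) hk
  have h2 : ‖∫ x, k x ∂μ‖ₑ ≤ eLpNorm k 1 μ := by
    rw [eLpNorm_one_eq_lintegral_enorm]; exact enorm_integral_le_lintegral_enorm _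
  have h3 := pow_le_pow_left' (h2.trans h1) 2
  rw [mul_pow, lintegral_ofReal_sq_eq, ← ENNReal.rpow_natCast (_ ^ _), ← ENNReal.rpow_mul] at h3
  norm_num at h3
  rw [← sq_abs, ENNReal.ofReal_pow (abs_nonneg _), ← Real.norm_eq_abs, ofReal_norm, mul_comm]
  exact h3

/-- Averaging is a contraction: Cauchy–Schwarz on P gives the factor s² |P| |Ω|, at most (|s| |Ω̃|)²
≤ 1. -/
lemma exists_eLpNorm_mean_le (hPD : P ⊆ totalDomain ε Ω) {s : ℝ}
    (hs : s ≠ 0 → volume (totalDomain ε Ω) ≠ ⊤ ∧ ENNReal.ofReal |s| * volume (totalDomain ε Ω) ≤ 1)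
    {k : ℝ → Space n → ℝ} (hk : MemLp (Function.uncurry k) 2 (cylinder T P)) :
    MemLp (Function.uncurry fun t (_ : Space n) => s * ∫ y in P, k t y) 2 (cylinder T Ω) ∧
    eLpNorm (Function.uncurry fun t (_ : Space n) => s * ∫ y in P, k t y) 2 (cylinder T Ω)
      ≤ eLpNorm (Function.uncurry k) 2 (cylinder T P) := by
  have hm : AEStronglyMeasurable (fun t => s * ∫ y in P, k t y) (volume.restrict (Ioo 0 T)) :=
    (AEStronglyMeasurable.integral_prod_right' hk.1).const_mul s
  have hm' : AEStronglyMeasurable (Function.uncurry fun t (_ : Space n) => s * ∫ y in P, k t y)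
      (cylinder T Ω) := hm.comp_fst
  suffices h : eLpNorm (Function.uncurry fun t (_ : Space n) => s * ∫ y in P, k t y) 2 (cylinder T Ω)
      ≤ eLpNorm (Function.uncurry k) 2 (cylinder T P) from ⟨⟨hm', h.trans_lt hk.2⟩, h⟩
  refine (ENNReal.pow_le_pow_left_iff two_ne_zero).1 ?_
  rw [lintegral_ofReal_sq_eq, lintegral_ofReal_sq_eq, cylinder, cylinder,
    lintegral_prod _ (hm'.aemeasurable.pow_const 2).ennreal_ofReal,
    lintegral_prod _ (hk.1.aemeasurable.pow_const 2).ennreal_ofReal]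
  refine lintegral_mono_ae ?_
  filter_upwards [hk.1.prodMk_left] with t ht
  simp only [Function.uncurry_apply_pair] at ht ⊢
  rw [lintegral_const, Measure.restrict_apply_univ, mul_pow, ENNReal.ofReal_mul (sq_nonneg s)]
  by_cases h0 : s = 0
  · simp [h0]
  · obtain ⟨-, hs1⟩ := hs h0
    have h1 := enorm_integral_sq_mul_le ht
    rw [Measure.restrict_apply_univ] at h1
    have hΩv : volume Ω ≤ volume (totalDomain ε Ω) := measure_mono subset_union_left
    have hPv : volume P ≤ volume (totalDomain ε Ω) := measure_mono hPD
    set J := ∫⁻ x in P, ENNReal.ofReal (k t x ^ 2) with hJ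
    rw [← sq_abs s, ENNReal.ofReal_pow (abs_nonneg s)]
    set V := volume (totalDomain ε Ω)
    set σ := ENNReal.ofReal |s|
    calc σ ^ 2 * ENNReal.ofReal ((∫ y in P, k t y) ^ 2) * volume Ω
        ≤ σ ^ 2 * (V * J) * V := by
          gcongr
          exact h1.trans (by gcongr)
      _ = (σ * V) * (σ * V) * J := by ring
      _ ≤ 1 * 1 * J := by gcongr
      _ = J := by simp

end Interior

/-! ### Assembly of the estimate -/

section Estimates

variable {n : ℕ} {ε : ℝ≥0∞} {Ω P : Set (Space n)} {T : ℝ}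
  {a : ℝ → Space n → Space n → Matrix (Fin n) (Fin n) ℝ} {aLow aUp : ℝ} {β : Space n → ℝ}
  {C : Submodule ℝ (Lp ℝ 2 (volume.restrict (totalDomain ε Ω)))} {c : Constraint}

lemma horizonEnergy_le (x : EnergySpace β (totalDomain ε Ω) C) :
    horizonEnergy β ε Ω C x ≤ ‖x‖ ^ 2 := by
  have h1 : ∫ p, energySnd β _ C x p ^ 2 ∂jumpMeasure β (totalDomain ε Ω)
      = ‖energySnd β _ C x‖ ^ 2 := by
    rw [← real_inner_self_eq_norm_sq, inner_Lp_eq (ae_eq_refl _) (ae_eq_refl _)]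
    simp only [sq]
  calc horizonEnergy β ε Ω C x ≤ ‖energySnd β _ C x‖ ^ 2 := by
        rw [← h1]
        exact setIntegral_le_integral (Lp.memLp _).integrable_sq (ae_of_all _ fun p => sq_nonneg _)
    _ ≤ ‖x‖ ^ 2 := pow_le_pow_left₀ (norm_nonneg _) (norm_energySnd_le x) 2

lemma norm_restrictTo_le {S : Set (Space n)} (hPS : P ⊆ S) (y : Lp ℝ 2 (volume.restrict S)) :
    ‖restrictTo S P y‖ ≤ ‖y‖ := by
  refine (abs_le_of_sq_le_sq' ?_ (norm_nonneg _)).2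
  rw [← ENNReal.ofReal_le_ofReal_iff (sq_nonneg _), ofReal_norm_sq_restrictTo hPS, ofReal_norm_sq_Lp]
  exact lintegral_mono_set hPS

lemma isContinuousSobolev_energyFst (hD : MeasurableSet (totalDomain ε Ω))
    (hβ : ContinuousOn β (totalDomain ε Ω))
    (hC : ∀ y, y ∈ C ↔ constraintFunctional c ε Ω y = 0)
    {V : ℝ → EnergySpace β (totalDomain ε Ω) C} (hV : ContinuousOn V (Icc 0 T)) :
    IsContinuousSobolev c β ε Ω T fun t => energyFst β _ C (V t) := by
  refine ⟨fun t _ => memSobolevC_energyFst hD hβ hC _, fun s hs => ?_⟩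
  have h1 : ∀ t, sobolevNorm β (totalDomain ε Ω)
      ((energyFst β _ C (V t) : Space n → ℝ) - energyFst β _ C (V s))
      ≤ ENNReal.ofReal (2 * ‖V t - V s‖) := fun t => by
    have h := sobolevNorm_energyFst_le hD hβ (V t - V s)
    rwa [map_sub, sobolevNorm_congr hD hβ (Lp.aestronglyMeasurable _) (Lp.coeFn_sub _ _)] at h
  refine tendsto_of_tendsto_of_tendsto_of_le_of_le tendsto_const_nhds ?_ (fun t => bot_le) h1
  have h2 : Tendsto (fun t => 2 * ‖V t - V s‖) (𝓝[Icc 0 T] s) (𝓝 0) := by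
    have := (((hV s hs).tendsto.sub_const (V s)).norm).const_mul 2
    simpa using this
  simpa using ENNReal.tendsto_ofReal h2

lemma le_sqrt_mul_of_sq_le {r K S : ℝ} (hK : 0 ≤ K) (hS : 0 ≤ S) (h : r ^ 2 ≤ K * S ^ 2) :
    r ≤ √K * S := by
  refine (abs_le_of_sq_le_sq' ?_ (by positivity)).2
  rwa [mul_pow, Real.sq_sqrt hK]

set_option maxHeartbeats 1000000 in
/-- The regularity theorem, for a constant `G` as in `exists_norm_sq_le_horizonEnergy`. -/
theorem IsWeakSolution.exists_regular_version (hΩ : IsOpen Ω) (hΩb : Bornology.IsBounded Ω)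
    (hε : 0 < ε) (hT : 0 < T) (ha : AdmissibleTensor ε Ω T a aLow aUp)
    (hβ : ContinuousOn β (totalDomain ε Ω)) {b G : ℝ} (hb : 0 < b)
    (hβS : ∀ x ∈ totalDomain ε Ω, b ≤ β x ∧ β x ≤ 1) (hc : c = .neumann → ε ≠ ⊤)
    (hPm : MeasurableSet P) (hΩP : Ω ⊆ P) (hPD : P ⊆ totalDomain ε Ω) (hG0 : 0 < G)
    (hG : ∀ C : Submodule ℝ (Lp ℝ 2 (volume.restrict (totalDomain ε Ω))),
      (∀ y ∈ C, constraintFunctional c ε Ω y = 0) →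
      ∀ x : EnergySpace β (totalDomain ε Ω) C, ‖x‖ ^ 2 ≤ G * (horizonEnergy β ε Ω C x
        + ‖restrictTo (totalDomain ε Ω) P (energyFst β _ C x)‖ ^ 2))
    {u₀ : Space n → ℝ} {f u : ℝ → Space n → ℝ} (hu₀ : MemSobolevC c β ε Ω u₀)
    (hf : MemLp (Function.uncurry f) 2 (cylinder T (totalDomain ε Ω)))
    (hu : IsWeakSolution c β ε Ω P T a f u₀ u) :
    ∃ v w g : ℝ → Space n → ℝ,
      IsVersion T (totalDomain ε Ω) v u ∧
      IsContinuousSobolev c β ε Ω T v ∧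
      HasL2TimeDeriv Ω T u w ∧
      MemTildeSpace c β ε Ω T a u g ∧
      (⨆ t ∈ Icc 0 T, sobolevNorm β (totalDomain ε Ω) (v t))
          + eLpNorm (Function.uncurry w) 2 (cylinder T Ω)
          + eLpNorm (Function.uncurry g) 2 (cylinder T Ω)
        ≤ ENNReal.ofReal (2 * √(G * (2 * energyConst aLow (|aUp| + 1) T))
            + 2 * √(2 * energyConst aLow (|aUp| + 1) T) + 1) *
          (eLpNorm (Function.uncurry f) 2 (cylinder T (totalDomain ε Ω))
            + sobolevNorm β (totalDomain ε Ω) u₀) := by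
  have hD : MeasurableSet (totalDomain ε Ω) := (isOpen_totalDomain hΩ hε).measurableSet
  have hA : (0 : ℝ) < |aUp| + 1 := by positivity
  obtain ⟨C, hCcl, hC⟩ := exists_constraint_submodule (ε := ε) (Ω := Ω) c fun h =>
    (isBounded_totalDomain hΩ hΩb hε (hc h)).measure_lt_top.ne
  have hC' := fun y hy => (hC y).1 hy
  have := completeSpace_energySpace (β := β) hCcl
  obtain ⟨N, M, K, Λ, c₀, c₁, hF, hNM⟩ :=
    exists_splitForm hΩ hΩb hε hT ha hD hβ hb hβS hc hC' hΩP hPD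
  obtain ⟨F, U, z, U₀, hsol, hU₀, hUu, hFf, -⟩ :=
    hu.exists_abstractSolution ha hD hβ hT hC hPD hu₀ hf hNM
  have hzu : ∀ᵐ t, t ∈ Ioo 0 T → z t =ᵐ[volume.restrict (totalDomain ε Ω)] u t := by
    filter_upwards [hsol.ae_eq, hUu] with t h1 h2 ht
    rw [← h1 ht]
    exact h2 ht
  obtain ⟨w, W, hw, hW, hWw, hzW⟩ := hsol.exists_time_deriv hF hT (u' := u)
    (hu.memL2.1.mono_measure (Measure.prod_mono le_rfl Measure.restrict_le_self))
    (hzu.mono fun t ht hts => restrictTo_ae_eq (ht hts))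
  rw [cylinder_restrict hPD] at hw
  have hI := energyFst_injective (β := β) (C := C)
  obtain ⟨V, B, hV⟩ := hsol.exists_bounded_trajectory hF hT hI
  have hVz := fun t ht => (hV t ht).1
  have hVc := hsol.continuousOn_trajectory hF hT hI hW hzW hV
  have hVu := hsol.ae_trajectory_eq hI hVz
  have hae := hsol.ae_equation hT hW hzW
  obtain ⟨s, hs, hmean⟩ := exists_memSobolevC_sub_mean hΩ hΩb hε hβ hc
  set k : ℝ → Space n → ℝ := fun t x => f t x - w t x with hk
  have hfP : MemLp (Function.uncurry f) 2 (cylinder T P) :=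
    hf.mono_measure (Measure.prod_mono le_rfl (Measure.restrict_mono hPD le_rfl))
  have hkL : MemLp (Function.uncurry k) 2 (cylinder T P) := hfP.sub hw
  obtain ⟨hmL, hmle⟩ := exists_eLpNorm_mean_le hPD hs hkL
  have hcyl : cylinder T Ω ≤ cylinder T P :=
    Measure.prod_mono le_rfl (Measure.restrict_mono hΩP le_rfl)
  -- The factor −1/2 comes from the symmetrization of the truncated integrals, and the subtracted
  -- mean from the Neumann constraint.
  set g : ℝ → Space n → ℝ := fun t x => -(1 / 2) * (k t x - s * ∫ y in P, k t y) with hg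
  have hgL : MemLp (Function.uncurry g) 2 (cylinder T Ω) :=
    ((hkL.mono_measure hcyl).sub hmL).const_mul (-(1 / 2))
  refine ⟨fun t => energyFst β _ C (V t), w, g, ?_, isContinuousSobolev_energyFst hD hβ hC hVc,
    hasL2TimeDeriv_of_sub_eq_integral hT hΩ.measurableSet hΩP hPD hw hW hWw hzu hzW,
    ⟨?_, hgL, ?_⟩, ?_⟩
  · rw [IsVersion, ae_restrict_iff' measurableSet_Ioo]
    filter_upwards [hVu, hUu] with t h1 h2 ht
    rw [h1 ht]
    exact h2 ht
  · filter_upwards [hu.memL2.2.1] with t ht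
    exact ⟨ht.1.1, ht.2⟩
  · rw [ae_restrict_iff' measurableSet_Ioo]
    filter_upwards [hae, hUu, hFf, hWw] with t h1 h2 h3 h4 ht φ hφ
    have ht' := Ioo_subset_Icc_self ht
    have hlim := tendsto_truncatedOperator ha hΩ hε hT hβ hb hβS ht'
      (memSobolev_congr hD hβ (h2 ht) (memSobolev_energyFst hD hβ (U t))) hφ
    rw [nonlocalForm_eq_setIntegral ha hT hΩ hε hβ hC hPm hΩP hPD (fun h => (hs h).1) ht' (h2 ht)
      (κ := F t - W t) (k := k t) ((Lp.coeFn_sub _ _).trans ((h3 ht).sub (h4 ht)))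
      (fun y => (hNM t (U t) y).symm.trans (h1 ht y)) hφ (hmean φ hφ), ← integral_const_mul] at hlim
    simpa only [hg, mul_assoc] using hlim
  · set E := energyConst aLow (|aUp| + 1) T with hE
    have hE0 : 0 < E := energyConst_pos ha.low_pos hA hT
    set S := eLpNorm (Function.uncurry f) 2 (cylinder T (totalDomain ε Ω))
      + sobolevNorm β (totalDomain ε Ω) u₀ with hS
    have hUS : ENNReal.ofReal ‖U₀‖ ≤ sobolevNorm β (totalDomain ε Ω) u₀ := by
      rw [← sobolevNorm_congr hD hβ (Lp.aestronglyMeasurable _) hU₀]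
      exact le_sobolevNorm_energyFst hD hβ U₀
    have hSt : S ≠ ⊤ := by
      refine ENNReal.add_ne_top.2 ⟨hf.2.ne, ?_⟩
      rw [← sobolevNorm_congr hD hβ (Lp.aestronglyMeasurable _) hU₀]
      exact ((sobolevNorm_energyFst_le hD hβ U₀).trans_lt ENNReal.ofReal_lt_top).ne
    set σ := S.toReal with hσ
    have hσS : ENNReal.ofReal σ = S := ENNReal.ofReal_toReal hSt
    have hU₀σ : ‖U₀‖ ≤ σ := by
      rw [← ENNReal.ofReal_le_ofReal_iff ENNReal.toReal_nonneg, hσS]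
      exact hUS.trans le_add_self
    -- The sum of the squares of two nonnegative numbers is at most the square of their sum. Keeping
    -- −‖U₀‖² here leads to the total 2σ² for the data below.
    have hFσ : ∫ t in (0 : ℝ)..T, ‖F t‖ ^ 2 ≤ σ ^ 2 - ‖U₀‖ ^ 2 := by
      have h1 : ENNReal.ofReal (∫ t in (0 : ℝ)..T, ‖F t‖ ^ 2)
          ≤ eLpNorm (Function.uncurry f) 2 (cylinder T (totalDomain ε Ω)) ^ 2 := by
        rw [ofReal_integral_norm_sq hT (hsol.memLp_rhs.restrict _),
          ← eLpNorm_uncurry_sq (by rw [cylinder_restrict hPD]; exact hfP.1) hFf,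
          cylinder_restrict hPD]
        have hmono : cylinder T P ≤ cylinder T (totalDomain ε Ω) :=
          Measure.prod_mono le_rfl (Measure.restrict_mono hPD le_rfl)
        exact pow_le_pow_left' (eLpNorm_mono_measure _ hmono) 2
      set ρ := (eLpNorm (Function.uncurry f) 2 (cylinder T (totalDomain ε Ω))).toReal with hρ
      have hρ0 : 0 ≤ ρ := ENNReal.toReal_nonneg
      rw [← ENNReal.ofReal_toReal hf.2.ne, ← ENNReal.ofReal_pow hρ0,
        ENNReal.ofReal_le_ofReal_iff (by positivity)] at h1
      have h2 : ρ + ‖U₀‖ ≤ σ := by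
        rw [← ENNReal.ofReal_le_ofReal_iff ENNReal.toReal_nonneg, hσS,
          ENNReal.ofReal_add hρ0 (norm_nonneg _), ENNReal.ofReal_toReal hf.2.ne]
        exact add_le_add le_rfl hUS
      have h3 := pow_le_pow_left₀ (by positivity) h2 2
      nlinarith [mul_nonneg hρ0 (norm_nonneg U₀)]
    -- Only aLow, |aUp| + 1 and T enter this constant. The constants of the splitting, which may
    -- depend on β, do not reach the estimate.
    have hbound := hsol.energy_bound hF hT hI hW hzW hVz hVc (q := horizonEnergy β ε Ω C)
      ha.low_pos hA (continuous_horizonEnergy hD) horizonEnergy_nonneg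
      (fun t' t htt x => by
        rw [hNM, hNM]
        have h1 := diffusionForm_sub_le ha hT hD htt x
        have h2 := mul_nonneg (sub_nonneg.2 htt) (horizonEnergy_nonneg x)
        linarith)
      (fun t x => by rw [hNM]; exact le_diffusionForm ha hT hD t x)
      (fun t x => by
        rw [hNM]
        have h1 := diffusionForm_le ha hT hD t x
        have h2 := horizonEnergy_nonneg x
        linarith)
    have hdata : horizonEnergy β ε Ω C U₀
        + ‖restrictTo (totalDomain ε Ω) P (energyFst β _ C U₀)‖ ^ 2
        + ∫ t in (0 : ℝ)..T, ‖F t‖ ^ 2 ≤ 2 * σ ^ 2 := by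
      have h1 := horizonEnergy_le U₀
      have h2 := pow_le_pow_left₀ (norm_nonneg _)
        ((norm_restrictTo_le hPD (energyFst β _ C U₀)).trans (norm_energyFst_le U₀)) 2
      have h3 := pow_le_pow_left₀ (norm_nonneg _) hU₀σ 2
      linarith
    have hb' : ∀ r ∈ Icc 0 T, horizonEnergy β ε Ω C (V r)
        + ‖restrictTo (totalDomain ε Ω) P (z r)‖ ^ 2 + ∫ t in (0 : ℝ)..T, ‖W t‖ ^ 2
        ≤ 2 * E * σ ^ 2 := fun r hr => by
      refine (hbound r hr).trans ?_
      have := mul_le_mul_of_nonneg_left hdata hE0.le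
      linarith
    have hW0 : 0 ≤ ∫ t in (0 : ℝ)..T, ‖W t‖ ^ 2 :=
      intervalIntegral.integral_nonneg hT.le fun t _ => sq_nonneg _
    have hVσ : ∀ r ∈ Icc 0 T, sobolevNorm β (totalDomain ε Ω) (energyFst β _ C (V r))
        ≤ ENNReal.ofReal (2 * √(G * (2 * E))) * S := fun r hr => by
      have h1 := hG C hC' (V r)
      rw [hVz r hr] at h1
      have h2 : ‖V r‖ ≤ √(G * (2 * E)) * σ := by
        refine le_sqrt_mul_of_sq_le (by positivity) ENNReal.toReal_nonneg (h1.trans ?_)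
        rw [mul_assoc]
        exact mul_le_mul_of_nonneg_left (by linarith [hb' r hr]) hG0.le
      refine (sobolevNorm_energyFst_le hD hβ _).trans ?_
      rw [← hσS, ← ENNReal.ofReal_mul (by positivity)]
      exact ENNReal.ofReal_le_ofReal (by linarith)
    have hwσ : eLpNorm (Function.uncurry w) 2 (cylinder T P) ≤ ENNReal.ofReal √(2 * E) * S := by
      refine (ENNReal.pow_le_pow_left_iff two_ne_zero).1 ?_
      rw [← hσS, ← ENNReal.ofReal_mul (Real.sqrt_nonneg _), ← ENNReal.ofReal_pow (by positivity),
        mul_pow, Real.sq_sqrt (by positivity), ← cylinder_restrict hPD,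
        eLpNorm_uncurry_sq (by rw [cylinder_restrict hPD]; exact hw.1) hWw,
        ← ofReal_integral_norm_sq hT (hW.restrict _)]
      refine ENNReal.ofReal_le_ofReal ?_
      have h1 := hb' 0 ⟨le_rfl, hT.le⟩
      have h2 := horizonEnergy_nonneg (V 0)
      have h3 := sq_nonneg ‖restrictTo (totalDomain ε Ω) P (z 0)‖
      linarith
    have hwΩ : eLpNorm (Function.uncurry w) 2 (cylinder T Ω) ≤ ENNReal.ofReal √(2 * E) * S :=
      (eLpNorm_mono_measure _ hcyl).trans hwσ
    have hkσ : eLpNorm (Function.uncurry k) 2 (cylinder T P)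
        ≤ S + ENNReal.ofReal √(2 * E) * S := by
      have h1 : eLpNorm (Function.uncurry k) 2 (cylinder T P)
          ≤ eLpNorm (Function.uncurry f) 2 (cylinder T P)
            + eLpNorm (Function.uncurry w) 2 (cylinder T P) :=
        eLpNorm_sub_le hfP.1 hw.1 (by norm_num)
      refine h1.trans (add_le_add ?_ hwσ)
      exact (eLpNorm_mono_measure _ (Measure.prod_mono le_rfl
        (Measure.restrict_mono hPD le_rfl))).trans le_self_add
    have hgσ : eLpNorm (Function.uncurry g) 2 (cylinder T Ω)
        ≤ S + ENNReal.ofReal √(2 * E) * S := by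
      have h1 : Function.uncurry g = (-(1 / 2) : ℝ) • (Function.uncurry k
          - Function.uncurry fun t (_ : Space n) => s * ∫ y in P, k t y) := rfl
      -- The function and its mean each contribute at most the norm of k, and the factor 1/2 of g
      -- cancels the resulting 2.
      have h2 : eLpNorm (Function.uncurry k - Function.uncurry fun t (_ : Space n) =>
          s * ∫ y in P, k t y) 2 (cylinder T Ω) ≤ 2 * eLpNorm (Function.uncurry k) 2 (cylinder T P) := by
        refine (eLpNorm_sub_le (hkL.mono_measure hcyl).1 hmL.1 (by norm_num)).trans ?_
        rw [two_mul]
        exact add_le_add (eLpNorm_mono_measure _ hcyl) hmle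
      refine le_trans ?_ hkσ
      rw [h1, eLpNorm_const_smul]
      refine (mul_le_mul_right h2 _).trans ?_
      rw [← mul_assoc]
      have h3 : ‖(-(1 / 2) : ℝ)‖ₑ * 2 = 1 := by
        rw [enorm_neg, one_div, Real.enorm_of_nonneg (by positivity), ENNReal.ofReal_inv_of_pos two_pos]
        simpa using ENNReal.inv_mul_cancel two_ne_zero ENNReal.ofNat_ne_top
      rw [h3, one_mul]
    rw [ENNReal.ofReal_add (by positivity) zero_le_one, ENNReal.ofReal_add (by positivity)
      (by positivity), two_mul √(2 * E), ENNReal.ofReal_add (by positivity) (by positivity),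
      ENNReal.ofReal_one]
    refine (add_le_add (add_le_add (iSup₂_le hVσ) hwΩ) hgσ).trans (le_of_eq ?_)
    ring

end Estimates

end NonlocalDiffusion

end


theorem theorem2p3 {n : ℕ} (hn : 0 < n)
    (Ω : Set (Space n)) (hΩ : IsOpen Ω) (hΩb : Bornology.IsBounded Ω)
    (ε : ℝ≥0∞) (hε : 0 < ε) (T : ℝ) (hT : 0 < T)
    (a : ℝ → Space n → Space n → Matrix (Fin n) (Fin n) ℝ) (aLow aUp : ℝ)
    (ha : AdmissibleTensor ε Ω T a aLow aUp) :
    ∃ C : ℝ, 0 < C ∧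
      ∀ (β : Space n → ℝ) (βLow βUp : ℝ), ContinuousOn β (totalDomain ε Ω) →
        0 < βLow → βUp < 1 → (∀ x ∈ totalDomain ε Ω, βLow ≤ β x ∧ β x ≤ βUp) →
      ∀ c : Constraint, (c = .neumann → ε ≠ ⊤) →
      ∀ P : Set (Space n), (P = Ω ∨ P = totalDomain ε Ω) →
      ∀ (u₀ : Space n → ℝ) (f u : ℝ → Space n → ℝ),
        MemSobolevC c β ε Ω u₀ →
        MemLp (Function.uncurry f) 2 (cylinder T (totalDomain ε Ω)) →
        IsWeakSolution c β ε Ω P T a f u₀ u →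
        ∃ v w g : ℝ → Space n → ℝ,
          IsVersion T (totalDomain ε Ω) v u ∧
          IsContinuousSobolev c β ε Ω T v ∧
          HasL2TimeDeriv Ω T u w ∧
          MemTildeSpace c β ε Ω T a u g ∧
          (⨆ t ∈ Icc 0 T, sobolevNorm β (totalDomain ε Ω) (v t))
              + eLpNorm (Function.uncurry w) 2 (cylinder T Ω)
              + eLpNorm (Function.uncurry g) 2 (cylinder T Ω)
            ≤ ENNReal.ofReal C *
              (eLpNorm (Function.uncurry f) 2 (cylinder T (totalDomain ε Ω))
                + sobolevNorm β (totalDomain ε Ω) u₀) := by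
  obtain ⟨G, hG0, hG⟩ := exists_norm_sq_le_horizonEnergy hΩ hΩb hε
  -- The three summands are the trajectory norm, with G converting horizon energy into the full
  -- norm; two copies of the bound for ∂ₜu, one for itself and one inside g; and 1 for the
  -- contribution of f to g.
  refine ⟨2 * √(G * (2 * energyConst aLow (|aUp| + 1) T))
    + 2 * √(2 * energyConst aLow (|aUp| + 1) T) + 1, by positivity, ?_⟩
  intro β βLow βUp hβ hβLow hβUp hβS c hc P hP u₀ f u hu₀ hf hu
  have hD : MeasurableSet (totalDomain ε Ω) := (isOpen_totalDomain hΩ hε).measurableSet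
  have hβS' : ∀ x ∈ totalDomain ε Ω, βLow ≤ β x ∧ β x ≤ 1 := fun x hx =>
    ⟨(hβS x hx).1, (hβS x hx).2.trans hβUp.le⟩
  have hPD : MeasurableSet P ∧ Ω ⊆ P ∧ P ⊆ totalDomain ε Ω := by
    rcases hP with rfl | rfl
    · exact ⟨hΩ.measurableSet, Subset.rfl, subset_union_left⟩
    · exact ⟨hD, subset_union_left, Subset.rfl⟩
  exact hu.exists_regular_version hΩ hΩb hε hT ha hβ hβLow hβS' hc hPD.1 hPD.2.1 hPD.2.2 hG0
    (fun C hC => hG β hβ (fun x hx => ⟨hβLow.le.trans (hβS' x hx).1, (hβS' x hx).2⟩) c hc C hC P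
      hPD.2.1 hPD.2.2) hu₀ hf
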